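/- **Theorem (Coded Service Capacity Region).** *System.* There are $n$ servers and $k$ job types. A set $S_{\rm coded}$ of $n_{\rm coded}<n$ servers is coded; the other servers are split into disjoint sets $S_1,\dots,S_k$ of systematic servers with $|S_i|=\alpha_i(n-n_{\rm coded})$, where $0<\alpha_i<1$ and $\sum_i\alpha_i=1$. The recovery sets of type $i$ (their set is denoted by $R_i$) are: (1) $\{\ell\}$ with $\ell\in S_i$; (2) any $k$ coded servers; (3) any $k_1$ coded servers together with $k-k_1$ systematic servers of pairwise distinct types different from $i$, where $1\le k_1<k$. *Dynamics.* The system is empty at time $0$. Jobs of type $i$ arrive according to a Poisson process of rate $\lambda_i\ge 0$, independently for the different types. Upon arrival, a job of type $i$ is assigned to a recovery set in $R_i$ by a routing policy, that is, by a measurable non-anticipating rule, which may use independent random numbers and everything observed up to the arrival (types and times of arrivals, earlier assignments, task departures so far). One task of the job is sent to each server of the assigned set. Every server serves its tasks first-come-first-served, the service times are i.i.d. exponential of rate $1$ and independent of the arrivals, and the job is completed when all its tasks are. The system is *stable* if $$\lim_{c\to\infty}\lim_{t\to\infty}\mathbb P(\text{number of jobs in the system at time } t>c)=0$$ (the inner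 limits being required to exist). Let $\mathcal S$ be the set of the $\lambda\in[0,\infty)^k$ for which some routing policy makes the system stable. The *service capacity region* is the closure of $\mathcal S$. *Claim.* Let $$\Lambda_{\rm coded}=\Big\{\lambda\in\mathbb R^k:\ \exists\,\lambda_{i,R}\ge 0\ (1\le i\le k,\ R\in R_i)\ \text{ with }\ \lambda_i=\sum_{R\in R_i}\lambda_{i,R}\ \ \forall i,\quad \sum_{i=1}^k\ \sum_{R\in R_i:\ \ell\in R}\lambda_{i,R}\le 1\ \ \text{for every server } \ell\Big\}.$$ 1. The service capacity region is $\Lambda_{\rm coded}$. Moreover, for every $\lambda$ in the interior of $\Lambda_{\rm coded}$ some routing policy makes the system stable, and for $\lambda\in[0,\infty)^k\setminus\Lambda_{\rm coded}$ no routing policy does. 2. Suppose that $n_{\rm coded}\ge k$ or $n_{\rm coded}=0$. For $\lambda\in[0,\infty)^k$ put $r_i=\alpha_i(n-n_{\rm coded})-\lambda_i$, $r_i^+=\max\{r_i,0\}$, $r_i^-=-\min\{r_i,0\}$, and let the types be numbered such that $r_1\le r_2\le\dots\le r_k$. Then $$\lambda\in\Lambda_{\rm coded}\iff \min_{k_0\in\{1,\dots,k\}}\frac{n_{\rm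 coded}+\sum_{i=1}^{k_0}r_i^+}{k_0}\ \ge\ \sum_{i=1}^k r_i^-.$$ -/

import Mathlib

open MeasureTheory ProbabilityTheory Filter Topology Set
open scoped ENNReal NNReal

namespace CodedCloud

noncomputable section

/-! ### The coded multi-access system and its recovery sets -/

/-- A coded multi-access system with `n` servers and `k` job types. `kind ℓ = none` means that
server `ℓ` is a coded server, and `kind ℓ = some i` that it is a systematic server of type `i`.
A fraction `α i` of the systematic servers is dedicated to type `i`. -/
structure CodedSystem (n k : ℕ) where
  kind : Fin n → Option (Fin k)
  α : Fin k → ℝ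
  α_pos : ∀ i, 0 < α i
  α_lt_one : ∀ i, α i < 1
  α_sum : ∑ i, α i = 1
  coded_lt : (Finset.univ.filter fun ℓ => kind ℓ = none).card < n
  card_systematic : ∀ i, ((Finset.univ.filter fun ℓ => kind ℓ = some i).card : ℝ)
    = α i * ((n : ℝ) - ((Finset.univ.filter fun ℓ => kind ℓ = none).card : ℝ))

namespace CodedSystem

variable {n k : ℕ} (M : CodedSystem n k)

/-- The set of coded servers. -/
def coded : Finset (Fin n) := Finset.univ.filter fun ℓ => M.kind ℓ = none

/-- The set of systematic servers of type `i`. -/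
def systematic (i : Fin k) : Finset (Fin n) := Finset.univ.filter fun ℓ => M.kind ℓ = some i

/-- The number of coded servers. -/
def nCoded : ℕ := M.coded.card

/-- `R` can serve a job of type `i`: it is a single systematic server of type `i`, or `k` coded
servers, or `k₁` coded servers with `1 ≤ k₁ < k` and `k - k₁` systematic servers of pairwise
distinct types different from `i`. -/
def IsRecoverySet (i : Fin k) (R : Finset (Fin n)) : Prop :=
  (∃ ℓ ∈ M.systematic i, R = {ℓ}) ∨
  (R ⊆ M.coded ∧ R.card = k) ∨
  (R.card = k ∧ 1 ≤ (R ∩ M.coded).card ∧ (R ∩ M.coded).card < k ∧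
    (∀ ℓ ∈ R, ℓ ∉ M.systematic i) ∧
    ∀ ℓ ∈ R \ M.coded, ∀ ℓ' ∈ R \ M.coded, M.kind ℓ = M.kind ℓ' → ℓ = ℓ')

open Classical in
/-- The set of recovery sets of type `i`. -/
def recoverySets (i : Fin k) : Finset (Finset (Fin n)) :=
  Finset.univ.filter fun R => M.IsRecoverySet i R

/-- The vectors of arrival rates that split into nonnegative rates over the recovery sets in such
a way that the total task rate at every server is at most `1`. -/
def codedRegion : Set (Fin k → ℝ) :=
  {lam | ∃ x : Fin k → Finset (Fin n) → ℝ,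
    (∀ i, ∀ R ∈ M.recoverySets i, 0 ≤ x i R) ∧
    (∀ i, lam i = ∑ R ∈ M.recoverySets i, x i R) ∧
    ∀ ℓ : Fin n, ∑ i, ∑ R ∈ (M.recoverySets i).filter (fun R => ℓ ∈ R), x i R ≤ 1}

/-- The residual capacity of type `i`. -/
def residual (lam : Fin k → ℝ) (i : Fin k) : ℝ :=
  M.α i * ((n : ℝ) - (M.nCoded : ℝ)) - lam i

end CodedSystem

/-! ### The random inputs: Poisson arrivals, exponential service times, random numbers -/

/-- The law of an exponential time of rate `r`; at rate `0` the time is infinite. -/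
def expTime (r : ℝ) : Measure ℝ≥0∞ :=
  if 0 < r then (expMeasure r).map ENNReal.ofReal else Measure.dirac ⊤

instance (r : ℝ) : IsProbabilityMeasure (expTime r) := by
  unfold expTime
  split_ifs with h
  · have := isProbabilityMeasure_expMeasure h
    exact Measure.isProbabilityMeasure_map ENNReal.measurable_ofReal.aemeasurable
  · infer_instance

/-- The random inputs of a system with `n` servers and `k` job types. -/
structure Input (n k : ℕ) where
  /-- `gap (i, q)` is the time between the arrivals of jobs `q - 1` and `q` of type `i`
  (counted from time `0` for `q = 0`). -/
  gap : Fin k × ℕ → ℝ≥0∞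
  /-- `service (m, ℓ)` is the time that the `m`-th arriving job needs at server `ℓ`. -/
  service : ℕ × Fin n → ℝ≥0∞
  /-- A random number that the routing policy may use for the `m`-th arriving job. -/
  coin : ℕ → unitInterval

/-- The sample space, in product form. -/
abbrev Sample (n k : ℕ) : Type :=
  (Fin k × ℕ → ℝ≥0∞) × (ℕ × Fin n → ℝ≥0∞) × (ℕ → unitInterval)

/-- The inputs that belong to a sample point. -/
def Sample.input {n k : ℕ} (ω : Sample n k) : Input n k := ⟨ω.1, ω.2.1, ω.2.2⟩

/-- All inputs are independent. Jobs of type `i` form a Poisson process of rate `lam i` (the gaps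
are exponential of rate `lam i`), service times are exponential of rate `1`, and the random
numbers of the policy are uniform on `[0, 1]`. -/
def sampleLaw (n : ℕ) {k : ℕ} (lam : Fin k → ℝ) : Measure (Sample n k) :=
  (Measure.infinitePi fun p : Fin k × ℕ => expTime (lam p.1)).prod
    ((Measure.infinitePi fun _ : ℕ × Fin n => expTime 1).prod
      (Measure.infinitePi fun _ : ℕ => (volume : Measure unitInterval)))

namespace Input

variable {n k : ℕ} (I : Input n k)

/-- The arrival time of job `q` of type `i`. -/
def typeArrival (i : Fin k) (q : ℕ) : ℝ≥0∞ := ∑ j ∈ Finset.range (q + 1), I.gap (i, j)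

/-- If `c i` jobs of every type `i` have arrived, then the next job to arrive is of this type
(the least one, in the null event of a tie). -/
def nextType [NeZero k] (c : Fin k → ℕ) : Fin k :=
  (Finset.univ.filter fun i => ∀ j, I.typeArrival i (c i) ≤ I.typeArrival j (c j)).min' (by
    obtain ⟨i, _, hi⟩ := Finset.exists_min_image (Finset.univ : Finset (Fin k))
      (fun i => I.typeArrival i (c i)) Finset.univ_nonempty
    exact ⟨i, by simpa using fun j => hi j (Finset.mem_univ j)⟩)

/-- The number of jobs of each type among the first `m` arriving jobs. -/
def counts [NeZero k] : ℕ → Fin k → ℕ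
  | 0 => fun _ => 0
  | m + 1 => Function.update (counts m) (I.nextType (counts m))
      (counts m (I.nextType (counts m)) + 1)

/-- The type of the `m`-th arriving job. -/
def jobType [NeZero k] (m : ℕ) : Fin k := I.nextType (I.counts m)

/-- The arrival time of the `m`-th arriving job. -/
def jobArrival [NeZero k] (m : ℕ) : ℝ≥0∞ := I.typeArrival (I.jobType m) (I.counts m (I.jobType m))

end Input

/-! ### Routing policies and the queueing dynamics -/

/-- What a routing policy knows when the `m`-th job arrives at time `A`: type, arrival time and
random number of the jobs `0, …, m`, and, for each of the jobs `0, …, m - 1`, the recovery set to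
which it was sent and, for each server, the minimum of `A` and the time at which its task left
that server (so the departures before `A` are known, and nothing about those after `A`). -/
abbrev History (n k m : ℕ) : Type :=
  (Fin (m + 1) → Fin k × ℝ≥0∞ × unitInterval) × (Fin m → Finset (Fin n) × (Fin n → ℝ≥0∞))

/-- A routing policy assigns a recovery set to every arriving job upon its arrival, as a
measurable function of the history. -/
structure Policy {n k : ℕ} (M : CodedSystem n k) where
  route : ∀ m, History n k m → Finset (Fin n)
  measurable_route : ∀ m, Measurable (route m)
  route_mem : ∀ m (h : History n k m), route m h ∈ M.recoverySets (h.1 (Fin.last m)).1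

namespace Policy

variable {n k : ℕ} [NeZero k] {M : CodedSystem n k} (π : Policy M) (I : Input n k)

/-- The history at the arrival of job `m`, if `past` records for every earlier job the recovery
set to which it was sent and the times at which its tasks left the servers. -/
def historyOf (I : Input n k) (m : ℕ) (past : Fin m → Finset (Fin n) × (Fin n → ℝ≥0∞)) :
    History n k m :=
  (fun j => (I.jobType j, I.jobArrival j, I.coin j),
    fun j => ((past j).1, fun ℓ => min ((past j).2 ℓ) (I.jobArrival m)))

/-- The time at which server `ℓ` has finished all the tasks recorded in `past`. -/
def freeAt {m : ℕ} (past : Fin m → Finset (Fin n) × (Fin n → ℝ≥0∞)) (ℓ : Fin n) : ℝ≥0∞ :=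
  (Finset.univ.filter fun j => ℓ ∈ (past j).1).sup fun j => (past j).2 ℓ

/-- The record of job `m`. Servers are first-come-first-served: the task of job `m` at a server
`ℓ` of its recovery set starts when the job has arrived and the earlier tasks at `ℓ` are finished.
At the other servers the job has no task (its departure time there is its arrival time). -/
def serve (m : ℕ) (past : Fin m → Finset (Fin n) × (Fin n → ℝ≥0∞)) :
    Finset (Fin n) × (Fin n → ℝ≥0∞) :=
  (π.route m (historyOf I m past), fun ℓ =>
    if ℓ ∈ π.route m (historyOf I m past) then
      max (I.jobArrival m) (freeAt past ℓ) + I.service (m, ℓ)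
    else I.jobArrival m)

/-- The records of the first `m` jobs. -/
def records : (m : ℕ) → Fin m → Finset (Fin n) × (Fin n → ℝ≥0∞)
  | 0 => Fin.elim0
  | m + 1 => Fin.snoc (α := fun _ => Finset (Fin n) × (Fin n → ℝ≥0∞)) (records m)
      (π.serve I m (records m))

/-- The recovery set to which the `m`-th arriving job is sent. -/
def jobRoute (m : ℕ) : Finset (Fin n) := (π.serve I m (π.records I m)).1

/-- The time at which the task of the `m`-th arriving job leaves server `ℓ`. -/
def taskDeparture (m : ℕ) (ℓ : Fin n) : ℝ≥0∞ := (π.serve I m (π.records I m)).2 ℓ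

/-- The time at which all tasks of the `m`-th arriving job are completed. -/
def jobCompletion (m : ℕ) : ℝ≥0∞ := (π.jobRoute I m).sup (π.taskDeparture I m)

/-- The number of jobs in the system at time `t`. -/
def jobsInSystem (t : ℝ≥0) : ℕ∞ :=
  {m : ℕ | I.jobArrival m ≤ (t : ℝ≥0∞) ∧ (t : ℝ≥0∞) < π.jobCompletion I m}.encard

/-- Stability: `lim_{c → ∞} lim_{t → ∞} P(number of jobs in the system at time t > c) = 0`,
where the inner limits exist. -/
def IsStable (lam : Fin k → ℝ) : Prop :=
  ∃ L : ℕ → ℝ≥0∞,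
    (∀ c : ℕ, Tendsto
      (fun t : ℝ≥0 => sampleLaw n lam {ω | (c : ℕ∞) < π.jobsInSystem ω.input t})
      atTop (𝓝 (L c))) ∧
    Tendsto L atTop (𝓝 0)

end Policy

namespace CodedSystem

variable {n k : ℕ} [NeZero k] (M : CodedSystem n k)

/-- The vectors of arrival rates under which some routing policy makes the system stable. -/
def stabilizable : Set (Fin k → ℝ) :=
  {lam | (∀ i, 0 ≤ lam i) ∧ ∃ π : Policy M, π.IsStable lam}

/-- The service capacity region, which consists of all supportable arrival rates up to its
boundary. -/
def serviceCapacityRegion : Set (Fin k → ℝ) := closure M.stabilizable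

end CodedSystem

end

end CodedCloud

namespace CodedCloud

/-! ### The polyhedral region -/

namespace CodedSystem

variable {n k : ℕ} (M : CodedSystem n k)

lemma mem_recoverySets {i : Fin k} {R : Finset (Fin n)} :
    R ∈ M.recoverySets i ↔ M.IsRecoverySet i R := by
  simp [recoverySets]

lemma mem_systematic {i : Fin k} {ℓ : Fin n} : ℓ ∈ M.systematic i ↔ M.kind ℓ = some i := by
  simp [systematic]

lemma mem_coded {ℓ : Fin n} : ℓ ∈ M.coded ↔ M.kind ℓ = none := by
  simp [coded]

lemma card_systematic' (i : Fin k) :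
    ((M.systematic i).card : ℝ) = M.α i * ((n : ℝ) - M.nCoded) := M.card_systematic i

lemma nCoded_lt : (M.nCoded : ℝ) < n := by exact_mod_cast M.coded_lt

lemma card_systematic_pos (i : Fin k) : 0 < ((M.systematic i).card : ℝ) := by
  rw [M.card_systematic']
  exact mul_pos (M.α_pos i) (sub_pos.2 M.nCoded_lt)

lemma systematic_nonempty (i : Fin k) : (M.systematic i).Nonempty :=
  Finset.card_pos.1 (by exact_mod_cast M.card_systematic_pos i)

lemma nonempty_of_mem_recoverySets [NeZero k] {i : Fin k} {R : Finset (Fin n)}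
    (h : R ∈ M.recoverySets i) : R.Nonempty := by
  rcases M.mem_recoverySets.1 h with ⟨ℓ, -, rfl⟩ | ⟨-, h⟩ | ⟨h, -⟩
  · exact Finset.singleton_nonempty ℓ
  all_goals exact Finset.card_pos.1 (h ▸ Nat.pos_of_neZero k)

lemma singleton_mem_recoverySets {i : Fin k} {ℓ : Fin n} (h : ℓ ∈ M.systematic i) :
    {ℓ} ∈ M.recoverySets i :=
  M.mem_recoverySets.2 (Or.inl ⟨ℓ, h, rfl⟩)

lemma nonneg_of_mem_codedRegion {lam : Fin k → ℝ} (h : lam ∈ M.codedRegion) (i : Fin k) :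
    0 ≤ lam i := by
  obtain ⟨x, h0, h1, -⟩ := h
  rw [h1]
  exact Finset.sum_nonneg (h0 i)

lemma convex_codedRegion : Convex ℝ M.codedRegion := by
  rintro a ⟨x, hx0, hx1, hx2⟩ b ⟨y, hy0, hy1, hy2⟩ s t hs ht hst
  refine ⟨fun i R => s * x i R + t * y i R, fun i R hR => ?_, fun i => ?_, fun ℓ => ?_⟩
  · have := hx0 i R hR
    have := hy0 i R hR
    positivity
  · simp [hx1, hy1, Finset.sum_add_distrib, Finset.mul_sum]
  · simp only [Finset.sum_add_distrib, ← Finset.mul_sum]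
    nlinarith [hx2 ℓ, hy2 ℓ]

lemma isClosed_codedRegion [NeZero k] : IsClosed M.codedRegion := by
  classical
  let f : (Fin k → Finset (Fin n) → ℝ) → Fin k → ℝ := fun x i => ∑ R ∈ M.recoverySets i, x i R
  let K : Set (Fin k → Finset (Fin n) → ℝ) :=
    (Set.univ.pi fun _ => Set.univ.pi fun _ => Set.Icc 0 1) ∩
      {x | ∀ ℓ : Fin n, ∑ i, ∑ R ∈ (M.recoverySets i).filter (fun R => ℓ ∈ R), x i R ≤ 1}
  have hK : IsCompact K := by
    refine IsCompact.inter_right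
      (isCompact_univ_pi fun _ => isCompact_univ_pi fun _ => isCompact_Icc) ?_
    simp only [Set.ofPred_forall]
    exact isClosed_iInter fun ℓ => isClosed_le (by fun_prop) continuous_const
  have hf : Continuous f := by fun_prop
  have : M.codedRegion = f '' K := by
    ext lam
    constructor
    · rintro ⟨x, h0, h1, h2⟩
      refine ⟨fun i R => if R ∈ M.recoverySets i then x i R else 0, ⟨?_, fun ℓ => ?_⟩, ?_⟩
      · rintro i - R -
        dsimp only
        split_ifs with hR
        · refine ⟨h0 i R hR, ?_⟩
          obtain ⟨ℓ, hℓ⟩ := M.nonempty_of_mem_recoverySets hR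
          refine le_trans ?_ (h2 ℓ)
          have hn : ∀ j, 0 ≤ ∑ R ∈ (M.recoverySets j).filter (fun R => ℓ ∈ R), x j R :=
            fun j => Finset.sum_nonneg fun R hR => h0 j R (Finset.mem_filter.1 hR).1
          refine le_trans ?_ (Finset.single_le_sum (fun j _ => hn j) (Finset.mem_univ i))
          exact Finset.single_le_sum (f := fun R => x i R)
            (fun R hR => h0 i R (Finset.mem_filter.1 hR).1) (Finset.mem_filter.2 ⟨hR, hℓ⟩)
        · simp
      · refine le_trans (le_of_eq ?_) (h2 ℓ)
        refine Finset.sum_congr rfl fun i _ => Finset.sum_congr rfl fun R hR => ?_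
        exact if_pos (Finset.mem_filter.1 hR).1
      · funext i
        rw [h1 i]
        exact Finset.sum_congr rfl fun R hR => if_pos hR
    · rintro ⟨x, ⟨hx, h2⟩, rfl⟩
      exact ⟨x, fun i R _ => (hx i trivial R trivial).1, fun i => rfl, h2⟩
  rw [this]
  exact (hK.image hf).isClosed

lemma mem_codedRegion_of_le {lam mu : Fin k → ℝ} (h : lam ∈ M.codedRegion)
    (h0 : ∀ i, 0 ≤ mu i) (hle : ∀ i, mu i ≤ lam i) : mu ∈ M.codedRegion := by
  have hlam := M.nonneg_of_mem_codedRegion h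
  obtain ⟨x, hx0, hx1, hx2⟩ := h
  refine ⟨fun i R => mu i / lam i * x i R, fun i R hR => ?_, fun i => ?_, fun ℓ => ?_⟩
  · exact mul_nonneg (div_nonneg (h0 i) (hlam i)) (hx0 i R hR)
  · rw [← Finset.mul_sum, ← hx1]
    rcases eq_or_ne (lam i) 0 with h | h
    · rw [h, mul_zero]
      exact le_antisymm (h ▸ hle i) (h0 i)
    · rw [div_mul_cancel₀ _ h]
  · refine le_trans (Finset.sum_le_sum fun i _ => Finset.sum_le_sum fun R hR => ?_) (hx2 ℓ)
    exact mul_le_of_le_one_left (hx0 i R (Finset.mem_filter.1 hR).1)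
      (div_le_one_of_le₀ (hle i) (hlam i))

lemma one_mem_codedRegion : (fun _ => 1) ∈ M.codedRegion := by
  classical
  choose s hs using M.systematic_nonempty
  refine ⟨fun i R => if R = {s i} then 1 else 0, fun i R _ => ?_, fun i => ?_, fun ℓ => ?_⟩
  · positivity
  · rw [Finset.sum_ite_eq' _ _ fun _ => (1 : ℝ),
      if_pos (M.singleton_mem_recoverySets (hs i))]
  · have : ∀ i, ∑ R ∈ (M.recoverySets i).filter (fun R => ℓ ∈ R),
        (if R = {s i} then (1 : ℝ) else 0) = if M.kind ℓ = some i ∧ ℓ = s i then 1 else 0 := by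
      intro i
      rw [Finset.sum_ite_eq' _ _ fun _ => (1 : ℝ)]
      refine if_congr ?_ rfl rfl
      rw [Finset.mem_filter, Finset.mem_singleton]
      constructor
      · rintro ⟨-, h⟩
        exact ⟨h ▸ M.mem_systematic.1 (hs i), h⟩
      · rintro ⟨-, h⟩
        exact ⟨M.singleton_mem_recoverySets (hs i), h⟩
    rw [Finset.sum_congr rfl fun i _ => this i, Finset.sum_boole]
    norm_cast
    refine Finset.card_le_one.2 fun i hi j hj => ?_
    simp only [Finset.mem_filter, Finset.mem_univ, true_and] at hi hj
    exact Option.some_injective _ (hi.1.symm.trans hj.1)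

lemma interior_codedRegion_nonempty : (interior M.codedRegion).Nonempty := by
  refine ⟨fun _ => 1 / 2, mem_interior.2 ⟨Set.univ.pi fun _ => Set.Ioo 0 1, ?_, ?_, ?_⟩⟩
  · intro lam hlam
    exact M.mem_codedRegion_of_le M.one_mem_codedRegion (fun i => (hlam i trivial).1.le)
      fun i => (hlam i trivial).2.le
  · exact isOpen_set_pi Set.finite_univ fun _ _ => isOpen_Ioo
  · intro i _
    norm_num

lemma closure_interior_codedRegion [NeZero k] :
    closure (interior M.codedRegion) = M.codedRegion := by
  rw [M.convex_codedRegion.closure_interior_eq_closure_of_nonempty_interior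
    M.interior_codedRegion_nonempty, M.isClosed_codedRegion.closure_eq]

lemma pos_of_mem_interior {lam : Fin k → ℝ} (h : lam ∈ interior M.codedRegion) (i : Fin k) :
    0 < lam i := by
  have hc : Continuous fun t : ℝ => lam - t • Pi.single i (1 : ℝ) := by fun_prop
  have h0 : (fun t : ℝ => lam - t • Pi.single i (1 : ℝ)) 0 ∈ interior M.codedRegion := by simpa
  have := (hc.tendsto 0).eventually (isOpen_interior.mem_nhds h0)
  obtain ⟨t, ht, ht0⟩ := ((this.filter_mono nhdsWithin_le_nhds).and
    (self_mem_nhdsWithin (s := Set.Ioi (0 : ℝ)))).exists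
  have := M.nonneg_of_mem_codedRegion (interior_subset ht) i
  simp at this ht0
  linarith

lemma exists_smul_mem_of_mem_interior {lam : Fin k → ℝ} (h : lam ∈ interior M.codedRegion) :
    ∃ s : ℝ, 1 < s ∧ s • lam ∈ M.codedRegion := by
  have hc : Continuous fun t : ℝ => t • lam := by fun_prop
  have h0 : (fun t : ℝ => t • lam) 1 ∈ interior M.codedRegion := by simpa
  have := (hc.tendsto 1).eventually (isOpen_interior.mem_nhds h0)
  obtain ⟨t, ht, ht0⟩ := ((this.filter_mono nhdsWithin_le_nhds).and
    (self_mem_nhdsWithin (s := Set.Ioi (1 : ℝ)))).exists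
  exact ⟨t, ht0, interior_subset ht⟩

/-- A vector of rates is in the region if vectors with arbitrarily small violations of the
constraints are. -/
lemma mem_codedRegion_of_forall_pos [NeZero k] {lam : Fin k → ℝ} (h0 : ∀ i, 0 ≤ lam i)
    (h : ∀ ε > (0 : ℝ), ∃ x : Fin k → Finset (Fin n) → ℝ,
      (∀ i, ∀ R ∈ M.recoverySets i, 0 ≤ x i R) ∧
      (∀ i, lam i - ε ≤ ∑ R ∈ M.recoverySets i, x i R) ∧
      ∀ ℓ : Fin n, ∑ i, ∑ R ∈ (M.recoverySets i).filter (fun R => ℓ ∈ R), x i R ≤ 1 + ε) :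
    lam ∈ M.codedRegion := by
  have key : ∀ ε > (0 : ℝ), (fun i => max (lam i - ε) 0 / (1 + ε)) ∈ M.codedRegion := by
    intro ε hε
    obtain ⟨x, hx0, hx1, hx2⟩ := h ε hε
    have hε1 : 0 < 1 + ε := by linarith
    refine M.mem_codedRegion_of_le (lam := fun i => (∑ R ∈ M.recoverySets i, x i R) / (1 + ε))
      ⟨fun i R => x i R / (1 + ε), fun i R hR => div_nonneg (hx0 i R hR) hε1.le,
        fun i => Finset.sum_div _ _ _, fun ℓ => ?_⟩ (fun i => by positivity) fun i => ?_
    · simp only [← Finset.sum_div]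
      exact (div_le_one hε1).2 (hx2 ℓ)
    · gcongr
      exact max_le (hx1 i) (Finset.sum_nonneg (hx0 i))
  have hc : ContinuousAt (fun (ε : ℝ) i => max (lam i - ε) 0 / (1 + ε)) 0 := by
    refine continuousAt_pi.2 fun i => ContinuousAt.div (by fun_prop) (by fun_prop) (by norm_num)
  have hl : Tendsto (fun (ε : ℝ) i => max (lam i - ε) 0 / (1 + ε)) (𝓝[>] 0) (𝓝 lam) := by
    have := hc.tendsto.mono_left (nhdsWithin_le_nhds (s := Set.Ioi 0))
    simpa [h0] using this
  exact M.isClosed_codedRegion.mem_of_tendsto hl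
    (eventually_nhdsWithin_of_forall fun ε hε => key ε hε)

end CodedSystem

/-! ### The criterion in terms of the residual capacities -/

lemma exists_subset_card_sum_mul_le {ι : Type*} (T : Finset ι) {k : ℕ} (hk : 0 < k)
    (p w : ι → ℝ) (h0 : ∀ i ∈ T, 0 ≤ p i) (h1 : ∀ i ∈ T, p i ≤ 1) (hs : ∑ i ∈ T, p i = k) :
    ∃ A ⊆ T, A.card = k ∧ ∑ i ∈ T, w i * p i ≤ ∑ i ∈ A, w i := by
  classical
  have hkT : k ≤ T.card := by
    have := Finset.sum_le_sum h1
    rw [hs] at this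
    simpa using this
  obtain ⟨A, hA, hmax⟩ := Finset.exists_max_image (T.powersetCard k) (fun A => ∑ i ∈ A, w i)
    (Finset.powersetCard_nonempty.2 hkT)
  obtain ⟨hAT, hAk⟩ := Finset.mem_powersetCard.1 hA
  refine ⟨A, hAT, hAk, ?_⟩
  have hAne : A.Nonempty := Finset.card_pos.1 (hAk ▸ hk)
  obtain ⟨a, haA, ha⟩ := Finset.exists_min_image A w hAne
  have hb : ∀ b ∈ T \ A, w b ≤ w a := by
    intro b hb
    obtain ⟨hbT, hbA⟩ := Finset.mem_sdiff.1 hb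
    have hb' : b ∉ A.erase a := fun h => hbA (Finset.mem_of_mem_erase h)
    have hle := hmax (insert b (A.erase a)) (Finset.mem_powersetCard.2 ⟨?_, ?_⟩)
    · rw [Finset.sum_insert hb', ← Finset.add_sum_erase A w haA] at hle
      linarith
    · exact Finset.insert_subset hbT ((Finset.erase_subset _ _).trans hAT)
    · rw [Finset.card_insert_of_notMem hb', Finset.card_erase_of_mem haA, hAk]
      omega
  rw [← Finset.sum_sdiff hAT] at hs ⊢
  have e1 : ∑ i ∈ T \ A, w i * p i ≤ w a * ∑ i ∈ T \ A, p i := by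
    rw [Finset.mul_sum]
    exact Finset.sum_le_sum fun i hi =>
      mul_le_mul_of_nonneg_right (hb i hi) (h0 i (Finset.mem_sdiff.1 hi).1)
  have e2 : w a * ∑ i ∈ A, (1 - p i) ≤ ∑ i ∈ A, w i * (1 - p i) := by
    rw [Finset.mul_sum]
    exact Finset.sum_le_sum fun i hi =>
      mul_le_mul_of_nonneg_right (ha i hi) (sub_nonneg.2 (h1 i (hAT hi)))
  have e3 : ∑ i ∈ A, (1 - p i) = ∑ i ∈ T \ A, p i := by
    rw [Finset.sum_sub_distrib, Finset.sum_const, hAk, nsmul_eq_mul, mul_one, ← hs]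
    ring
  have e4 : ∑ i ∈ A, w i * (1 - p i) = ∑ i ∈ A, w i - ∑ i ∈ A, w i * p i := by
    rw [← Finset.sum_sub_distrib]
    exact Finset.sum_congr rfl fun i _ => by ring
  rw [e3] at e2
  linarith

namespace CodedSystem

lemma two_le {n k : ℕ} [NeZero k] (M : CodedSystem n k) : 2 ≤ k := by
  have h0 : k ≠ 0 := NeZero.ne k
  by_contra h
  obtain rfl : k = 1 := by omega
  have h1 := M.α_sum
  have h2 := M.α_lt_one 0
  rw [Fin.sum_univ_one] at h1
  linarith

variable {n k : ℕ} (M : CodedSystem n k)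

/-- A set of servers with at most one systematic server of every type. -/
def IsTransversal (R : Finset (Fin n)) : Prop :=
  ∀ ℓ ∈ R \ M.coded, ∀ ℓ' ∈ R \ M.coded, M.kind ℓ = M.kind ℓ' → ℓ = ℓ'

lemma sum_servers (f : Fin n → ℝ) :
    ∑ ℓ, f ℓ = ∑ ℓ ∈ M.coded, f ℓ + ∑ j, ∑ ℓ ∈ M.systematic j, f ℓ := by
  rw [← Finset.sum_fiberwise (g := M.kind), Fintype.sum_option]
  rfl

lemma card_eq_sum (R : Finset (Fin n)) :
    (R.card : ℝ) = (R ∩ M.coded).card + ∑ j, ((R ∩ M.systematic j).card : ℝ) := by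
  have := M.sum_servers fun ℓ => if ℓ ∈ R then 1 else 0
  simpa [Finset.inter_comm] using this

/-- Rates on the servers that respect the types are a mixture of transversals of size `k`. -/
lemma exists_transversal_weights (hk : 0 < k) (v : Fin n → ℝ) (h0 : ∀ ℓ, 0 ≤ v ℓ)
    (hs : ∑ ℓ, v ℓ = k) (hc : ∀ ℓ ∈ M.coded, v ℓ ≤ 1)
    (ht : ∀ j, ∑ ℓ ∈ M.systematic j, v ℓ ≤ 1) :
    ∃ W : Finset (Fin n) → ℝ, (∀ R, 0 ≤ W R) ∧ (∑ R, W R = 1) ∧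
      (∀ R, 0 < W R → R.card = k ∧ M.IsTransversal R) ∧
      ∀ ℓ, ∑ R with ℓ ∈ R, W R = v ℓ := by
  classical
  let F : Finset (Finset (Fin n)) :=
    Finset.univ.filter fun R => R.card = k ∧ M.IsTransversal R
  let ind : Finset (Fin n) → Fin n → ℝ := fun R ℓ => if ℓ ∈ R then 1 else 0
  have hind : Function.Injective ind := by
    intro R R' h
    ext ℓ
    have := congrFun h ℓ
    by_cases h1 : ℓ ∈ R <;> by_cases h2 : ℓ ∈ R' <;> simp_all [ind]
  have hmem : v ∈ convexHull ℝ ((F.image ind : Finset (Fin n → ℝ)) : Set (Fin n → ℝ)) := by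
    by_contra hv
    obtain ⟨f, u, hf, hu⟩ := geometric_hahn_banach_closed_point (convex_convexHull ℝ _)
      ((F.image ind).finite_toSet.isClosed_convexHull ℝ) hv
    let w : Fin n → ℝ := fun ℓ => f (Pi.single ℓ 1)
    have hfw : ∀ y, f y = ∑ ℓ, w ℓ * y ℓ := by
      intro y
      have := f.toLinearMap.pi_apply_eq_sum_univ y
      simp only [ContinuousLinearMap.coe_coe] at this
      rw [this]
      refine Finset.sum_congr rfl fun ℓ _ => ?_
      rw [smul_eq_mul, mul_comm]
      congr 2
      ext ℓ'
      simp [Pi.single_apply, eq_comm]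
    choose s hsS hsmax using fun j => Finset.exists_max_image _ w (M.systematic_nonempty j)
    have hks : ∀ j, M.kind (s j) = some j := fun j => M.mem_systematic.1 (hsS j)
    have hsinj : Function.Injective s := fun i j h =>
      Option.some_injective _ (by rw [← hks, ← hks, h])
    let p : Fin n → ℝ := fun ℓ => match M.kind ℓ with
      | none => v ℓ
      | some j => ∑ ℓ' ∈ M.systematic j, v ℓ'
    have hps : ∀ j, p (s j) = ∑ ℓ' ∈ M.systematic j, v ℓ' := fun j => by simp only [p, hks]
    have hpc : ∀ ℓ ∈ M.coded, p ℓ = v ℓ := fun ℓ h => by simp only [p, M.mem_coded.1 h]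
    let T : Finset (Fin n) := M.coded ∪ Finset.univ.image s
    have hdisj : Disjoint M.coded (Finset.univ.image s) := by
      rw [Finset.disjoint_left]
      intro ℓ hℓ hℓ'
      obtain ⟨j, -, rfl⟩ := Finset.mem_image.1 hℓ'
      simp [M.mem_coded, hks] at hℓ
    have hT : ∀ g : Fin n → ℝ,
        ∑ ℓ ∈ T, g ℓ = ∑ ℓ ∈ M.coded, g ℓ + ∑ j, g (s j) := by
      intro g
      rw [Finset.sum_union hdisj, Finset.sum_image fun _ _ _ _ h => hsinj h]
    obtain ⟨A, hAT, hAk, hA⟩ := exists_subset_card_sum_mul_le T hk p w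
      (fun ℓ hℓ => by
        rcases Finset.mem_union.1 hℓ with h | h
        · rw [hpc ℓ h]; exact h0 ℓ
        · obtain ⟨j, -, rfl⟩ := Finset.mem_image.1 h
          rw [hps]; exact Finset.sum_nonneg fun ℓ _ => h0 ℓ)
      (fun ℓ hℓ => by
        rcases Finset.mem_union.1 hℓ with h | h
        · rw [hpc ℓ h]; exact hc ℓ h
        · obtain ⟨j, -, rfl⟩ := Finset.mem_image.1 h
          rw [hps]; exact ht j)
      (by
        rw [hT, ← hs, M.sum_servers, Finset.sum_congr rfl hpc]
        simp only [hps])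
    have hAF : A ∈ F := by
      refine Finset.mem_filter.2 ⟨Finset.mem_univ _, hAk, fun ℓ hℓ ℓ' hℓ' h => ?_⟩
      have key : ∀ ℓ ∈ A \ M.coded, ∃ j, s j = ℓ := by
        intro ℓ hℓ
        obtain ⟨h1, h2⟩ := Finset.mem_sdiff.1 hℓ
        rcases Finset.mem_union.1 (hAT h1) with h3 | h3
        · exact absurd h3 h2
        · obtain ⟨j, -, hj⟩ := Finset.mem_image.1 h3
          exact ⟨j, hj⟩
      obtain ⟨j, rfl⟩ := key ℓ hℓ
      obtain ⟨j', rfl⟩ := key ℓ' hℓ'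
      rw [hks, hks] at h
      rw [Option.some_injective _ h]
    have h1 := hf (ind A) (subset_convexHull ℝ _ (Finset.mem_image_of_mem ind hAF))
    have h2 : f (ind A) = ∑ ℓ ∈ A, w ℓ := by
      rw [hfw]
      simp [ind]
    have h3 : f v ≤ ∑ ℓ ∈ T, w ℓ * p ℓ := by
      rw [hfw, M.sum_servers, hT]
      refine add_le_add (le_of_eq (Finset.sum_congr rfl fun ℓ hℓ => by rw [hpc ℓ hℓ])) ?_
      refine Finset.sum_le_sum fun j _ => ?_
      rw [hps, Finset.mul_sum]
      exact Finset.sum_le_sum fun ℓ hℓ => mul_le_mul_of_nonneg_right (hsmax j ℓ hℓ) (h0 ℓ)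
    linarith
  obtain ⟨w, hw0, hw1, hw2⟩ := Finset.mem_convexHull'.1 hmem
  rw [Finset.sum_image fun _ _ _ _ h => hind h] at hw1 hw2
  have hW : ∀ (S : Finset (Fin n) → Prop) [DecidablePred S],
      ∑ R with S R, (if R ∈ F then w (ind R) else 0) = ∑ R ∈ F with S R, w (ind R) := by
    intro S _
    rw [← Finset.sum_filter, Finset.filter_filter]
    refine Finset.sum_congr ?_ fun _ _ => rfl
    ext R
    simp [and_comm]
  refine ⟨fun R => if R ∈ F then w (ind R) else 0, fun R => ?_, ?_, fun R hR => ?_, fun ℓ => ?_⟩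
  · dsimp only
    split_ifs with h
    · exact hw0 _ (Finset.mem_image_of_mem ind h)
    · exact le_rfl
  · rw [← hw1]
    simp
  · by_cases h : R ∈ F
    · exact (Finset.mem_filter.1 h).2
    · simp [h] at hR
  · rw [hW, ← hw2, Finset.sum_apply, Finset.sum_filter]
    refine Finset.sum_congr rfl fun R _ => ?_
    simp [ind]

/-- Necessity of the criterion. -/
lemma card_mul_deficit_le [NeZero k] {lam : Fin k → ℝ} (h : lam ∈ M.codedRegion)
    {K : Finset (Fin k)} (hK : K.Nonempty) :
    (K.card : ℝ) * ∑ i, -min (M.residual lam i) 0 ≤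
      M.nCoded + ∑ i ∈ K, max (M.residual lam i) 0 := by
  classical
  have hk2 := M.two_le
  obtain ⟨x, hx0, hx1, hx2⟩ := h
  set r := M.residual lam with hr
  let own : Fin k → Finset (Fin n) → Prop := fun i R => ∃ ℓ ∈ M.systematic i, R = {ℓ}
  let rest : Fin k → Finset (Finset (Fin n)) := fun i => (M.recoverySets i).filter fun R => ¬ own i R
  let z : Fin k → ℝ := fun i => ∑ R ∈ rest i, x i R
  let y : Fin k → ℝ := fun i => ∑ R ∈ (M.recoverySets i).filter (own i), x i R
  have hrest0 : ∀ i, ∀ R ∈ rest i, 0 ≤ x i R := fun i R hR => hx0 i R (Finset.mem_filter.1 hR).1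
  have hz0 : ∀ i, 0 ≤ z i := fun i => Finset.sum_nonneg (hrest0 i)
  have hyz : ∀ i, lam i = y i + z i := fun i => by
    rw [hx1]; exact (Finset.sum_filter_add_sum_filter_not _ _ _).symm
  -- the load on a set of servers
  have hload : ∀ S : Finset (Fin n),
      ∑ i, ∑ R ∈ M.recoverySets i, x i R * ((R ∩ S).card : ℝ) ≤ S.card := by
    intro S
    have := Finset.sum_le_sum (s := S) fun ℓ _ => hx2 ℓ
    rw [Finset.sum_comm] at this
    refine le_trans (le_of_eq (Finset.sum_congr rfl fun i _ => ?_)) (this.trans (by simp))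
    simp only [Finset.sum_filter]
    rw [Finset.sum_comm]
    refine Finset.sum_congr rfl fun R _ => ?_
    rw [← Finset.sum_filter, Finset.sum_const, nsmul_eq_mul, mul_comm, Finset.filter_mem_eq_inter,
      Finset.inter_comm]
  let u : Fin k → ℝ := fun j => ∑ i, ∑ R ∈ rest i, x i R * ((R ∩ M.systematic j).card : ℝ)
  have hu0 : ∀ j, 0 ≤ u j := fun j => Finset.sum_nonneg fun i _ => Finset.sum_nonneg fun R hR =>
    mul_nonneg (hrest0 i R hR) (Nat.cast_nonneg _)
  have hcoded : ∑ i, ∑ R ∈ rest i, x i R * ((R ∩ M.coded).card : ℝ) ≤ M.nCoded := by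
    refine le_trans (Finset.sum_le_sum fun i _ => ?_) (hload M.coded)
    exact Finset.sum_le_sum_of_subset_of_nonneg (Finset.filter_subset _ _)
      fun R hR _ => mul_nonneg (hx0 i R hR) (Nat.cast_nonneg _)
  have hur : ∀ j, u j ≤ r j + z j := by
    intro j
    have h1 := hload (M.systematic j)
    have h2 : u j + y j ≤ ∑ i, ∑ R ∈ M.recoverySets i, x i R * ((R ∩ M.systematic j).card : ℝ) := by
      have : y j = ∑ i, if i = j then y i else 0 := by simp
      rw [this, ← Finset.sum_add_distrib]
      refine Finset.sum_le_sum fun i _ => ?_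
      rw [← Finset.sum_filter_add_sum_filter_not (M.recoverySets i) (own i), add_comm]
      apply add_le_add _ (le_refl _)
      split_ifs with hij
      · subst hij
        refine Finset.sum_le_sum fun R hR => ?_
        obtain ⟨ℓ, hℓ, rfl⟩ := (Finset.mem_filter.1 hR).2
        rw [Finset.singleton_inter_of_mem hℓ]
        simp
      · exact Finset.sum_nonneg fun R hR =>
          mul_nonneg (hx0 i R (Finset.mem_filter.1 hR).1) (Nat.cast_nonneg _)
    have h3 : r j = (M.systematic j).card - lam j := by rw [M.card_systematic']; rfl
    rw [h3, hyz j]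
    linarith
  have hcard : ∀ i, ∀ R ∈ rest i, R.card = k ∧ ∀ j, ((R ∩ M.systematic j).card : ℝ)
      ≤ if j = i then 0 else 1 := by
    intro i R hR
    obtain ⟨hR1, hR2⟩ := Finset.mem_filter.1 hR
    rcases M.mem_recoverySets.1 hR1 with h | ⟨h1, h2⟩ | ⟨h1, -, -, h2, h3⟩
    · exact absurd h hR2
    · refine ⟨h2, fun j => ?_⟩
      have : R ∩ M.systematic j = ∅ := by
        ext ℓ
        simp only [Finset.mem_inter, Finset.notMem_empty, iff_false, not_and]
        intro hℓ hℓ'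
        have := M.mem_coded.1 (h1 hℓ)
        rw [M.mem_systematic.1 hℓ'] at this
        cases this
      rw [this]
      split_ifs <;> simp
    · refine ⟨h1, fun j => ?_⟩
      split_ifs with hij
      · subst hij
        have : R ∩ M.systematic j = ∅ := by
          ext ℓ
          simpa using h2 ℓ
        simp [this]
      · norm_cast
        refine Finset.card_le_one.2 fun ℓ hℓ ℓ' hℓ' => ?_
        simp only [Finset.mem_inter, M.mem_systematic] at hℓ hℓ'
        refine h3 ℓ ?_ ℓ' ?_ (hℓ.2.trans hℓ'.2.symm) <;> simp [M.mem_coded, hℓ, hℓ']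
  let Z : ℝ := ∑ i, z i
  have huZ : ∀ j, u j ≤ Z - z j := by
    intro j
    have : Z - z j = ∑ i, if j = i then 0 else z i := by
      have : z j = ∑ i, if j = i then z i else 0 := by simp
      rw [this, ← Finset.sum_sub_distrib]
      refine Finset.sum_congr rfl fun i _ => ?_
      split_ifs <;> simp
    rw [this]
    refine Finset.sum_le_sum fun i _ => ?_
    have : (if j = i then 0 else z i) = ∑ R ∈ rest i, x i R * if j = i then 0 else 1 := by
      split_ifs <;> simp [z]
    rw [this]
    exact Finset.sum_le_sum fun R hR =>
      mul_le_mul_of_nonneg_left ((hcard i R hR).2 j) (hrest0 i R hR)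
  have htot : (k : ℝ) * Z ≤ M.nCoded + ∑ j, u j := by
    have : (k : ℝ) * Z = ∑ i, ∑ R ∈ rest i, x i R * ((R ∩ M.coded).card : ℝ) + ∑ j, u j := by
      rw [Finset.sum_comm (s := Finset.univ) (t := Finset.univ), ← Finset.sum_add_distrib,
        Finset.mul_sum]
      refine Finset.sum_congr rfl fun i _ => ?_
      rw [Finset.sum_comm, ← Finset.sum_add_distrib, Finset.mul_sum]
      refine Finset.sum_congr rfl fun R hR => ?_
      rw [← Finset.mul_sum, ← mul_add, ← M.card_eq_sum, (hcard i R hR).1, mul_comm]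
    linarith
  have hDZ : ∑ i, -min (r i) 0 ≤ Z := by
    refine Finset.sum_le_sum fun i _ => ?_
    have := hur i
    have := hu0 i
    have := hz0 i
    rw [neg_le, le_min_iff]
    constructor <;> linarith
  -- the inequality for sets that contain all types with a negative residual
  have key : ∀ L : Finset (Fin k), L.Nonempty → (∀ i, r i < 0 → i ∈ L) →
      (L.card : ℝ) * ∑ i, -min (r i) 0 ≤ M.nCoded + ∑ i ∈ L, max (r i) 0 := by
    intro L hL hneg
    have h1 : ∑ j, u j ≤ ∑ j ∈ L, (r j + z j) + ((k - L.card) * Z - ∑ j ∈ Lᶜ, z j) := by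
      rw [← Finset.sum_add_sum_compl L]
      refine add_le_add (Finset.sum_le_sum fun j _ => hur j) ?_
      refine (Finset.sum_le_sum fun j _ => huZ j).trans (le_of_eq ?_)
      rw [Finset.sum_sub_distrib, Finset.sum_const, Finset.card_compl, nsmul_eq_mul,
        Nat.cast_sub (Finset.card_le_univ L)]
      simp
    have h2 : ∑ j ∈ L, z j ≤ Z := Finset.sum_le_sum_of_subset_of_nonneg (Finset.subset_univ _)
      fun j _ _ => hz0 j
    have h3 : 0 ≤ ∑ j ∈ Lᶜ, z j := Finset.sum_nonneg fun j _ => hz0 j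
    have h4 : ∑ i ∈ L, r i = ∑ i ∈ L, max (r i) 0 - ∑ i, -min (r i) 0 := by
      have : ∑ i, -min (r i) 0 = ∑ i ∈ L, -min (r i) 0 := by
        refine (Finset.sum_subset (Finset.subset_univ _) fun i _ hi => ?_).symm
        rw [min_eq_right (not_lt.1 fun h => hi (hneg i h)), neg_zero]
      rw [this, ← Finset.sum_sub_distrib]
      refine Finset.sum_congr rfl fun i _ => ?_
      rw [sub_neg_eq_add, max_add_min, add_zero]
    rw [Finset.sum_add_distrib, h4] at h1
    have h5 : (1 : ℝ) ≤ L.card := by exact_mod_cast Finset.card_pos.2 hL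
    nlinarith
  have hneg0 : 0 ≤ ∑ i, -min (r i) 0 :=
    Finset.sum_nonneg fun i _ => neg_nonneg.2 (min_le_right _ _)
  let K' := K ∪ Finset.univ.filter fun i => r i < 0
  have h1 := key K' (hK.mono Finset.subset_union_left) fun i hi => by simp [K', hi]
  have h2 : ∑ i ∈ K', max (r i) 0 = ∑ i ∈ K, max (r i) 0 := by
    refine (Finset.sum_subset Finset.subset_union_left fun i hi hiK => ?_).symm
    have : r i < 0 := by simpa [K', hiK] using hi
    exact max_eq_right this.le
  rw [h2] at h1
  refine le_trans ?_ h1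
  exact mul_le_mul_of_nonneg_right
    (by exact_mod_cast Finset.card_le_card Finset.subset_union_left) hneg0

end CodedSystem

namespace CodedSystem

variable {n k : ℕ} (M : CodedSystem n k)

lemma mem_codedRegion_of_weights [NeZero k] {lam : Fin k → ℝ} (h0 : ∀ i, 0 ≤ lam i)
    (W : Finset (Fin n) → ℝ) (hW0 : ∀ R, 0 ≤ W R)
    (hWrec : ∀ R, 0 < W R → ∀ i, M.residual lam i < 0 → R ∈ M.recoverySets i)
    (hW1 : ∀ i, M.residual lam i < 0 → ∑ R, W R = 1)
    (hWc : ∀ ℓ ∈ M.coded, (∑ i, -min (M.residual lam i) 0) * ∑ R with ℓ ∈ R, W R ≤ 1)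
    (hWs : ∀ j, ∀ ℓ ∈ M.systematic j, (∑ i, -min (M.residual lam i) 0) * ∑ R with ℓ ∈ R, W R
      ≤ max (M.residual lam j) 0 / (M.systematic j).card) :
    lam ∈ M.codedRegion := by
  classical
  set r := M.residual lam with hr
  let cap : Fin k → ℝ := fun i => (M.systematic i).card
  have hcap : ∀ i, 0 < cap i := M.card_systematic_pos
  have hrc : ∀ i, r i = cap i - lam i := fun i => by
    simp only [cap]; rw [M.card_systematic']; rfl
  have hneg : ∀ i, 0 ≤ -min (r i) 0 := fun i => neg_nonneg.2 (min_le_right _ _)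
  let own : Fin k → Finset (Fin n) → Prop := fun i R => ∃ ℓ ∈ M.systematic i, R = {ℓ}
  let f : Fin k → Finset (Fin n) → ℝ := fun i R =>
    if own i R then min (lam i) (cap i) / cap i else 0
  have hq0 : ∀ i, 0 ≤ min (lam i) (cap i) / cap i :=
    fun i => div_nonneg (le_min (h0 i) (hcap i).le) (hcap i).le
  have hf0 : ∀ i R, 0 ≤ f i R := fun i R => by
    simp only [f]; split_ifs
    exacts [hq0 i, le_rfl]
  have hown : ∀ i, (M.recoverySets i).filter (own i) =
      (M.systematic i).map ⟨fun ℓ => {ℓ}, Finset.singleton_injective⟩ := by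
    intro i
    ext R
    simp only [Finset.mem_filter, Finset.mem_map, Function.Embedding.coeFn_mk, own]
    constructor
    · rintro ⟨-, ℓ, hℓ, rfl⟩
      exact ⟨ℓ, hℓ, rfl⟩
    · rintro ⟨ℓ, hℓ, rfl⟩
      exact ⟨M.singleton_mem_recoverySets hℓ, ℓ, hℓ, rfl⟩
  refine ⟨fun i R => -min (r i) 0 * W R + f i R, fun i R _ => ?_, fun i => ?_, fun ℓ => ?_⟩
  · exact add_nonneg (mul_nonneg (hneg i) (hW0 R)) (hf0 i R)
  · rw [Finset.sum_add_distrib, ← Finset.mul_sum]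
    have h1 : ∑ R ∈ M.recoverySets i, f i R = min (lam i) (cap i) := by
      simp only [f]
      rw [← Finset.sum_filter, hown, Finset.sum_map, Finset.sum_const, nsmul_eq_mul]
      exact mul_div_cancel₀ _ (hcap i).ne'
    rw [h1]
    rcases lt_or_ge (r i) 0 with h | h
    · have h2 : ∑ R ∈ M.recoverySets i, W R = 1 := by
        rw [← hW1 i h]
        refine Finset.sum_subset (Finset.subset_univ _) fun R _ hR => ?_
        by_contra hne
        exact hR (hWrec R (lt_of_le_of_ne (hW0 R) (Ne.symm hne)) i h)
      rw [h2, min_eq_left h.le, min_eq_right (by linarith [hrc i]), hrc]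
      ring
    · rw [min_eq_right h, min_eq_left (by linarith [hrc i])]
      ring
  · have h1 : ∑ i, ∑ R ∈ (M.recoverySets i).filter (fun R => ℓ ∈ R), -min (r i) 0 * W R ≤
        (∑ i, -min (r i) 0) * ∑ R with ℓ ∈ R, W R := by
      rw [Finset.sum_mul]
      refine Finset.sum_le_sum fun i _ => ?_
      rw [← Finset.mul_sum]
      refine mul_le_mul_of_nonneg_left ?_ (hneg i)
      exact Finset.sum_le_sum_of_subset_of_nonneg
        (Finset.filter_subset_filter _ (Finset.subset_univ _)) fun R _ _ => hW0 R
    have h2 : ∀ i, ∑ R ∈ (M.recoverySets i).filter (fun R => ℓ ∈ R), f i R =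
        if ℓ ∈ M.systematic i then min (lam i) (cap i) / cap i else 0 := by
      intro i
      simp only [f]
      rw [← Finset.sum_filter, Finset.filter_filter]
      split_ifs with h
      · have : ((M.recoverySets i).filter fun R => ℓ ∈ R ∧ own i R) = {{ℓ}} := by
          ext R
          simp only [Finset.mem_filter, Finset.mem_singleton, own]
          constructor
          · rintro ⟨-, h2, ℓ', -, rfl⟩
            rw [Finset.mem_singleton.1 h2]
          · rintro rfl
            exact ⟨M.singleton_mem_recoverySets h, by simp, ℓ, h, rfl⟩
        rw [this, Finset.sum_singleton]
      · refine Finset.sum_eq_zero fun R hR => ?_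
        obtain ⟨-, h2, ℓ', h3, rfl⟩ := Finset.mem_filter.1 hR
        rw [Finset.mem_singleton.1 h2] at h
        exact absurd h3 h
    simp only [Finset.sum_add_distrib]
    rw [Finset.sum_congr rfl fun i _ => h2 i]
    cases hℓ : M.kind ℓ with
    | none =>
      have : ∀ i, ℓ ∉ M.systematic i := fun i => by simp [M.mem_systematic, hℓ]
      simp only [this, if_false, Finset.sum_const_zero, add_zero]
      exact h1.trans (hWc ℓ (M.mem_coded.2 hℓ))
    | some j =>
      have : ∀ i, ℓ ∈ M.systematic i ↔ j = i := fun i => by simp [M.mem_systematic, hℓ]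
      simp only [this, Finset.sum_ite_eq, Finset.mem_univ, if_true]
      have h3 := hWs j ℓ ((this j).2 rfl)
      have h4 : max (r j) 0 / cap j + min (lam j) (cap j) / cap j = 1 := by
        rw [← add_div, div_eq_one_iff_eq (hcap j).ne', hrc]
        rcases le_total (lam j) (cap j) with h | h
        · rw [max_eq_left (by linarith), min_eq_left h]; ring
        · rw [max_eq_right (by linarith), min_eq_right h]; ring
      have h5 := h1.trans h3
      linarith

lemma mem_recoverySets_of_isTransversal {lam : Fin k → ℝ} {i : Fin k} {R : Finset (Fin n)}
    (hk : 0 < k)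
    (hR : R.card = k) (ht : M.IsTransversal R)
    (hpos : ∀ ℓ ∈ R, ∀ j, ℓ ∈ M.systematic j → 0 < M.residual lam j)
    (hi : M.residual lam i < 0) : R ∈ M.recoverySets i := by
  classical
  refine M.mem_recoverySets.2 (Or.inr ?_)
  by_cases hsub : R ⊆ M.coded
  · exact Or.inl ⟨hsub, hR⟩
  have hdisj : ∀ ℓ ∈ R, ℓ ∉ M.systematic i := fun ℓ hℓ h => (hpos ℓ hℓ i h).not_gt hi
  refine Or.inr ⟨hR, ?_, ?_, hdisj, ht⟩
  · by_contra hlt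
    have h0 : R ∩ M.coded = ∅ := Finset.card_eq_zero.1 (by omega)
    have hRs : R \ M.coded = R := by
      rw [Finset.sdiff_eq_self_iff_disjoint, Finset.disjoint_iff_inter_eq_empty, h0]
    have hsub : R.image M.kind ⊆ (Finset.univ.erase i).map Function.Embedding.some := by
      intro o ho
      obtain ⟨ℓ, hℓ, rfl⟩ := Finset.mem_image.1 ho
      cases hk : M.kind ℓ with
      | none => exact absurd (M.mem_coded.2 hk) (Finset.mem_sdiff.1 (hRs.symm ▸ hℓ)).2
      | some j =>
        simp only [Finset.mem_map, Finset.mem_erase, Finset.mem_univ, and_true]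
        refine ⟨j, ?_, rfl⟩
        rintro rfl
        exact hdisj ℓ hℓ (M.mem_systematic.2 hk)
    have h1 := Finset.card_le_card hsub
    rw [Finset.card_image_of_injOn, hR, Finset.card_map, Finset.card_erase_of_mem
      (Finset.mem_univ i), Finset.card_univ, Fintype.card_fin] at h1
    · omega
    · intro ℓ hℓ ℓ' hℓ' h
      rw [IsTransversal, hRs] at ht
      exact ht ℓ hℓ ℓ' hℓ' h
  · refine lt_of_lt_of_eq ?_ hR
    refine Finset.card_lt_card ⟨Finset.inter_subset_left, fun h => hsub fun ℓ hℓ => ?_⟩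
    exact (Finset.mem_inter.1 (h hℓ)).2

/-- Sufficiency of the criterion. -/
lemma mem_codedRegion_of_deficit_le [NeZero k] (hc : M.nCoded = 0 ∨ k ≤ M.nCoded)
    {lam : Fin k → ℝ} (h0 : ∀ i, 0 ≤ lam i) (σ : Equiv.Perm (Fin k))
    (hσ : Monotone fun i => M.residual lam (σ i))
    (h : ∀ k₀ : Fin k, ((k₀ : ℝ) + 1) * ∑ i, -min (M.residual lam i) 0 ≤
      M.nCoded + ∑ i ∈ Finset.Iic k₀, max (M.residual lam (σ i)) 0) :
    lam ∈ M.codedRegion := by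
  classical
  have hk : 0 < k := Nat.pos_of_neZero k
  set r := M.residual lam with hr
  set D : ℝ := ∑ i, -min (r i) 0 with hD
  have hneg : ∀ i, 0 ≤ -min (r i) 0 := fun i => neg_nonneg.2 (min_le_right _ _)
  have hD0 : 0 ≤ D := Finset.sum_nonneg fun i _ => hneg i
  have hDr : ∀ i, r i < 0 → 0 < D := fun i hi =>
    lt_of_lt_of_le (by rw [min_eq_left hi.le]; linarith)
      (Finset.single_le_sum (fun i _ => hneg i) (Finset.mem_univ i))
  rcases hD0.eq_or_lt with hD0 | hDpos
  · have hr0 : ∀ i, ¬ r i < 0 := fun i hi => (hDr i hi).ne hD0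
    refine M.mem_codedRegion_of_weights h0 (fun _ => 0) (fun _ => le_rfl)
      (fun R hR => absurd hR (lt_irrefl _)) (fun i hi => absurd hi (hr0 i)) (by simp) ?_
    intro j ℓ _
    simp only [Finset.sum_const_zero, mul_zero]
    exact div_nonneg (le_max_right _ _) (Nat.cast_nonneg _)
  have hnc : k ≤ M.nCoded := by
    refine hc.resolve_left fun hc => ?_
    have h1 := h 0
    have h2 : Finset.Iic (0 : Fin k) = {0} := by
      ext i; simp
    have h3 : r (σ 0) < 0 := by
      by_contra hge
      refine hDpos.ne' (Finset.sum_eq_zero fun i _ => ?_)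
      have : r (σ 0) ≤ r (σ (σ.symm i)) := hσ (Fin.zero_le _)
      rw [σ.apply_symm_apply] at this
      rw [min_eq_right (by linarith), neg_zero]
    rw [h2, hc, Finset.sum_singleton, max_eq_right h3.le] at h1
    simp at h1
    linarith
  let cap : Fin k → ℝ := fun i => (M.systematic i).card
  have hcap : ∀ i, 0 < cap i := M.card_systematic_pos
  let a : Fin k → ℝ := fun i => min (max (r i) 0) D
  have ha0 : ∀ i, 0 ≤ a i := fun i => le_min (le_max_right _ _) hD0
  let b : ℝ := min 1 D
  have hb0 : 0 ≤ b := le_min zero_le_one hD0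
  have hnck : (k : ℝ) ≤ M.nCoded := by exact_mod_cast hnc
  have htot : k * D ≤ M.nCoded * b + ∑ i, a i := by
    rcases le_total D 1 with hD1 | hD1
    · have : b = D := min_eq_right hD1
      have := Finset.sum_nonneg fun i (_ : i ∈ Finset.univ) => ha0 i
      nlinarith
    have hb : b = 1 := min_eq_left hD1
    let K : Finset (Fin k) := Finset.univ.filter fun i => max (r (σ i)) 0 < D
    have hsum : ∑ i, a i = ∑ i ∈ K, max (r (σ i)) 0 + (k - K.card) * D := by
      rw [← Equiv.sum_comp σ, ← Finset.sum_add_sum_compl K]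
      congr 1
      · refine Finset.sum_congr rfl fun i hi => ?_
        exact min_eq_left (Finset.mem_filter.1 hi).2.le
      · rw [Finset.sum_congr rfl (g := fun _ => D) fun i hi => ?_, Finset.sum_const,
          Finset.card_compl, nsmul_eq_mul, Nat.cast_sub (Finset.card_le_univ K)]
        · simp
        · refine min_eq_right (not_lt.1 fun h => ?_)
          exact (Finset.mem_compl.1 hi) (Finset.mem_filter.2 ⟨Finset.mem_univ _, h⟩)
    rw [hsum, hb]
    rcases K.eq_empty_or_nonempty with hK | hK
    · simp only [hK, Finset.sum_empty, Finset.card_empty]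
      push_cast
      nlinarith
    · have hKI : K = Finset.Iic (K.max' hK) := by
        ext i
        rw [Finset.mem_Iic]
        refine ⟨fun hi => K.le_max' i hi, fun hi => ?_⟩
        have h1 := (Finset.mem_filter.1 (K.max'_mem hK)).2
        refine Finset.mem_filter.2 ⟨Finset.mem_univ _, lt_of_le_of_lt ?_ h1⟩
        exact max_le_max (hσ hi) le_rfl
      have h1 := h (K.max' hK)
      rw [← hKI] at h1
      have h2 : ((K.max' hK : Fin k) : ℝ) + 1 = K.card := by
        conv_rhs => rw [hKI]
        rw [Fin.card_Iic]
        push_cast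
        rfl
      rw [h2] at h1
      nlinarith
  set T : ℝ := M.nCoded * b + ∑ i, a i with hT
  have hkR : (0 : ℝ) < k := by exact_mod_cast hk
  have hTpos : 0 < T := lt_of_lt_of_le (mul_pos hkR hDpos) htot
  let c : ℝ := k * D / T
  have hc0 : 0 < c := div_pos (mul_pos hkR hDpos) hTpos
  have hc1 : c ≤ 1 := (div_le_one hTpos).2 htot
  let v : Fin n → ℝ := fun ℓ => match M.kind ℓ with
    | none => c * (b / D)
    | some j => c * (a j / D / cap j)
  have hvc : ∀ ℓ ∈ M.coded, v ℓ = c * (b / D) := fun ℓ hℓ => by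
    simp only [v, M.mem_coded.1 hℓ]
  have hvs : ∀ j, ∀ ℓ ∈ M.systematic j, v ℓ = c * (a j / D / cap j) := fun j ℓ hℓ => by
    simp only [v, M.mem_systematic.1 hℓ]
  have hv0 : ∀ ℓ, 0 ≤ v ℓ := by
    intro ℓ
    cases hℓ : M.kind ℓ with
    | none => rw [hvc ℓ (M.mem_coded.2 hℓ)]; positivity
    | some j =>
      rw [hvs j ℓ (M.mem_systematic.2 hℓ)]
      have := ha0 j
      have := hcap j
      positivity
  have hvS : ∀ j, ∑ ℓ ∈ M.systematic j, v ℓ = c * (a j / D) := by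
    intro j
    rw [Finset.sum_congr rfl (hvs j), Finset.sum_const, nsmul_eq_mul]
    have := (hcap j).ne'
    change cap j * _ = _
    field_simp
  have hv1 : ∑ ℓ, v ℓ = k := by
    rw [M.sum_servers, Finset.sum_congr rfl hvc, Finset.sum_const, nsmul_eq_mul]
    simp only [hvS]
    rw [← Finset.mul_sum, ← Finset.sum_div]
    have : (M.coded.card : ℝ) * (c * (b / D)) + c * ((∑ i, a i) / D) = c * T / D := by
      rw [hT, nCoded]; field_simp
    rw [this]
    simp only [c]
    field_simp
  have hv2 : ∀ ℓ ∈ M.coded, v ℓ ≤ 1 := by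
    intro ℓ hℓ
    rw [hvc ℓ hℓ]
    exact mul_le_one₀ hc1 (by positivity) ((div_le_one hDpos).2 (min_le_right _ _))
  have hv3 : ∀ j, ∑ ℓ ∈ M.systematic j, v ℓ ≤ 1 := by
    intro j
    rw [hvS]
    exact mul_le_one₀ hc1 (div_nonneg (ha0 j) hDpos.le) ((div_le_one hDpos).2 (min_le_right _ _))
  obtain ⟨W, hW0, hW1, hWt, hWv⟩ := M.exists_transversal_weights hk v hv0 hv1 hv2 hv3
  refine M.mem_codedRegion_of_weights h0 W hW0 (fun R hR i hi => ?_) (fun _ _ => hW1) ?_ ?_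
  · obtain ⟨h1, h2⟩ := hWt R hR
    refine M.mem_recoverySets_of_isTransversal hk h1 h2 (fun ℓ hℓ j hj => ?_) hi
    have h3 : 0 < v ℓ := by
      rw [← hWv]
      exact lt_of_lt_of_le hR (Finset.single_le_sum (f := W) (fun R _ => hW0 R) (by simpa using hℓ))
    by_contra hneg
    have h4 : a j = 0 := le_antisymm ((min_le_left _ _).trans (max_le (not_lt.1 hneg) le_rfl))
      (ha0 j)
    rw [hvs j ℓ hj, h4] at h3
    simp at h3
  · intro ℓ hℓ
    rw [hWv, hvc ℓ hℓ]
    have : D * (c * (b / D)) = c * b := by field_simp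
    rw [← hr, ← hD, this]
    exact mul_le_one₀ hc1 hb0 (min_le_left _ _)
  · intro j ℓ hℓ
    rw [hWv, hvs j ℓ hℓ, ← hr, ← hD]
    have : D * (c * (a j / D / cap j)) = c * a j / cap j := by
      have := (hcap j).ne'
      field_simp
    rw [this]
    refine div_le_div_of_nonneg_right ?_ (hcap j).le
    exact (mul_le_of_le_one_left (ha0 j) hc1).trans (min_le_left _ _)

/-- The criterion in terms of the sorted residual capacities. -/
theorem mem_codedRegion_iff [NeZero k] (hc : M.nCoded = 0 ∨ k ≤ M.nCoded)
    {lam : Fin k → ℝ} (h0 : ∀ i, 0 ≤ lam i) (σ : Equiv.Perm (Fin k))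
    (hσ : Monotone fun i => M.residual lam (σ i)) :
    lam ∈ M.codedRegion ↔
      ∑ i, -min (M.residual lam i) 0 ≤
        ⨅ k₀ : Fin k, ((M.nCoded : ℝ) + ∑ i ∈ Finset.Iic k₀, max (M.residual lam (σ i)) 0) /
          ((k₀ : ℝ) + 1) := by
  constructor
  · intro h
    refine le_ciInf fun k₀ => ?_
    rw [le_div_iff₀ (by positivity), mul_comm]
    have h1 := M.card_mul_deficit_le h (K := (Finset.Iic k₀).map σ.toEmbedding)
      (Finset.map_nonempty.2 ⟨k₀, Finset.mem_Iic.2 le_rfl⟩)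
    rw [Finset.card_map, Fin.card_Iic, Finset.sum_map] at h1
    simpa using h1
  · intro h
    refine M.mem_codedRegion_of_deficit_le hc h0 σ hσ fun k₀ => ?_
    have h1 := h.trans (ciInf_le (Set.finite_range _).bddBelow k₀)
    rw [le_div_iff₀ (by positivity), mul_comm] at h1
    exact h1

end CodedSystem

/-! ### Merging the arrival streams -/

/-- The time of the `q`-th point of the point process with gaps `g`. -/
noncomputable def arrivalTime (g : ℕ → ℝ≥0∞) (q : ℕ) : ℝ≥0∞ := ∑ j ∈ Finset.range (q + 1), g j

lemma arrivalTime_mono (g : ℕ → ℝ≥0∞) : Monotone (arrivalTime g) := fun _ _ h =>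
  Finset.sum_le_sum_of_subset (Finset.range_mono (Nat.succ_le_succ h))

lemma arrivalTime_succ (g : ℕ → ℝ≥0∞) (q : ℕ) :
    arrivalTime g (q + 1) = arrivalTime g q + g (q + 1) :=
  Finset.sum_range_succ _ _

lemma arrivalTime_zero (g : ℕ → ℝ≥0∞) : arrivalTime g 0 = g 0 := by simp [arrivalTime]

/-- The gaps of a point process after time `u`, if `j` points lie in `[0, u]`. -/
noncomputable def residualGaps (u : ℝ≥0∞) (j : ℕ) (g : ℕ → ℝ≥0∞) : ℕ → ℝ≥0∞
  | 0 => arrivalTime g j - u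
  | q + 1 => g (j + q + 1)

lemma add_arrivalTime_residualGaps {u : ℝ≥0∞} {j : ℕ} {g : ℕ → ℝ≥0∞}
    (h : u ≤ arrivalTime g j) (q : ℕ) :
    u + arrivalTime (residualGaps u j g) q = arrivalTime g (j + q) := by
  induction q with
  | zero => rw [arrivalTime_zero, residualGaps, add_tsub_cancel_of_le h, add_zero]
  | succ q ih => rw [arrivalTime_succ, ← add_assoc, ih, residualGaps, ← add_assoc, arrivalTime_succ]

namespace Input

variable {n k : ℕ} (I : Input n k)

lemma typeArrival_eq (i : Fin k) (q : ℕ) :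
    I.typeArrival i q = arrivalTime (fun q => I.gap (i, q)) q := rfl

lemma typeArrival_mono (i : Fin k) : Monotone (I.typeArrival i) := arrivalTime_mono _

/-- Exactly `J i` jobs of every type `i` arrive until time `u`. -/
def CountAt (u : ℝ≥0∞) (J : Fin k → ℕ) : Prop :=
  ∀ i, (∀ q < J i, I.typeArrival i q ≤ u) ∧ u < I.typeArrival i (J i)

/-- The inputs seen after time `u`, if `J i` jobs of every type `i` arrive until time `u`. -/
noncomputable def shift (u : ℝ≥0∞) (J : Fin k → ℕ) : Input n k where
  gap p := residualGaps u (J p.1) (fun q => I.gap (p.1, q)) p.2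
  service p := I.service (∑ i, J i + p.1, p.2)
  coin m := I.coin (∑ i, J i + m)

lemma CountAt.add_typeArrival {I : Input n k} {u : ℝ≥0∞} {J : Fin k → ℕ} (h : I.CountAt u J) (i : Fin k) (q : ℕ) :
    u + (I.shift u J).typeArrival i q = I.typeArrival i (J i + q) :=
  add_arrivalTime_residualGaps (h i).2.le q

variable [NeZero k]

lemma nextType_eq_iff (c : Fin k → ℕ) (i : Fin k) :
    I.nextType c = i ↔ (∀ j, I.typeArrival i (c i) ≤ I.typeArrival j (c j)) ∧
      ∀ i' < i, ¬ ∀ j, I.typeArrival i' (c i') ≤ I.typeArrival j (c j) := by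
  rw [nextType, Finset.min'_eq_iff]
  simp only [Finset.mem_filter, Finset.mem_univ, true_and]
  refine and_congr_right fun _ => forall_congr' fun i' => ?_
  rw [← not_imp_not, not_le]

lemma typeArrival_nextType_le (c : Fin k → ℕ) (j : Fin k) :
    I.typeArrival (I.nextType c) (c (I.nextType c)) ≤ I.typeArrival j (c j) :=
  ((I.nextType_eq_iff c _).1 rfl).1 j

lemma counts_succ (m : ℕ) (i : Fin k) :
    I.counts (m + 1) i = I.counts m i + if I.jobType m = i then 1 else 0 := by
  rw [counts, Function.update_apply, ← jobType]
  by_cases h : I.jobType m = i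
  · simp [h]
  · simp [h, Ne.symm h]

lemma jobArrival_le (m : ℕ) (j : Fin k) : I.jobArrival m ≤ I.typeArrival j (I.counts m j) :=
  I.typeArrival_nextType_le _ j

lemma counts_mono (i : Fin k) : Monotone fun m => I.counts m i :=
  monotone_nat_of_le_succ fun m => by rw [counts_succ]; exact Nat.le_add_right _ _

lemma jobArrival_mono : Monotone I.jobArrival := by
  refine monotone_nat_of_le_succ fun m => (I.jobArrival_le m (I.jobType (m + 1))).trans ?_
  exact I.typeArrival_mono _ (I.counts_mono _ m.le_succ)

lemma sum_counts (m : ℕ) : ∑ i, I.counts m i = m := by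
  induction m with
  | zero => simp [counts]
  | succ m ih => simp [counts_succ, Finset.sum_add_distrib, ih]

lemma counts_le (m : ℕ) (i : Fin k) : I.counts m i ≤ m :=
  (Finset.single_le_sum (fun j _ => Nat.zero_le (I.counts m j)) (Finset.mem_univ i)).trans
    (I.sum_counts m).le

lemma jobType_congr {I I' : Input n k} (hg : I.gap = I'.gap) : I.jobType = I'.jobType := by
  have hT : I.typeArrival = I'.typeArrival := by
    funext i q; simp only [typeArrival, hg]
  have hC : I.counts = I'.counts := by
    funext m
    induction m with
    | zero => rfl
    | succ m ih => simp only [counts, ih, nextType, hT]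
  funext m
  simp only [jobType, nextType, hT, hC]

lemma jobArrival_congr {I I' : Input n k} (hg : I.gap = I'.gap) :
    I.jobArrival = I'.jobArrival := by
  have hT : I.typeArrival = I'.typeArrival := by
    funext i q; simp only [typeArrival, hg]
  have hC : I.counts = I'.counts := by
    funext m
    induction m with
    | zero => rfl
    | succ m ih => simp only [counts, ih, nextType, hT]
  funext m
  simp only [jobArrival, jobType_congr hg, hT, hC]

/-- A product over the first `M` jobs, sorted by types. -/
@[to_additive /-- A sum over the first `M` jobs, sorted by types. -/]
lemma prod_range_jobs {α : Type*} [CommMonoid α] (f : Fin k → ℝ≥0∞ → α) (M : ℕ) :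
    ∏ m ∈ Finset.range M, f (I.jobType m) (I.jobArrival m) =
      ∏ i, ∏ q ∈ Finset.range (I.counts M i), f i (I.typeArrival i q) := by
  induction M with
  | zero => simp [counts]
  | succ M ih =>
    rw [Finset.prod_range_succ, ih]
    have : ∀ i, ∏ q ∈ Finset.range (I.counts (M + 1) i), f i (I.typeArrival i q) =
        (∏ q ∈ Finset.range (I.counts M i), f i (I.typeArrival i q)) *
          if I.jobType M = i then f i (I.typeArrival i (I.counts M i)) else 1 := by
      intro i
      rw [counts_succ]
      split_ifs
      · rw [Finset.prod_range_succ]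
      · simp
    simp only [this, Finset.prod_mul_distrib, Finset.prod_ite_eq, Finset.mem_univ, if_true]
    rfl

lemma lt_counts_of_typeArrival_lt {t : ℝ≥0∞} {M q : ℕ} {i : Fin k} (ht : t < I.jobArrival M)
    (h : I.typeArrival i q ≤ t) : q < I.counts M i := by
  by_contra hq
  exact ((I.jobArrival_le M i).trans (I.typeArrival_mono i (not_lt.1 hq))).not_gt
    (lt_of_le_of_lt h ht)

variable {I}

lemma CountAt.counts_eq {u : ℝ≥0∞} {J : Fin k → ℕ} (h : I.CountAt u J) :
    I.counts (∑ i, J i) = J := by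
  have hle : ∀ m ≤ ∑ i, J i, ∀ i, I.counts m i ≤ J i := by
    intro m
    induction m with
    | zero => intro _ i; simp [counts]
    | succ m ih =>
      intro hm i
      rw [counts_succ]
      split_ifs with hi
      · subst hi
        refine lt_of_le_of_ne (ih (by omega) _) fun heq => ?_
        obtain ⟨j, -, hj⟩ : ∃ j ∈ Finset.univ, I.counts m j < J j := by
          refine Finset.exists_lt_of_sum_lt ?_
          rw [sum_counts]
          omega
        have h1 := (I.jobArrival_le m j).trans ((h j).1 _ hj)
        have h2 := (h (I.jobType m)).2
        rw [← heq] at h2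
        exact h1.not_gt h2
      · exact ih (by omega) i
  have hs := I.sum_counts (∑ i, J i)
  funext i
  exact (Finset.sum_eq_sum_iff_of_le fun i _ => hle _ le_rfl i).1 hs i (Finset.mem_univ i)

lemma CountAt.nextType_add {u : ℝ≥0∞} {J : Fin k → ℕ} (h : I.CountAt u J) (hu : u ≠ ⊤)
    (c : Fin k → ℕ) : I.nextType (J + c) = (I.shift u J).nextType c := by
  rw [nextType_eq_iff]
  simp only [Pi.add_apply, ← h.add_typeArrival, ENNReal.add_le_add_iff_left hu]
  exact ((I.shift u J).nextType_eq_iff c _).1 rfl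

lemma CountAt.counts_add {u : ℝ≥0∞} {J : Fin k → ℕ} (h : I.CountAt u J) (hu : u ≠ ⊤) (m : ℕ) :
    I.counts (∑ i, J i + m) = J + (I.shift u J).counts m := by
  induction m with
  | zero => simp only [add_zero, h.counts_eq]; funext i; simp [counts]
  | succ m ih =>
    funext i
    rw [← add_assoc, counts_succ, Pi.add_apply, counts_succ, jobType, jobType, ih,
      h.nextType_add hu, Pi.add_apply, add_assoc]

lemma CountAt.jobType_add {u : ℝ≥0∞} {J : Fin k → ℕ} (h : I.CountAt u J) (hu : u ≠ ⊤) (m : ℕ) :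
    I.jobType (∑ i, J i + m) = (I.shift u J).jobType m := by
  rw [jobType, jobType, h.counts_add hu, h.nextType_add hu]

lemma CountAt.jobArrival_add {u : ℝ≥0∞} {J : Fin k → ℕ} (h : I.CountAt u J) (hu : u ≠ ⊤) (m : ℕ) :
    I.jobArrival (∑ i, J i + m) = u + (I.shift u J).jobArrival m := by
  rw [jobArrival, jobArrival, h.counts_add hu, h.jobType_add hu, Pi.add_apply,
    ← h.add_typeArrival]

/-- The jobs that arrive until time `u` are the first ones. -/
lemma CountAt.lt_jobArrival_iff {u : ℝ≥0∞} {J : Fin k → ℕ} (h : I.CountAt u J) {m : ℕ} :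
    u < I.jobArrival m ↔ ∑ i, J i ≤ m := by
  constructor
  · intro hm
    by_contra hlt
    obtain ⟨j, -, hj⟩ : ∃ j ∈ Finset.univ, I.counts m j < J j := by
      refine Finset.exists_lt_of_sum_lt ?_
      rw [sum_counts]
      omega
    exact ((I.jobArrival_le m j).trans ((h j).1 _ hj)).not_gt hm
  · intro hm
    refine lt_of_lt_of_le ?_ (I.jobArrival_mono hm)
    rw [jobArrival, h.counts_eq]
    exact (h _).2

end Input

/-! ### The queueing dynamics -/

namespace Policy

variable {n k : ℕ} [NeZero k] {M : CodedSystem n k} (π : Policy M) (I : Input n k)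

lemma records_apply {m : ℕ} (j : Fin m) :
    π.records I m j = π.serve I j (π.records I j) := by
  induction m with
  | zero => exact j.elim0
  | succ m ih =>
    rw [records]
    induction j using Fin.lastCases with
    | last => simp
    | cast j => simp [ih]

lemma records_fst {m : ℕ} (j : Fin m) : (π.records I m j).1 = π.jobRoute I j := by
  rw [records_apply]; rfl

lemma records_snd {m : ℕ} (j : Fin m) (ℓ : Fin n) :
    (π.records I m j).2 ℓ = π.taskDeparture I j ℓ := by
  rw [records_apply]; rfl

/-- The time at which server `ℓ` has finished the tasks of the first `m` jobs. -/
noncomputable def freeTime (m : ℕ) (ℓ : Fin n) : ℝ≥0∞ := freeAt (π.records I m) ℓ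

lemma freeTime_le_iff {m : ℕ} {ℓ : Fin n} {x : ℝ≥0∞} :
    π.freeTime I m ℓ ≤ x ↔ ∀ j < m, ℓ ∈ π.jobRoute I j → π.taskDeparture I j ℓ ≤ x := by
  simp only [freeTime, freeAt, Finset.sup_le_iff, Finset.mem_filter, Finset.mem_univ, true_and,
    records_fst, records_snd]
  exact ⟨fun h j hj hℓ => h ⟨j, hj⟩ hℓ, fun h j hℓ => h j j.2 hℓ⟩

lemma taskDeparture_of_mem {m : ℕ} {ℓ : Fin n} (h : ℓ ∈ π.jobRoute I m) :
    π.taskDeparture I m ℓ = max (I.jobArrival m) (π.freeTime I m ℓ) + I.service (m, ℓ) :=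
  if_pos h

lemma taskDeparture_of_notMem {m : ℕ} {ℓ : Fin n} (h : ℓ ∉ π.jobRoute I m) :
    π.taskDeparture I m ℓ = I.jobArrival m :=
  if_neg h

lemma taskDeparture_le_freeTime {j m : ℕ} {ℓ : Fin n} (hj : j < m) (h : ℓ ∈ π.jobRoute I j) :
    π.taskDeparture I j ℓ ≤ π.freeTime I m ℓ :=
  (π.freeTime_le_iff I).1 le_rfl j hj h

lemma jobCompletion_le_iff {m : ℕ} {x : ℝ≥0∞} :
    π.jobCompletion I m ≤ x ↔ ∀ ℓ ∈ π.jobRoute I m, π.taskDeparture I m ℓ ≤ x :=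
  Finset.sup_le_iff

/-- The work of the first tasks at a server is finished not before the last of them departs. -/
lemma sum_service_le_taskDeparture (m : ℕ) (ℓ : Fin n) (hm : ℓ ∈ π.jobRoute I m) :
    ∑ j ∈ Finset.range (m + 1), (if ℓ ∈ π.jobRoute I j then I.service (j, ℓ) else 0) ≤
      π.taskDeparture I m ℓ := by
  have key : ∀ m, ∑ j ∈ Finset.range m, (if ℓ ∈ π.jobRoute I j then I.service (j, ℓ) else 0) ≤
      π.freeTime I m ℓ := by
    intro m
    induction m with
    | zero => simp
    | succ m ih =>
      rw [Finset.sum_range_succ]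
      split_ifs with h
      · refine le_trans ?_ (π.taskDeparture_le_freeTime I m.lt_succ_self h)
        rw [taskDeparture_of_mem π I h]
        exact add_le_add (ih.trans (le_max_right _ _)) le_rfl
      · rw [add_zero]
        refine ih.trans ((π.freeTime_le_iff I).2 fun j hj hℓ => ?_)
        exact π.taskDeparture_le_freeTime I (by omega) hℓ
  rw [Finset.sum_range_succ, if_pos hm, taskDeparture_of_mem π I hm]
  exact add_le_add ((key m).trans (le_max_right _ _)) le_rfl

/-- The total work of the tasks that leave a server until time `t` is at most `t`. -/
lemma sum_service_departed_le (t : ℝ≥0∞) (ℓ : Fin n) (S : Finset ℕ)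
    (hS : ∀ j ∈ S, ℓ ∈ π.jobRoute I j ∧ π.taskDeparture I j ℓ ≤ t) :
    ∑ j ∈ S, I.service (j, ℓ) ≤ t := by
  rcases S.eq_empty_or_nonempty with rfl | hne
  · simp
  obtain ⟨h1, h2⟩ := hS _ (S.max'_mem hne)
  refine le_trans ?_ ((π.sum_service_le_taskDeparture I _ ℓ h1).trans h2)
  rw [Finset.sum_congr rfl (g := fun j => if ℓ ∈ π.jobRoute I j then I.service (j, ℓ) else 0)
    fun j hj => (if_pos (hS j hj).1).symm]
  exact Finset.sum_le_sum_of_subset fun j hj =>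
    Finset.mem_range.2 (Nat.lt_succ_of_le (S.le_max' j hj))

/-- A task departs after the work that arrived in some busy period. -/
lemma exists_taskDeparture_le (m : ℕ) (ℓ : Fin n) (hm : ℓ ∈ π.jobRoute I m) :
    ∃ j ≤ m, π.taskDeparture I m ℓ ≤ I.jobArrival j +
      ∑ i ∈ Finset.Icc j m, if ℓ ∈ π.jobRoute I i then I.service (i, ℓ) else 0 := by
  induction m using Nat.strong_induction_on with
  | _ m ih =>
    rw [taskDeparture_of_mem π I hm]
    rcases le_or_gt (π.freeTime I m ℓ) (I.jobArrival m) with h | h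
    · refine ⟨m, le_rfl, ?_⟩
      rw [max_eq_left h]
      simp [hm]
    · have : ¬ ∀ j < m, ℓ ∈ π.jobRoute I j → π.taskDeparture I j ℓ < π.freeTime I m ℓ := by
        intro hall
        have h2 : π.freeTime I m ℓ < π.freeTime I m ℓ := by
          conv_lhs => rw [freeTime, freeAt]
          rw [Finset.sup_lt_iff (lt_of_le_of_lt bot_le h)]
          simp only [Finset.mem_filter, Finset.mem_univ, true_and, records_fst, records_snd]
          exact fun j hj => hall j j.2 hj
        exact lt_irrefl _ h2
      push Not at this
      obtain ⟨m', hm', hℓ, hle⟩ := this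
      obtain ⟨j, hj, hjle⟩ := ih m' hm' hℓ
      refine ⟨j, by omega, ?_⟩
      rw [max_eq_right h.le, show m = (m - 1) + 1 by omega, ← Finset.insert_Icc_right_eq_Icc_add_one (by omega),
        Finset.sum_insert (by simp), show m - 1 + 1 = m by omega, if_pos hm,
        add_comm (I.service (m, ℓ)), ← add_assoc]
      refine add_le_add ((hle.trans hjle).trans ?_) le_rfl
      gcongr
      omega

/-- The history before a job depends only on the gaps, the random numbers and the records. -/
lemma historyOf_congr {I I' : Input n k} (hg : I.gap = I'.gap) (hc : I.coin = I'.coin) (m : ℕ)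
    (past : Fin m → Finset (Fin n) × (Fin n → ℝ≥0∞)) :
    historyOf I m past = historyOf I' m past := by
  simp only [historyOf, Input.jobType_congr hg, Input.jobArrival_congr hg, hc]

/-- The routing of a job does not depend on its own service times and those of later jobs. -/
lemma records_congr {I I' : Input n k} (hg : I.gap = I'.gap) (hc : I.coin = I'.coin) {m : ℕ}
    (hs : ∀ j < m, ∀ ℓ, I.service (j, ℓ) = I'.service (j, ℓ)) :
    π.records I m = π.records I' m := by
  induction m with
  | zero => rfl
  | succ m ih =>
    have ih := ih fun j hj => hs j (by omega)
    have hserve : π.serve I m = π.serve I' m := by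
      funext past
      simp only [serve, historyOf_congr hg hc, Input.jobArrival_congr hg, hs m m.lt_succ_self]
    rw [records, records, ih, hserve]

lemma jobRoute_congr {I I' : Input n k} (hg : I.gap = I'.gap) (hc : I.coin = I'.coin) {m : ℕ}
    (hs : ∀ j < m, ∀ ℓ, I.service (j, ℓ) = I'.service (j, ℓ)) :
    π.jobRoute I m = π.jobRoute I' m := by
  change π.route m (historyOf I m (π.records I m)) = π.route m (historyOf I' m (π.records I' m))
  rw [historyOf_congr hg hc, π.records_congr hg hc hs]

end Policy

/-! ### Measurability -/

lemma natCast_lt_encard_iff {α : Type*} {s : Set α} {c : ℕ} :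
    (c : ℕ∞) < s.encard ↔ ∃ F : Finset α, F.card = c + 1 ∧ (F : Set α) ⊆ s := by
  rw [← ENat.add_one_le_iff (ENat.natCast_ne_top c)]
  constructor
  · intro h
    obtain ⟨t, hts, ht⟩ := Set.exists_subset_encard_eq h
    have hfin : t.Finite := Set.finite_of_encard_eq_coe (k := c + 1) (by rw [ht]; norm_cast)
    refine ⟨hfin.toFinset, ?_, by simpa using hts⟩
    have := hfin.encard_eq_coe_toFinset_card
    rw [ht] at this
    exact_mod_cast this.symm
  · rintro ⟨F, hF, hFs⟩
    refine le_trans (le_of_eq ?_) (Set.encard_le_encard hFs)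
    rw [Set.encard_coe_eq_coe_finsetCard, hF]
    norm_cast

lemma measurableSet_lt_encard {Ω : Type*} [MeasurableSpace Ω] {S : Ω → Set ℕ}
    (hS : ∀ m, MeasurableSet {ω | m ∈ S ω}) (c : ℕ) :
    MeasurableSet {ω | (c : ℕ∞) < (S ω).encard} := by
  have : {ω | (c : ℕ∞) < (S ω).encard} =
      ⋃ F ∈ {F : Finset ℕ | F.card = c + 1}, ⋂ m ∈ F, {ω | m ∈ S ω} := by
    ext ω
    simp only [natCast_lt_encard_iff, Set.mem_ofPred_eq, Set.mem_iUnion, Set.mem_iInter,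
      exists_prop]
    rfl
  rw [this]
  exact MeasurableSet.biUnion (Set.to_countable _)
    fun F _ => Finset.measurableSet_biInter F fun m _ => hS m

section Measurability

variable {n k : ℕ}

lemma measurable_typeArrival (i : Fin k) (q : ℕ) :
    Measurable fun ω : Sample n k => ω.input.typeArrival i q := by
  unfold Input.typeArrival Sample.input
  fun_prop

variable [NeZero k]

lemma measurable_nextType (c : Fin k → ℕ) :
    Measurable fun ω : Sample n k => ω.input.nextType c := by
  refine measurable_to_countable' fun i => ?_
  let A : Fin k → Set (Sample n k) := fun i =>
    ⋂ j, {ω | ω.input.typeArrival i (c i) ≤ ω.input.typeArrival j (c j)}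
  have hA : ∀ i, MeasurableSet (A i) := fun i => MeasurableSet.iInter fun j =>
    measurableSet_le (measurable_typeArrival _ _) (measurable_typeArrival _ _)
  have : (fun ω : Sample n k => ω.input.nextType c) ⁻¹' {i} = A i ∩ ⋂ i', ⋂ (_ : i' < i), (A i')ᶜ := by
    ext ω
    simp only [A, mem_preimage, mem_singleton_iff, Input.nextType_eq_iff, mem_inter_iff, mem_iInter,
      mem_compl_iff, mem_ofPred_eq]
  rw [this]
  exact (hA i).inter (MeasurableSet.iInter fun i' => MeasurableSet.iInter fun _ => (hA i').compl)

lemma measurable_counts (m : ℕ) : Measurable fun ω : Sample n k => ω.input.counts m := by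
  induction m with
  | zero => exact measurable_const
  | succ m ih =>
    have h : Measurable fun p : (Fin k → ℕ) × Sample n k =>
        Function.update p.1 (p.2.input.nextType p.1) (p.1 (p.2.input.nextType p.1) + 1) := by
      refine measurable_from_prod_countable_right fun c => ?_
      exact (measurable_of_countable fun i => Function.update c i (c i + 1)).comp
        (measurable_nextType c)
    have key : (fun ω : Sample n k => ω.input.counts (m + 1)) = fun ω =>
      (fun p : (Fin k → ℕ) × Sample n k =>
        Function.update p.1 (p.2.input.nextType p.1) (p.1 (p.2.input.nextType p.1) + 1))
          (ω.input.counts m, ω) := rfl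
    rw [key]
    exact h.comp (ih.prodMk measurable_id)

lemma measurable_jobType (m : ℕ) : Measurable fun ω : Sample n k => ω.input.jobType m := by
  have h : Measurable fun p : (Fin k → ℕ) × Sample n k => p.2.input.nextType p.1 :=
    measurable_from_prod_countable_right fun c => measurable_nextType c
  have key : (fun ω : Sample n k => ω.input.jobType m) = fun ω =>
      (fun p : (Fin k → ℕ) × Sample n k => p.2.input.nextType p.1) (ω.input.counts m, ω) := rfl
  rw [key]
  exact h.comp ((measurable_counts m).prodMk measurable_id)

lemma measurable_jobArrival (m : ℕ) : Measurable fun ω : Sample n k => ω.input.jobArrival m := by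
  have h : Measurable fun p : (Fin k × (Fin k → ℕ)) × Sample n k =>
      p.2.input.typeArrival p.1.1 (p.1.2 p.1.1) :=
    measurable_from_prod_countable_right fun c => measurable_typeArrival c.1 (c.2 c.1)
  have key : (fun ω : Sample n k => ω.input.jobArrival m) = fun ω =>
      (fun p : (Fin k × (Fin k → ℕ)) × Sample n k => p.2.input.typeArrival p.1.1 (p.1.2 p.1.1))
        ((ω.input.jobType m, ω.input.counts m), ω) := rfl
  rw [key]
  exact h.comp (((measurable_jobType m).prodMk (measurable_counts m)).prodMk measurable_id)

namespace Policy

variable {M : CodedSystem n k} (π : Policy M)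

lemma measurable_serve {m : ℕ} {past : Sample n k → Fin m → Finset (Fin n) × (Fin n → ℝ≥0∞)}
    (h : Measurable past) :
    Measurable fun ω : Sample n k => π.serve ω.input m (past ω) := by
  have hh : Measurable fun ω : Sample n k => historyOf ω.input m (past ω) := by
    unfold historyOf
    refine Measurable.prodMk ?_ ?_
    · refine measurable_pi_lambda _ fun j => ?_
      refine (measurable_jobType _).prodMk ((measurable_jobArrival _).prodMk ?_)
      unfold Sample.input
      fun_prop
    · refine measurable_pi_lambda _ fun j => Measurable.prodMk (by fun_prop) ?_
      have := measurable_jobArrival (n := n) (k := k) m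
      fun_prop
  have hr : Measurable fun ω : Sample n k => π.route m (historyOf ω.input m (past ω)) :=
    (π.measurable_route m).comp hh
  have hf : ∀ ℓ, Measurable fun ω : Sample n k => freeAt (past ω) ℓ := by
    intro ℓ
    refine measurable_of_Iic fun x => ?_
    have : (fun ω : Sample n k => freeAt (past ω) ℓ) ⁻¹' Iic x =
        ⋂ j, {ω | ℓ ∈ (past ω j).1}ᶜ ∪ {ω | (past ω j).2 ℓ ≤ x} := by
      ext ω
      simp only [freeAt, mem_preimage, mem_Iic, Finset.sup_le_iff, Finset.mem_filter,
        Finset.mem_univ, true_and, mem_iInter, mem_union, mem_compl_iff, mem_ofPred_eq,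
        imp_iff_not_or]
    rw [this]
    refine MeasurableSet.iInter fun j => MeasurableSet.union (MeasurableSet.compl ?_)
      (measurableSet_le (by fun_prop) measurable_const)
    exact (measurableSet_mem_finset ℓ).preimage (by fun_prop)
  refine hr.prodMk (measurable_pi_lambda _ fun ℓ => ?_)
  refine Measurable.ite ((measurableSet_mem_finset ℓ).preimage hr) ?_ (measurable_jobArrival m)
  refine Measurable.add ((measurable_jobArrival m).max (hf ℓ)) ?_
  unfold Sample.input
  fun_prop

lemma measurable_records (m : ℕ) : Measurable fun ω : Sample n k => π.records ω.input m := by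
  refine measurable_pi_lambda _ fun j => ?_
  simp only [records_apply]
  obtain ⟨j, hj⟩ := j
  simp only
  clear hj
  induction j using Nat.strong_induction_on with
  | _ j ih =>
    refine π.measurable_serve (measurable_pi_lambda _ fun i => ?_)
    simp only [records_apply]
    exact ih i i.2

lemma measurable_jobRoute (m : ℕ) : Measurable fun ω : Sample n k => π.jobRoute ω.input m :=
  measurable_fst.comp (π.measurable_serve (π.measurable_records m))

lemma measurable_taskDeparture (m : ℕ) (ℓ : Fin n) :
    Measurable fun ω : Sample n k => π.taskDeparture ω.input m ℓ :=
  (measurable_pi_apply ℓ).comp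
    (measurable_snd.comp (π.measurable_serve (π.measurable_records m)))

lemma measurableSet_mem_jobRoute (m : ℕ) (ℓ : Fin n) :
    MeasurableSet {ω : Sample n k | ℓ ∈ π.jobRoute ω.input m} :=
  (measurableSet_mem_finset ℓ).preimage (π.measurable_jobRoute m)

lemma measurable_jobCompletion (m : ℕ) :
    Measurable fun ω : Sample n k => π.jobCompletion ω.input m := by
  refine measurable_of_Iic fun x => ?_
  have : (fun ω : Sample n k => π.jobCompletion ω.input m) ⁻¹' Iic x =
      ⋂ ℓ, {ω | ℓ ∈ π.jobRoute ω.input m}ᶜ ∪ {ω | π.taskDeparture ω.input m ℓ ≤ x} := by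
    ext ω
    simp only [mem_preimage, mem_Iic, jobCompletion_le_iff, mem_iInter, mem_union, mem_compl_iff,
      mem_ofPred_eq, imp_iff_not_or]
  rw [this]
  exact MeasurableSet.iInter fun ℓ => (π.measurableSet_mem_jobRoute m ℓ).compl.union
    (measurableSet_le (π.measurable_taskDeparture m ℓ) measurable_const)

lemma measurableSet_lt_jobsInSystem (c : ℕ) (t : ℝ≥0) :
    MeasurableSet {ω : Sample n k | (c : ℕ∞) < π.jobsInSystem ω.input t} := by
  refine measurableSet_lt_encard (fun m => ?_) c
  exact (measurableSet_le (measurable_jobArrival m) measurable_const).inter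
    (measurableSet_lt measurable_const (π.measurable_jobCompletion m))

end Policy

end Measurability

/-! ### Static policies -/

/-- The policy that routes every job independently of the state of the system, as a function of
its type and of a random number. -/
def staticPolicy {n k : ℕ} (M : CodedSystem n k) (f : Fin k → unitInterval → Finset (Fin n))
    (hf : ∀ i, Measurable (f i)) (hmem : ∀ i u, f i u ∈ M.recoverySets i) : Policy M where
  route m h := f (h.1 (Fin.last m)).1 (h.1 (Fin.last m)).2.2
  measurable_route m := by
    have : Measurable fun p : Fin k × unitInterval => f p.1 p.2 :=
      measurable_from_prod_countable_right hf
    exact this.comp (f := fun h : History n k m => ((h.1 (Fin.last m)).1, (h.1 (Fin.last m)).2.2))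
      (by fun_prop)
  route_mem m h := hmem _ _

namespace Policy

variable {n k : ℕ} [NeZero k] {M : CodedSystem n k}

/-- The routing of every job is a function of its type and of its random number. -/
def IsStatic (π : Policy M) (f : Fin k → unitInterval → Finset (Fin n)) : Prop :=
  ∀ (I : Input n k) m, π.jobRoute I m = f (I.jobType m) (I.coin m)

lemma isStatic_staticPolicy (f : Fin k → unitInterval → Finset (Fin n))
    (hf : ∀ i, Measurable (f i)) (hmem : ∀ i u, f i u ∈ M.recoverySets i) :
    (staticPolicy M f hf hmem).IsStatic f := fun _ _ => rfl

variable {π : Policy M} {f : Fin k → unitInterval → Finset (Fin n)}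
  {I : Input n k} {u : ℝ≥0∞} {J : Fin k → ℕ}

lemma IsStatic.jobRoute_shift (hπ : π.IsStatic f) (h : I.CountAt u J) (hu : u ≠ ⊤) (m : ℕ) :
    π.jobRoute (I.shift u J) m = π.jobRoute I (∑ i, J i + m) := by
  rw [hπ, hπ, h.jobType_add hu]
  rfl

/-- Tasks leave earlier if the system is empty at time `u`. -/
lemma IsStatic.add_taskDeparture_shift_le (hπ : π.IsStatic f) (h : I.CountAt u J)
    (hu : u ≠ ⊤) (m : ℕ) (ℓ : Fin n) :
    u + π.taskDeparture (I.shift u J) m ℓ ≤ π.taskDeparture I (∑ i, J i + m) ℓ := by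
  induction m using Nat.strong_induction_on with
  | _ m ih =>
    have hr := hπ.jobRoute_shift h hu
    by_cases hℓ : ℓ ∈ π.jobRoute I (∑ i, J i + m)
    · rw [taskDeparture_of_mem π I hℓ, taskDeparture_of_mem π _ ((hr m).symm ▸ hℓ), ← add_assoc,
        h.jobArrival_add hu]
      refine add_le_add ?_ le_rfl
      rw [add_comm u]
      refine add_le_of_le_tsub_right_of_le (le_max_of_le_left le_self_add)
        (max_le ?_ ((π.freeTime_le_iff _).2 fun j hj hℓj => ?_))
      · exact ENNReal.le_sub_of_add_le_left hu (le_max_left _ _)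
      · refine ENNReal.le_sub_of_add_le_left hu (le_max_of_le_right ((ih j hj).trans ?_))
        exact π.taskDeparture_le_freeTime I (by omega) (hr j ▸ hℓj)
    · rw [taskDeparture_of_notMem π I hℓ, taskDeparture_of_notMem π _ fun h' => hℓ (hr m ▸ h'),
        h.jobArrival_add hu]

lemma IsStatic.jobsInSystem_shift_le (hπ : π.IsStatic f) (t v : ℝ≥0) (h : I.CountAt v J) :
    π.jobsInSystem (I.shift v J) t ≤ π.jobsInSystem I (v + t) := by
  have hu : (v : ℝ≥0∞) ≠ ⊤ := ENNReal.coe_ne_top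
  unfold jobsInSystem
  refine (Function.Injective.encard_image (add_right_injective (∑ i, J i)) _).symm.trans_le ?_
  refine Set.encard_le_encard ?_
  rintro _ ⟨m, ⟨h1, h2⟩, rfl⟩
  refine ⟨?_, ?_⟩
  · dsimp only
    rw [h.jobArrival_add hu, ENNReal.coe_add]
    exact add_le_add le_rfl h1
  · contrapose! h2
    rw [ENNReal.coe_add, jobCompletion_le_iff] at h2
    rw [jobCompletion_le_iff]
    intro ℓ hℓ
    rw [hπ.jobRoute_shift h hu] at hℓ
    exact (ENNReal.add_le_add_iff_left hu).1
      ((hπ.add_taskDeparture_shift_le h hu m ℓ).trans (h2 ℓ hℓ))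

end Policy

/-! ### Infinite product measures -/

section InfinitePi

variable {ι X : Type*} [MeasurableSpace X]

/-- Resampling one coordinate preserves a product measure. -/
lemma measurePreserving_update_infinitePi [DecidableEq ι] (μ : ι → Measure X)
    [∀ i, IsProbabilityMeasure (μ i)] (p : ι) :
    MeasurePreserving (fun z : (ι → X) × X => Function.update z.1 p z.2)
      ((Measure.infinitePi μ).prod (μ p)) (Measure.infinitePi μ) := by
  have hm : Measurable (fun z : (ι → X) × X => Function.update z.1 p z.2) := by
    refine measurable_pi_lambda _ fun i => ?_
    by_cases h : i = p
    · subst h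
      simpa using measurable_snd
    · simp only [Function.update_of_ne h]
      fun_prop
  refine ⟨hm, Measure.eq_infinitePi μ fun s t ht => ?_⟩
  rw [Measure.map_apply hm (MeasurableSet.pi s.countable_toSet fun i _ => ht i)]
  have : (fun z : (ι → X) × X => Function.update z.1 p z.2) ⁻¹' (s : Set ι).pi t =
      ((s.erase p : Finset ι) : Set ι).pi t ×ˢ (if p ∈ s then t p else univ) := by
    ext ⟨x, y⟩
    simp only [mem_preimage, Set.mem_pi, Finset.mem_coe, mem_prod, Finset.mem_erase]
    constructor
    · intro h
      refine ⟨fun i hi => ?_, ?_⟩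
      · simpa [hi.1] using h i hi.2
      · split_ifs with hp
        · simpa using h p hp
        · trivial
    · rintro ⟨h1, h2⟩ i hi
      by_cases hip : i = p
      · subst hip
        simpa [hi] using h2
      · simpa [hip] using h1 i ⟨hip, hi⟩
  rw [this, Measure.prod_prod, Measure.infinitePi_pi μ fun i _ => ht i]
  split_ifs with hp
  · rw [mul_comm, Finset.mul_prod_erase s (fun i => μ i (t i)) hp]
  · rw [measure_univ, mul_one, Finset.erase_eq_of_notMem hp]

/-- Selecting some of the coordinates of a product measure. -/
lemma measurePreserving_comp_infinitePi {κ : Type*} (μ : κ → Measure X)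
    [∀ i, IsProbabilityMeasure (μ i)] {e : ι → κ} (he : Function.Injective e) :
    MeasurePreserving (fun (z : κ → X) i => z (e i)) (Measure.infinitePi μ)
      (Measure.infinitePi fun i => μ (e i)) := by
  classical
  have hm : Measurable (fun (z : κ → X) i => z (e i)) := by fun_prop
  refine ⟨hm, Measure.eq_infinitePi _ fun s t ht => ?_⟩
  rw [Measure.map_apply hm (MeasurableSet.pi s.countable_toSet fun i _ => ht i)]
  have hext : ∀ i, Function.extend e t (fun _ => univ) (e i) = t i := fun i => he.extend_apply _ _ _
  have : (fun (z : κ → X) i => z (e i)) ⁻¹' (s : Set ι).pi t =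
      ((s.image e : Finset κ) : Set κ).pi (Function.extend e t fun _ => univ) := by
    ext z
    simp [Set.mem_pi, hext]
  rw [this, Measure.infinitePi_pi, Finset.prod_image fun _ _ _ _ h => he h]
  · simp only [hext]
  · intro i hi
    obtain ⟨j, -, rfl⟩ := Finset.mem_image.1 hi
    rw [hext]
    exact ht j

/-- The sequence with first term `y` and remaining terms `x`. -/
def seqCons {X : Type*} (y : X) (x : ℕ → X) : ℕ → X
  | 0 => y
  | q + 1 => x q

lemma measurable_seqCons : Measurable fun z : X × (ℕ → X) => seqCons z.1 z.2 := by
  refine measurable_pi_lambda _ fun q => ?_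
  cases q with
  | zero => exact measurable_fst
  | succ q => exact (measurable_pi_apply q).comp measurable_snd

/-- The first term of an i.i.d. sequence is independent of the remaining ones. -/
lemma measurePreserving_seqCons (μ : Measure X) [IsProbabilityMeasure μ] :
    MeasurePreserving (fun z : X × (ℕ → X) => seqCons z.1 z.2)
      (μ.prod (Measure.infinitePi fun _ : ℕ => μ)) (Measure.infinitePi fun _ : ℕ => μ) := by
  let ν := Measure.infinitePi fun _ : ℕ => μ
  have h1 : MeasurePreserving (fun (z : ℕ → X) q => z (q + 1)) ν ν :=
    measurePreserving_comp_infinitePi (fun _ : ℕ => μ) (add_left_injective 1)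
  have h2 : MeasurePreserving (fun z : (ℕ → X) × X => (z.2, fun q => z.1 (q + 1)))
      (ν.prod μ) (μ.prod ν) :=
    Measure.measurePreserving_swap.comp (h1.prod (MeasurePreserving.id μ))
  have h3 : MeasurePreserving (fun z : (ℕ → X) × X => Function.update z.1 0 z.2) (ν.prod μ) ν :=
    measurePreserving_update_infinitePi (fun _ : ℕ => μ) 0
  have h4 : (fun z : (ℕ → X) × X => Function.update z.1 0 z.2) =
      (fun z : X × (ℕ → X) => seqCons z.1 z.2) ∘ fun z : (ℕ → X) × X => (z.2, fun q => z.1 (q + 1)) := by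
    funext z q
    cases q <;> simp [seqCons]
  refine ⟨measurable_seqCons, ?_⟩
  change Measure.map _ (μ.prod ν) = ν
  rw [← h2.map_eq, Measure.map_map measurable_seqCons h2.measurable, ← h4, h3.map_eq]

end InfinitePi

/-! ### Exponential times -/

lemma expTime_of_nonpos {r : ℝ} (hr : r ≤ 0) : expTime r = Measure.dirac ⊤ :=
  if_neg (not_lt.2 hr)

lemma lintegral_expTime {r : ℝ} (hr : 0 < r) {h : ℝ≥0∞ → ℝ≥0∞} (hh : Measurable h) :
    ∫⁻ y, h y ∂expTime r =
      ∫⁻ x in Ioi (0 : ℝ), ENNReal.ofReal (r * Real.exp (-(r * x))) * h (ENNReal.ofReal x) := by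
  have hpdf : Measurable (exponentialPDF r) := (measurable_exponentialPDFReal r).ennreal_ofReal
  rw [expTime, if_pos hr, lintegral_map hh ENNReal.measurable_ofReal, expMeasure, gammaMeasure]
  change ∫⁻ x, (h ∘ ENNReal.ofReal) x ∂(volume.withDensity (exponentialPDF r)) = _
  rw [lintegral_withDensity_eq_lintegral_mul _ hpdf (hh.comp ENNReal.measurable_ofReal),
    restrict_Ioi_eq_restrict_Ici, ← lintegral_indicator measurableSet_Ici]
  refine lintegral_congr fun x => ?_
  by_cases hx : 0 ≤ x
  · rw [indicator_of_mem (show x ∈ Ici (0 : ℝ) from hx), Pi.mul_apply,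
      exponentialPDF_of_nonneg hx, Function.comp]
  · rw [indicator_of_notMem (show x ∉ Ici (0 : ℝ) from hx), Pi.mul_apply,
      exponentialPDF_of_neg (not_le.1 hx), zero_mul]

/-- Exponential tilting of an exponential time. -/
lemma lintegral_mul_exp_expTime {r θ : ℝ} (hr : 0 < r) (hθ : θ < r) {h : ℝ≥0∞ → ℝ≥0∞}
    (hh : Measurable h) :
    ∫⁻ y, h y * ENNReal.ofReal (Real.exp (θ * y.toReal)) ∂expTime r =
      ENNReal.ofReal (r / (r - θ)) * ∫⁻ y, h y ∂expTime (r - θ) := by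
  have h1 : 0 < r - θ := sub_pos.2 hθ
  rw [lintegral_expTime hr (by fun_prop), lintegral_expTime h1 hh, ← lintegral_const_mul _ (by fun_prop)]
  refine setLIntegral_congr_fun measurableSet_Ioi fun x hx => ?_
  rw [ENNReal.toReal_ofReal (le_of_lt hx), mul_left_comm, ← ENNReal.ofReal_mul (by positivity),
    mul_comm, ← mul_assoc, ← ENNReal.ofReal_mul (by positivity)]
  congr 2
  have : Real.exp (-((r - θ) * x)) = Real.exp (-(r * x)) * Real.exp (θ * x) := by
    rw [← Real.exp_add]; congr 1; ring
  rw [this]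
  field_simp

lemma lintegral_exp_expTime {r θ : ℝ} (hr : 0 < r) (hθ : θ < r) :
    ∫⁻ y, ENNReal.ofReal (Real.exp (θ * y.toReal)) ∂expTime r = ENNReal.ofReal (r / (r - θ)) := by
  simpa using lintegral_mul_exp_expTime hr hθ (h := fun _ => 1) measurable_const

/-- The lack of memory of exponential times, for a positive rate. -/
lemma lintegral_expTime_sub_of_pos {r : ℝ} (hr : 0 < r) {u : ℝ≥0∞} (hu : u ≠ ⊤)
    {h : ℝ≥0∞ → ℝ≥0∞} (hh : Measurable h) :
    ∫⁻ y, (if u < y then h (y - u) else 0) ∂expTime r =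
      ENNReal.ofReal (Real.exp (-(r * u.toReal))) * ∫⁻ y, h y ∂expTime r := by
  obtain ⟨a, rfl⟩ : ∃ a : ℝ≥0, u = a := ⟨u.toNNReal, (ENNReal.coe_toNNReal hu).symm⟩
  have hm : Measurable fun y : ℝ≥0∞ => if (a : ℝ≥0∞) < y then h (y - a) else 0 :=
    Measurable.ite (measurableSet_lt measurable_const measurable_id) (by fun_prop) measurable_const
  rw [lintegral_expTime hr hm, lintegral_expTime hr hh, ← lintegral_const_mul _ (by fun_prop),
    ← lintegral_indicator measurableSet_Ioi, ← lintegral_indicator measurableSet_Ioi]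
  symm
  rw [← lintegral_sub_right_eq_self (μ := (volume : Measure ℝ)) _ (a : ℝ)]
  refine lintegral_congr fun x => Eq.symm ?_
  have ha : (a : ℝ≥0∞) = ENNReal.ofReal (a : ℝ) := (ENNReal.ofReal_coe_nnreal).symm
  by_cases hx : (a : ℝ) < x
  · have hx0 : 0 < x := lt_of_le_of_lt a.2 hx
    rw [indicator_of_mem (show x ∈ Ioi (0 : ℝ) from hx0),
      indicator_of_mem (show x - a ∈ Ioi (0 : ℝ) from sub_pos.2 hx), if_pos, ha,
      ← ENNReal.ofReal_sub _ a.coe_nonneg, ← mul_assoc, ← ENNReal.ofReal_mul (Real.exp_pos _).le]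
    · congr 2
      rw [mul_left_comm, ← Real.exp_add, ENNReal.toReal_ofReal a.coe_nonneg]
      congr 2
      ring
    · rw [ha]
      exact (ENNReal.ofReal_lt_ofReal_iff hx0).2 hx
  · rw [indicator_of_notMem (show x - a ∉ Ioi (0 : ℝ) from fun h => hx (sub_pos.1 h))]
    by_cases hx0 : x ∈ Ioi (0 : ℝ)
    · rw [indicator_of_mem hx0, if_neg, mul_zero]
      rw [ha, ENNReal.ofReal_lt_ofReal_iff hx0]
      exact hx
    · rw [indicator_of_notMem hx0]

lemma expTime_Ioi {r : ℝ} (hr : 0 < r) {u : ℝ≥0∞} (hu : u ≠ ⊤) :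
    expTime r (Ioi u) = ENNReal.ofReal (Real.exp (-(r * u.toReal))) := by
  have := lintegral_expTime_sub_of_pos hr hu (h := fun _ => 1) measurable_const
  rw [lintegral_const, measure_univ, mul_one, mul_one] at this
  rw [← this, ← lintegral_indicator_one measurableSet_Ioi]
  simp only [indicator_apply, mem_Ioi, Pi.one_apply]

/-- The lack of memory of exponential times. -/
lemma lintegral_expTime_sub (r : ℝ) {u : ℝ≥0∞} (hu : u ≠ ⊤) {h : ℝ≥0∞ → ℝ≥0∞}
    (hh : Measurable h) :
    ∫⁻ y, (if u < y then h (y - u) else 0) ∂expTime r =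
      expTime r (Ioi u) * ∫⁻ y, h y ∂expTime r := by
  rcases lt_or_ge 0 r with hr | hr
  · rw [lintegral_expTime_sub_of_pos hr hu hh, expTime_Ioi hr hu]
  · have h1 : u < ⊤ := lt_top_iff_ne_top.2 hu
    simp [expTime_of_nonpos hr, h1, hu]

lemma ae_expTime_pos (r : ℝ) : ∀ᵐ y ∂expTime r, 0 < y := by
  rcases lt_or_ge 0 r with hr | hr
  · refine (mem_ae_iff_prob_eq_one measurableSet_Ioi).2 ?_
    simp [expTime_Ioi hr ENNReal.zero_ne_top]
  · rw [expTime_of_nonpos hr, ae_dirac_iff measurableSet_Ioi]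
    exact ENNReal.zero_lt_top

/-! ### Poisson processes -/

/-- The law of the gaps of a Poisson process of rate `r`. -/
noncomputable def gapLaw (r : ℝ) : Measure (ℕ → ℝ≥0∞) := Measure.infinitePi fun _ : ℕ => expTime r

instance (r : ℝ) : IsProbabilityMeasure (gapLaw r) := by
  unfold gapLaw; infer_instance

lemma lintegral_gapLaw (r : ℝ) {h : (ℕ → ℝ≥0∞) → ℝ≥0∞} (hh : Measurable h) :
    ∫⁻ g, h g ∂gapLaw r = ∫⁻ y, ∫⁻ x, h (seqCons y x) ∂gapLaw r ∂expTime r := by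
  have h1 := measurePreserving_seqCons (expTime r)
  rw [gapLaw, ← h1.lintegral_comp hh, 
    lintegral_prod (fun z => h (seqCons z.1 z.2)) (hh.comp h1.measurable).aemeasurable]

lemma measurable_arrivalTime (q : ℕ) : Measurable fun g => arrivalTime g q := by
  unfold arrivalTime
  fun_prop

lemma measurable_residualGaps (u : ℝ≥0∞) (j : ℕ) : Measurable (residualGaps u j) := by
  refine measurable_pi_lambda _ fun q => ?_
  cases q with
  | zero => exact (measurable_arrivalTime j).sub measurable_const
  | succ q => exact measurable_pi_apply _

lemma arrivalTime_seqCons_succ (y : ℝ≥0∞) (x : ℕ → ℝ≥0∞) (q : ℕ) :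
    arrivalTime (seqCons y x) (q + 1) = y + arrivalTime x q := by
  rw [arrivalTime, Finset.sum_range_succ', add_comm]
  rfl

lemma arrivalTime_seqCons_zero (y : ℝ≥0∞) (x : ℕ → ℝ≥0∞) :
    arrivalTime (seqCons y x) 0 = y := by
  simp [arrivalTime, seqCons]

/-- Exactly `j` points lie in `[0, u]`. -/
def PointsAt (u : ℝ≥0∞) (j : ℕ) (g : ℕ → ℝ≥0∞) : Prop :=
  (∀ q < j, arrivalTime g q ≤ u) ∧ u < arrivalTime g j

lemma measurableSet_pointsAt (u : ℝ≥0∞) (j : ℕ) : MeasurableSet {g | PointsAt u j g} := by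
  have : {g | PointsAt u j g} =
      (⋂ q, ⋂ (_ : q < j), {g | arrivalTime g q ≤ u}) ∩ {g | u < arrivalTime g j} := by
    ext g
    simp [PointsAt]
  rw [this]
  exact (MeasurableSet.iInter fun q => MeasurableSet.iInter fun _ =>
    measurableSet_le (measurable_arrivalTime q) measurable_const).inter
    (measurableSet_lt measurable_const (measurable_arrivalTime j))

lemma pointsAt_zero_seqCons {u y : ℝ≥0∞} {x : ℕ → ℝ≥0∞} :
    PointsAt u 0 (seqCons y x) ↔ u < y := by
  simp [PointsAt, arrivalTime_seqCons_zero]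

lemma pointsAt_succ_seqCons {u y : ℝ≥0∞} {x : ℕ → ℝ≥0∞} {j : ℕ} (hu : u ≠ ⊤) :
    PointsAt u (j + 1) (seqCons y x) ↔ y ≤ u ∧ PointsAt (u - y) j x := by
  constructor
  · rintro ⟨h1, h2⟩
    have hy : y ≤ u := by simpa [arrivalTime_seqCons_zero] using h1 0 (Nat.succ_pos j)
    have hy' : y ≠ ⊤ := ne_top_of_le_ne_top hu hy
    refine ⟨hy, fun q hq => ?_, ?_⟩
    · have := h1 (q + 1) (by omega)
      rw [arrivalTime_seqCons_succ] at this
      exact ENNReal.le_sub_of_add_le_left hy' this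
    · rw [arrivalTime_seqCons_succ, add_comm] at h2
      exact ENNReal.sub_lt_of_lt_add hy h2
  · rintro ⟨hy, h1, h2⟩
    refine ⟨fun q hq => ?_, ?_⟩
    · cases q with
      | zero => rwa [arrivalTime_seqCons_zero]
      | succ q =>
        rw [arrivalTime_seqCons_succ]
        refine (add_le_add le_rfl (h1 q (by omega))).trans ?_
        rw [add_tsub_cancel_of_le hy]
    · rw [arrivalTime_seqCons_succ]
      rw [← add_tsub_cancel_of_le hy]
      exact ENNReal.add_lt_add_left (ne_top_of_le_ne_top hu hy) h2

lemma residualGaps_zero_seqCons (u y : ℝ≥0∞) (x : ℕ → ℝ≥0∞) :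
    residualGaps u 0 (seqCons y x) = seqCons (y - u) x := by
  funext q
  cases q with
  | zero => simp [residualGaps, arrivalTime_seqCons_zero, seqCons]
  | succ q => simp [residualGaps, seqCons]

lemma residualGaps_succ_seqCons {u y : ℝ≥0∞} (x : ℕ → ℝ≥0∞) (j : ℕ) (hu : u ≠ ⊤) (hy : y ≤ u) :
    residualGaps u (j + 1) (seqCons y x) = residualGaps (u - y) j x := by
  funext q
  cases q with
  | zero =>
    have hy' : y ≠ ⊤ := ne_top_of_le_ne_top hu hy
    simp only [residualGaps, arrivalTime_seqCons_succ]
    conv_lhs => rw [← add_tsub_cancel_of_le hy]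
    exact ENNReal.add_sub_add_eq_sub_left hy'
  | succ q =>
    simp only [residualGaps]
    rw [show j + 1 + q + 1 = (j + q + 1) + 1 by omega]
    rfl

/-- The process after time `u` is independent of the number of points until time `u`, and it has
the law of the original process. -/
lemma gapLaw_pointsAt_inter (r : ℝ) (j : ℕ) {u : ℝ≥0∞} (hu : u ≠ ⊤) {B : Set (ℕ → ℝ≥0∞)}
    (hB : MeasurableSet B) :
    gapLaw r {g | PointsAt u j g ∧ residualGaps u j g ∈ B} =
      gapLaw r {g | PointsAt u j g} * gapLaw r B := by
  classical
  have hmeas : ∀ u j, MeasurableSet {g | PointsAt u j g ∧ residualGaps u j g ∈ B} := fun u j =>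
    (measurableSet_pointsAt u j).inter (measurable_residualGaps u j hB)
  induction j generalizing u with
  | zero =>
    have hH : Measurable fun y => ∫⁻ x, B.indicator 1 (seqCons y x) ∂gapLaw r :=
      Measurable.lintegral_prod_right ((measurable_one.indicator hB).comp measurable_seqCons)
    rw [← lintegral_indicator_one (hmeas u 0), ← lintegral_indicator_one (measurableSet_pointsAt u 0),
      ← lintegral_indicator_one hB, lintegral_gapLaw r (measurable_one.indicator (hmeas u 0)),
      lintegral_gapLaw r (measurable_one.indicator (measurableSet_pointsAt u 0)),
      lintegral_gapLaw r (measurable_one.indicator hB)]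
    have e1 : ∀ y, ∫⁻ x, ({g | PointsAt u 0 g ∧ residualGaps u 0 g ∈ B}.indicator 1 (seqCons y x)
        : ℝ≥0∞) ∂gapLaw r =
        if u < y then ∫⁻ x, B.indicator 1 (seqCons (y - u) x) ∂gapLaw r else 0 := by
      intro y
      split_ifs with h
      · refine lintegral_congr fun x => ?_
        simp [indicator_apply, pointsAt_zero_seqCons, h, residualGaps_zero_seqCons]
      · simp [pointsAt_zero_seqCons, h]
    have e2 : ∀ y, ∫⁻ x, ({g | PointsAt u 0 g}.indicator 1 (seqCons y x) : ℝ≥0∞) ∂gapLaw r =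
        (Ioi u).indicator 1 y := by
      intro y
      by_cases h : u < y <;> simp [pointsAt_zero_seqCons, h]
    simp only [e1, e2]
    rw [lintegral_expTime_sub r hu hH, lintegral_indicator_one measurableSet_Ioi]
  | succ j ih =>
    rw [← lintegral_indicator_one (hmeas u (j + 1)),
      ← lintegral_indicator_one (measurableSet_pointsAt u (j + 1)),
      lintegral_gapLaw r (measurable_one.indicator (hmeas u (j + 1))),
      lintegral_gapLaw r (measurable_one.indicator (measurableSet_pointsAt u (j + 1))),
      ← lintegral_mul_const]
    · refine lintegral_congr fun y => ?_
      by_cases h : y ≤ u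
      · have h' : u - y ≠ ⊤ := ENNReal.sub_ne_top hu
        have ih := ih h'
        rw [← lintegral_indicator_one (hmeas _ _),
          ← lintegral_indicator_one (measurableSet_pointsAt _ _)] at ih
        convert ih using 2
        · funext x
          simp [indicator_apply, pointsAt_succ_seqCons hu, h, residualGaps_succ_seqCons _ _ hu h]
        · refine lintegral_congr fun x => ?_
          simp [indicator_apply, pointsAt_succ_seqCons hu, h]
      · simp [pointsAt_succ_seqCons hu, h]
    · exact Measurable.lintegral_prod_right ((measurable_one.indicator
        (measurableSet_pointsAt u (j + 1))).comp measurable_seqCons)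

/-- The exponential moments of the number of points in `[0, s]`. -/
lemma lintegral_prod_arrivalTime_le {r : ℝ} (hr : 0 < r) {z : ℝ} (hz : 1 ≤ z) (N : ℕ) (s : ℝ≥0) :
    ∫⁻ g, ∏ q ∈ Finset.range N, (if arrivalTime g q ≤ s then ENNReal.ofReal z else 1) ∂gapLaw r ≤
      ENNReal.ofReal (Real.exp (r * s * (z - 1))) := by
  induction N generalizing s with
  | zero =>
    simp only [Finset.range_zero, Finset.prod_empty, lintegral_const, measure_univ, mul_one]
    rw [← ENNReal.ofReal_one]
    apply ENNReal.ofReal_le_ofReal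
    rw [Real.one_le_exp_iff]
    have := s.2
    have : 0 ≤ z - 1 := by linarith
    positivity
  | succ N ih =>
    have hz0 : 0 < z := by linarith
    have hm : ∀ (N : ℕ) (s : ℝ≥0∞), Measurable fun g => ∏ q ∈ Finset.range N,
        (if arrivalTime g q ≤ s then ENNReal.ofReal z else 1) := fun N s =>
      Finset.measurable_prod _ fun q _ => Measurable.ite
        (measurableSet_le (measurable_arrivalTime q) measurable_const) measurable_const
        measurable_const
    rw [lintegral_gapLaw r (hm _ _)]
    set c : ℝ := r * s * (z - 1) with hc
    -- the two cases for the first gap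
    have key : ∀ y : ℝ≥0∞, ∫⁻ x, ∏ q ∈ Finset.range (N + 1),
        (if arrivalTime (seqCons y x) q ≤ s then ENNReal.ofReal z else 1) ∂gapLaw r ≤
        (Ioi (s : ℝ≥0∞)).indicator 1 y + (Iic (s : ℝ≥0∞)).indicator
          (fun _ => ENNReal.ofReal (z * Real.exp c)) y *
            ENNReal.ofReal (Real.exp (-(r * (z - 1)) * y.toReal)) := by
      intro y
      by_cases hy : y ≤ s
      · have hy' : y ≠ ⊤ := ne_top_of_le_ne_top ENNReal.coe_ne_top hy
        obtain ⟨a, rfl⟩ : ∃ a : ℝ≥0, y = a := ⟨y.toNNReal, (ENNReal.coe_toNNReal hy').symm⟩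
        have has : a ≤ s := ENNReal.coe_le_coe.1 hy
        have h1 : ∀ x, ∏ q ∈ Finset.range (N + 1),
            (if arrivalTime (seqCons (a : ℝ≥0∞) x) q ≤ s then ENNReal.ofReal z else 1) =
            ENNReal.ofReal z * ∏ q ∈ Finset.range N,
              (if arrivalTime x q ≤ (s - a : ℝ≥0) then ENNReal.ofReal z else 1) := by
          intro x
          rw [Finset.prod_range_succ', mul_comm, arrivalTime_seqCons_zero, if_pos hy]
          congr 1
          refine Finset.prod_congr rfl fun q _ => if_congr ?_ rfl rfl
          rw [arrivalTime_seqCons_succ, ENNReal.coe_sub, add_comm]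
          exact (ENNReal.le_sub_iff_add_le_right hy' hy).symm
        simp only [h1]
        rw [lintegral_const_mul _ (hm _ _), indicator_of_notMem (by simpa using has), zero_add,
          indicator_of_mem (show (a : ℝ≥0∞) ∈ Iic (s : ℝ≥0∞) from hy)]
        refine (mul_le_mul_right (ih (s - a)) _).trans (le_of_eq ?_)
        rw [← ENNReal.ofReal_mul hz0.le, ← ENNReal.ofReal_mul (by positivity), mul_assoc z,
          ← Real.exp_add]
        congr 3
        rw [NNReal.coe_sub has, ENNReal.coe_toReal, hc]
        ring
      · have h1 : ∀ x, ∏ q ∈ Finset.range (N + 1),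
            (if arrivalTime (seqCons y x) q ≤ s then ENNReal.ofReal z else 1) = 1 := by
          intro x
          refine Finset.prod_eq_one fun q _ => if_neg fun h => hy (le_trans ?_ h)
          calc y = arrivalTime (seqCons y x) 0 := (arrivalTime_seqCons_zero y x).symm
            _ ≤ _ := arrivalTime_mono _ (Nat.zero_le q)
        simp only [h1]
        rw [lintegral_const, measure_univ, mul_one, indicator_of_mem (show y ∈ Ioi (s : ℝ≥0∞) from
          not_le.1 hy)]
        exact le_self_add
    refine (lintegral_mono key).trans (le_of_eq ?_)
    have hrz : r - -(r * (z - 1)) = r * z := by ring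
    rw [lintegral_add_left (measurable_one.indicator measurableSet_Ioi),
      lintegral_indicator_one measurableSet_Ioi, lintegral_mul_exp_expTime hr
      (by nlinarith) (measurable_const.indicator measurableSet_Iic), hrz,
      lintegral_indicator_const measurableSet_Iic, expTime_Ioi hr ENNReal.coe_ne_top]
    have h2 : expTime (r * z) (Iic (s : ℝ≥0∞)) = 1 - ENNReal.ofReal (Real.exp (-(r * z * s))) := by
      rw [← compl_Ioi, prob_compl_eq_one_sub measurableSet_Ioi,
        expTime_Ioi (by positivity) ENNReal.coe_ne_top, ENNReal.coe_toReal]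
    rw [h2, ← ENNReal.ofReal_one, ← ENNReal.ofReal_sub _ (Real.exp_pos _).le,
      ← ENNReal.ofReal_mul (by positivity), ← ENNReal.ofReal_mul (by positivity),
      ← ENNReal.ofReal_add (Real.exp_pos _).le]
    · congr 1
      have h3 : Real.exp (-(r * s)) = Real.exp c * Real.exp (-(r * z * s)) := by
        rw [← Real.exp_add, hc]; congr 1; ring
      rw [ENNReal.coe_toReal, h3]
      field_simp
      ring
    · have : Real.exp (-(r * z * s)) ≤ 1 := by
        rw [Real.exp_le_one_iff]
        have := s.2
        have : 0 ≤ r * z * s := by positivity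
        linarith
      have : 0 ≤ 1 - Real.exp (-(r * z * s)) := by linarith
      positivity

lemma pointsAt_unique {u : ℝ≥0∞} {i j : ℕ} {g : ℕ → ℝ≥0∞} (hi : PointsAt u i g)
    (hj : PointsAt u j g) : i = j := by
  rcases lt_trichotomy i j with h | h | h
  · exact absurd (hj.1 i h) (not_le.2 hi.2)
  · exact h
  · exact absurd (hi.1 j h) (not_le.2 hj.2)

/-- The number of points in `[0, u]`. -/
noncomputable def pointCount (u : ℝ≥0∞) (g : ℕ → ℝ≥0∞) : ℕ := sInf {q | u < arrivalTime g q}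

lemma pointsAt_pointCount {u : ℝ≥0∞} {g : ℕ → ℝ≥0∞} (h : ∃ q, u < arrivalTime g q) :
    PointsAt u (pointCount u g) g :=
  ⟨fun _ hq => not_lt.1 fun h' => Nat.notMem_of_lt_sInf hq h', Nat.sInf_mem (s := {q | u < arrivalTime g q}) h⟩

lemma PointsAt.pointCount_eq {u : ℝ≥0∞} {j : ℕ} {g : ℕ → ℝ≥0∞} (h : PointsAt u j g) :
    pointCount u g = j :=
  pointsAt_unique (pointsAt_pointCount ⟨j, h.2⟩) h

lemma measurable_pointCount (u : ℝ≥0∞) : Measurable (pointCount u) := by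
  refine measurable_to_countable' fun j => ?_
  have : pointCount u ⁻¹' {j} = {g | PointsAt u j g} ∪
      ((⋃ i, {g | PointsAt u i g})ᶜ ∩ {_g | j = 0}) := by
    ext g
    simp only [mem_preimage, mem_singleton_iff, mem_union, mem_ofPred_eq, mem_inter_iff,
      mem_compl_iff, mem_iUnion]
    by_cases h : ∃ q, u < arrivalTime g q
    · have h1 := pointsAt_pointCount h
      constructor
      · rintro rfl
        exact Or.inl h1
      · rintro (h2 | ⟨h2, -⟩)
        · exact h2.pointCount_eq
        · exact absurd ⟨_, h1⟩ h2
    · have h1 : pointCount u g = 0 := by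
        have : {q | u < arrivalTime g q} = ∅ := by
          ext q
          simpa using fun h' => h ⟨q, h'⟩
        rw [pointCount, this, Nat.sInf_empty]
      have h2 : ∀ i, ¬ PointsAt u i g := fun i hi => h ⟨i, hi.2⟩
      simp [h1, h2, eq_comm]
  rw [this]
  exact (measurableSet_pointsAt u j).union
    ((MeasurableSet.iUnion fun i => measurableSet_pointsAt u i).compl.inter (MeasurableSet.const _))

lemma ae_exists_lt_arrivalTime (r : ℝ) {u : ℝ≥0∞} (hu : u ≠ ⊤) :
    ∀ᵐ g ∂gapLaw r, ∃ q, u < arrivalTime g q := by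
  rcases lt_or_ge 0 r with hr | hr
  · obtain ⟨s, rfl⟩ : ∃ s : ℝ≥0, u = s := ⟨u.toNNReal, (ENNReal.coe_toNNReal hu).symm⟩
    set A : Set (ℕ → ℝ≥0∞) := {g | ∀ q, arrivalTime g q ≤ s} with hA
    have hAm : MeasurableSet A := by
      rw [hA, Set.ofPred_forall]
      exact MeasurableSet.iInter fun q => measurableSet_le (measurable_arrivalTime q) measurable_const
    set C : ℝ≥0∞ := ENNReal.ofReal (Real.exp (r * s * (2 - 1)))
    have key : ∀ N : ℕ, gapLaw r A ≤ C * (2⁻¹ : ℝ≥0∞) ^ N := by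
      intro N
      have h1 := lintegral_prod_arrivalTime_le hr (z := 2) (by norm_num) N s
      have h2 : gapLaw r A * 2 ^ N ≤ ∫⁻ g, ∏ q ∈ Finset.range N,
          (if arrivalTime g q ≤ s then ENNReal.ofReal 2 else 1) ∂gapLaw r := by
        rw [mul_comm, ← lintegral_indicator_const hAm]
        refine lintegral_mono fun g => ?_
        by_cases hg : g ∈ A
        · rw [indicator_of_mem hg, Finset.prod_congr rfl fun q _ => if_pos (hg q)]
          simp
        · rw [indicator_of_notMem hg]
          exact zero_le
      rw [← ENNReal.inv_pow, ← div_eq_mul_inv, ENNReal.le_div_iff_mul_le (by simp) (by simp)]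
      exact h2.trans h1
    have hlim : Tendsto (fun N : ℕ => C * (2⁻¹ : ℝ≥0∞) ^ N) atTop (𝓝 (C * 0)) :=
      ENNReal.Tendsto.const_mul (ENNReal.tendsto_pow_atTop_nhds_zero_of_lt_one
        (by simp [ENNReal.inv_lt_one])) (Or.inr ENNReal.ofReal_ne_top)
    rw [mul_zero] at hlim
    have h0 : gapLaw r A = 0 := le_antisymm (ge_of_tendsto' hlim key) zero_le
    refine measure_mono_null (fun g hg => ?_) h0
    simpa [hA] using hg
  · have h1 : ∀ᵐ y ∂expTime r, u < y := by
      rw [expTime_of_nonpos hr, ae_dirac_iff measurableSet_Ioi]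
      exact lt_top_iff_ne_top.2 hu
    have h2 := (measurePreserving_eval_infinitePi (fun _ : ℕ => expTime r) 0).quasiMeasurePreserving.ae h1
    filter_upwards [h2] with g hg
    exact ⟨0, by rwa [arrivalTime_zero]⟩

/-- The gaps of a point process after time `u`. -/
noncomputable def gapsAfter (u : ℝ≥0∞) (g : ℕ → ℝ≥0∞) : ℕ → ℝ≥0∞ :=
  residualGaps u (pointCount u g) g

lemma measurable_gapsAfter (u : ℝ≥0∞) : Measurable (gapsAfter u) := by
  have : Measurable fun p : ℕ × (ℕ → ℝ≥0∞) => residualGaps u p.1 p.2 :=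
    measurable_from_prod_countable_right fun j => measurable_residualGaps u j
  exact this.comp ((measurable_pointCount u).prodMk measurable_id)

/-- A Poisson process started at a later time is a Poisson process. -/
lemma measurePreserving_gapsAfter (r : ℝ) {u : ℝ≥0∞} (hu : u ≠ ⊤) :
    MeasurePreserving (gapsAfter u) (gapLaw r) (gapLaw r) := by
  refine ⟨measurable_gapsAfter u, Measure.ext fun B hB => ?_⟩
  rw [Measure.map_apply (measurable_gapsAfter u) hB]
  have hdisj : ∀ S : ℕ → Set (ℕ → ℝ≥0∞),
      Pairwise (Function.onFun Disjoint fun j => {g | PointsAt u j g} ∩ S j) := by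
    intro S i j hij
    refine Set.disjoint_left.2 fun g hi hj => hij (pointsAt_unique hi.1 hj.1)
  have hmeas : ∀ j, MeasurableSet {g | PointsAt u j g ∧ residualGaps u j g ∈ B} := fun j =>
    (measurableSet_pointsAt u j).inter (measurable_residualGaps u j hB)
  have hae := ae_exists_lt_arrivalTime r hu
  have h1 : gapLaw r (⋃ j, {g | PointsAt u j g}) = 1 := by
    rw [← mem_ae_iff_prob_eq_one (MeasurableSet.iUnion fun j => measurableSet_pointsAt u j)]
    filter_upwards [hae] with g hg
    exact mem_iUnion.2 ⟨_, pointsAt_pointCount hg⟩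
  have h2 : gapsAfter u ⁻¹' B =ᵐ[gapLaw r] ⋃ j, {g | PointsAt u j g ∧ residualGaps u j g ∈ B} := by
    filter_upwards [hae] with g hg
    refine propext ⟨fun h => mem_iUnion.2 ⟨pointCount u g, pointsAt_pointCount hg, h⟩, fun h => ?_⟩
    obtain ⟨j, hj, hB⟩ := mem_iUnion.1 h
    change residualGaps u (pointCount u g) g ∈ B
    rwa [hj.pointCount_eq]
  rw [measure_congr h2, measure_iUnion (show Pairwise (Function.onFun Disjoint fun j =>
    {g | PointsAt u j g ∧ residualGaps u j g ∈ B}) from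
    hdisj fun j => {g | residualGaps u j g ∈ B}) hmeas]
  simp only [gapLaw_pointsAt_inter r _ hu hB]
  rw [ENNReal.tsum_mul_right, ← measure_iUnion _ fun j => measurableSet_pointsAt u j, h1, one_mul]
  simpa using hdisj fun _ => univ

/-! ### Shifting the sample space in time -/

section Shift

variable {n k : ℕ}

/-- The joint law of the gaps of all types. -/
noncomputable def allGapLaw (lam : Fin k → ℝ) : Measure (Fin k × ℕ → ℝ≥0∞) :=
  Measure.infinitePi fun p : Fin k × ℕ => expTime (lam p.1)

instance (lam : Fin k → ℝ) : IsProbabilityMeasure (allGapLaw lam) := by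
  unfold allGapLaw; infer_instance

lemma measurePreserving_curry_gaps (lam : Fin k → ℝ) :
    MeasurePreserving (fun (g : Fin k × ℕ → ℝ≥0∞) i q => g (i, q)) (allGapLaw lam)
      (Measure.infinitePi fun i => gapLaw (lam i)) :=
  ⟨by fun_prop, Measure.infinitePi_map_curry fun (i : Fin k) (_ : ℕ) => expTime (lam i)⟩

lemma measurePreserving_gaps (lam : Fin k → ℝ) (i : Fin k) :
    MeasurePreserving (fun (g : Fin k × ℕ → ℝ≥0∞) q => g (i, q)) (allGapLaw lam)
      (gapLaw (lam i)) :=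
  (measurePreserving_eval_infinitePi (fun i => gapLaw (lam i)) i).comp
    (measurePreserving_curry_gaps lam)

lemma measurePreserving_allGapsAfter (lam : Fin k → ℝ) {u : ℝ≥0∞} (hu : u ≠ ⊤) :
    MeasurePreserving
      (fun (g : Fin k × ℕ → ℝ≥0∞) (p : Fin k × ℕ) => gapsAfter u (fun q => g (p.1, q)) p.2)
      (allGapLaw lam) (allGapLaw lam) := by
  have h1 := measurePreserving_curry_gaps lam
  have h2 : MeasurePreserving (fun (x : Fin k → ℕ → ℝ≥0∞) i => gapsAfter u (x i))
      (Measure.infinitePi fun i => gapLaw (lam i)) (Measure.infinitePi fun i => gapLaw (lam i)) := by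
    refine ⟨measurable_pi_lambda _ fun i => (measurable_gapsAfter u).comp (measurable_pi_apply i), ?_⟩
    rw [Measure.infinitePi_map_pi _ fun i => measurable_gapsAfter u]
    simp only [(measurePreserving_gapsAfter _ hu).map_eq]
  have h3 : MeasurePreserving (fun (x : Fin k → ℕ → ℝ≥0∞) (p : Fin k × ℕ) => x p.1 p.2)
      (Measure.infinitePi fun i => gapLaw (lam i)) (allGapLaw lam) :=
    ⟨by fun_prop, Measure.infinitePi_map_curry_symm fun (i : Fin k) (_ : ℕ) => expTime (lam i)⟩
  exact h3.comp (h2.comp h1)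

/-- The law of the service times and of the random numbers. -/
noncomputable def markLaw (n : ℕ) : Measure ((ℕ × Fin n → ℝ≥0∞) × (ℕ → unitInterval)) :=
  (Measure.infinitePi fun _ : ℕ × Fin n => expTime 1).prod
    (Measure.infinitePi fun _ : ℕ => (volume : Measure unitInterval))

instance : IsProbabilityMeasure (markLaw n) := by
  unfold markLaw; infer_instance

lemma sampleLaw_eq (n : ℕ) (lam : Fin k → ℝ) :
    sampleLaw n lam = (allGapLaw lam).prod (markLaw n) := rfl

instance (lam : Fin k → ℝ) : IsProbabilityMeasure (sampleLaw n lam) := by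
  rw [sampleLaw_eq]; infer_instance

lemma measurePreserving_markShift (m₀ : ℕ) :
    MeasurePreserving (fun z : (ℕ × Fin n → ℝ≥0∞) × (ℕ → unitInterval) =>
      ((fun p : ℕ × Fin n => z.1 (m₀ + p.1, p.2)), fun m => z.2 (m₀ + m)))
      (markLaw n) (markLaw n) := by
  have he : Function.Injective fun p : ℕ × Fin n => (m₀ + p.1, p.2) := by
    intro p p' h
    simp only [Prod.mk.injEq, add_right_inj] at h
    exact Prod.ext h.1 h.2
  exact (measurePreserving_comp_infinitePi (fun _ : ℕ × Fin n => expTime 1) he).prod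
    (measurePreserving_comp_infinitePi (fun _ : ℕ => (volume : Measure unitInterval))
      (add_right_injective m₀))

/-- The numbers of jobs of the types that arrive until time `u`. -/
noncomputable def Sample.countsAt (u : ℝ≥0∞) (ω : Sample n k) (i : Fin k) : ℕ :=
  pointCount u fun q => ω.1 (i, q)

/-- The sample point seen after time `u`. -/
noncomputable def Sample.shift (u : ℝ≥0∞) (ω : Sample n k) : Sample n k :=
  (fun p => gapsAfter u (fun q => ω.1 (p.1, q)) p.2,
    fun p => ω.2.1 (∑ i, ω.countsAt u i + p.1, p.2), fun m => ω.2.2 (∑ i, ω.countsAt u i + m))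

lemma Sample.input_shift (u : ℝ≥0∞) (ω : Sample n k) :
    (ω.shift u).input = ω.input.shift u (ω.countsAt u) := rfl

lemma measurePreserving_shift (lam : Fin k → ℝ) {u : ℝ≥0∞} (hu : u ≠ ⊤) :
    MeasurePreserving (Sample.shift u) (sampleLaw n lam) (sampleLaw n lam) := by
  rw [sampleLaw_eq]
  have hcount : Measurable fun g : Fin k × ℕ → ℝ≥0∞ => ∑ i, pointCount u fun q => g (i, q) :=
    Finset.measurable_sum _ fun i _ => (measurable_pointCount u).comp (by fun_prop)
  refine (measurePreserving_allGapsAfter lam hu).skew_product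
    (g := fun g (z : (ℕ × Fin n → ℝ≥0∞) × (ℕ → unitInterval)) =>
      ((fun p : ℕ × Fin n => z.1 ((∑ i, pointCount u fun q => g (i, q)) + p.1, p.2)),
        fun m => z.2 ((∑ i, pointCount u fun q => g (i, q)) + m))) ?_
    (ae_of_all _ fun g => (measurePreserving_markShift _).map_eq)
  have : Measurable fun p : ℕ × ((ℕ × Fin n → ℝ≥0∞) × (ℕ → unitInterval)) =>
      ((fun q : ℕ × Fin n => p.2.1 (p.1 + q.1, q.2)), fun m => p.2.2 (p.1 + m)) :=
    measurable_from_prod_countable_right fun m₀ => (measurePreserving_markShift m₀).measurable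
  exact this.comp ((hcount.comp measurable_fst).prodMk measurable_snd)

lemma ae_countAt (lam : Fin k → ℝ) {u : ℝ≥0∞} (hu : u ≠ ⊤) :
    ∀ᵐ ω ∂sampleLaw n lam, ω.input.CountAt u (ω.countsAt u) := by
  refine ae_all_iff.2 fun i => ?_
  have h1 : MeasurePreserving (fun ω : Sample n k => fun q => ω.1 (i, q)) (sampleLaw n lam)
      (gapLaw (lam i)) := by
    rw [sampleLaw_eq]
    exact (measurePreserving_gaps lam i).comp measurePreserving_fst
  filter_upwards [h1.quasiMeasurePreserving.ae (ae_exists_lt_arrivalTime (lam i) hu)] with ω hω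
  exact pointsAt_pointCount hω

/-- The number of jobs in a system with a static policy that starts empty grows stochastically. -/
lemma Policy.IsStatic.monotone_measure [NeZero k] {M : CodedSystem n k} {π : Policy M}
    {f : Fin k → unitInterval → Finset (Fin n)} (hπ : π.IsStatic f) (lam : Fin k → ℝ) (c : ℕ) :
    Monotone fun t : ℝ≥0 => sampleLaw n lam {ω | (c : ℕ∞) < π.jobsInSystem ω.input t} := by
  intro s t hst
  obtain ⟨v, rfl⟩ := exists_add_of_le hst
  have hv : (v : ℝ≥0∞) ≠ ⊤ := ENNReal.coe_ne_top
  dsimp only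
  rw [← (measurePreserving_shift lam hv).measure_preimage
    (π.measurableSet_lt_jobsInSystem c s).nullMeasurableSet]
  refine measure_mono_ae ?_
  filter_upwards [ae_countAt lam hv] with ω hω h
  have h1 : (c : ℕ∞) < π.jobsInSystem (ω.shift v).input s := h
  rw [Sample.input_shift] at h1
  rw [add_comm s v]
  exact h1.trans_le (hπ.jobsInSystem_shift_le s v hω)

end Shift

/-! ### Integrating out single coordinates -/

lemma lintegral_infinitePi_eval {ι X : Type*} [MeasurableSpace X] [DecidableEq ι]
    (μ : ι → Measure X) [∀ i, IsProbabilityMeasure (μ i)] (p : ι) {H : (ι → X) → X → ℝ≥0∞}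
    (hH : Measurable fun z : (ι → X) × X => H z.1 z.2)
    (hp : ∀ x y y', H (Function.update x p y) y' = H x y') :
    ∫⁻ x, H x (x p) ∂Measure.infinitePi μ =
      ∫⁻ x, ∫⁻ y, H x y ∂μ p ∂Measure.infinitePi μ := by
  have h1 := measurePreserving_update_infinitePi μ p
  have h2 : Measurable fun x : ι → X => H x (x p) :=
    hH.comp (measurable_id.prodMk (measurable_pi_apply p))
  rw [← h1.lintegral_comp h2, ← lintegral_prod (fun z : (ι → X) × X => H z.1 z.2) hH.aemeasurable]
  exact lintegral_congr fun z => by rw [hp, Function.update_self]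

lemma lintegral_infinitePi_prod {ι X : Type*} [MeasurableSpace X]
    (μ : ι → Measure X) [∀ i, IsProbabilityMeasure (μ i)] (s : Finset ι) {h : ι → X → ℝ≥0∞}
    (hh : ∀ i, Measurable (h i)) :
    ∫⁻ x, ∏ i ∈ s, h i (x i) ∂Measure.infinitePi μ = ∏ i ∈ s, ∫⁻ y, h i y ∂μ i := by
  classical
  induction s using Finset.induction_on with
  | empty => simp
  | insert a s ha ih =>
    have hm : Measurable fun x : ι → X => ∏ i ∈ s, h i (x i) :=
      Finset.measurable_prod _ fun i _ => (hh i).comp (measurable_pi_apply i)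
    simp only [Finset.prod_insert ha]
    rw [lintegral_infinitePi_eval μ a (H := fun x y => h a y * ∏ i ∈ s, h i (x i))]
    · simp only [lintegral_mul_const _ (hh a)]
      rw [lintegral_const_mul _ hm, ih]
    · exact ((hh a).comp measurable_snd).mul (hm.comp measurable_fst)
    · intro x y y'
      refine congrArg _ (Finset.prod_congr rfl fun i hi => ?_)
      rw [Function.update_of_ne (ne_of_mem_of_not_mem hi ha)]

section Sample

variable {n k : ℕ}

lemma lintegral_sampleLaw_service (lam : Fin k → ℝ) (p : ℕ × Fin n)
    {H : Sample n k → ℝ≥0∞ → ℝ≥0∞} (hH : Measurable fun z : Sample n k × ℝ≥0∞ => H z.1 z.2)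
    (hp : ∀ (ω : Sample n k) y y', H (ω.1, Function.update ω.2.1 p y, ω.2.2) y' = H ω y') :
    ∫⁻ ω, H ω (ω.2.1 p) ∂sampleLaw n lam = ∫⁻ ω, ∫⁻ y, H ω y ∂expTime 1 ∂sampleLaw n lam := by
  have h1 : Measurable fun ω : Sample n k => H ω (ω.2.1 p) :=
    hH.comp (measurable_id.prodMk (by fun_prop))
  have h2 : Measurable fun ω : Sample n k => ∫⁻ y, H ω y ∂expTime 1 :=
    Measurable.lintegral_prod_right hH
  rw [sampleLaw, lintegral_prod _ h1.aemeasurable, lintegral_prod _ h2.aemeasurable]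
  refine lintegral_congr fun g => ?_
  refine (lintegral_prod_symm' _ (h1.comp (measurable_const.prodMk measurable_id))).trans
    (Eq.trans ?_ (lintegral_prod_symm' _ (h2.comp (measurable_const.prodMk measurable_id))).symm)
  refine lintegral_congr fun c => ?_
  refine lintegral_infinitePi_eval (fun _ : ℕ × Fin n => expTime 1) p
    (H := fun s y => H (g, s, c) y) ?_ fun s y y' => hp (g, s, c) y y'
  exact hH.comp (by fun_prop : Measurable fun z : (ℕ × Fin n → ℝ≥0∞) × ℝ≥0∞ =>
    (((g, z.1, c) : Sample n k), z.2))

lemma lintegral_sampleLaw_coin (lam : Fin k → ℝ) (m : ℕ)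
    {H : Sample n k → unitInterval → ℝ≥0∞}
    (hH : Measurable fun z : Sample n k × unitInterval => H z.1 z.2)
    (hp : ∀ (ω : Sample n k) y y', H (ω.1, ω.2.1, Function.update ω.2.2 m y) y' = H ω y') :
    ∫⁻ ω, H ω (ω.2.2 m) ∂sampleLaw n lam = ∫⁻ ω, (∫⁻ y, H ω y) ∂sampleLaw n lam := by
  have h1 : Measurable fun ω : Sample n k => H ω (ω.2.2 m) :=
    hH.comp (measurable_id.prodMk (by fun_prop))
  have h2 : Measurable fun ω : Sample n k => ∫⁻ y, H ω y :=
    Measurable.lintegral_prod_right hH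
  rw [sampleLaw, lintegral_prod _ h1.aemeasurable, lintegral_prod _ h2.aemeasurable]
  refine lintegral_congr fun g => ?_
  refine (lintegral_prod _ (h1.comp (measurable_const.prodMk measurable_id)).aemeasurable).trans
    (Eq.trans ?_
      (lintegral_prod _ (h2.comp (measurable_const.prodMk measurable_id)).aemeasurable).symm)
  refine lintegral_congr fun s => ?_
  refine lintegral_infinitePi_eval (fun _ : ℕ => (volume : Measure unitInterval)) m
    (H := fun c y => H (g, s, c) y) ?_ fun c y y' => hp (g, s, c) y y'
  exact hH.comp (by fun_prop : Measurable fun z : (ℕ → unitInterval) × unitInterval =>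
    (((g, s, z.1) : Sample n k), z.2))

lemma lintegral_sampleLaw_gap (lam : Fin k → ℝ) {h : (Fin k × ℕ → ℝ≥0∞) → ℝ≥0∞}
    (hh : Measurable h) :
    ∫⁻ ω, h ω.1 ∂sampleLaw n lam = ∫⁻ g, h g ∂allGapLaw lam :=
  (measurePreserving_fst (μ := allGapLaw lam) (ν := markLaw n)).lintegral_comp hh

end Sample

/-! ### Exponential moments -/

/-- The function `exp (θ y)` on `[0, ∞]`. -/
noncomputable def expE (θ : ℝ) (y : ℝ≥0∞) : ℝ≥0∞ :=
  if y = ⊤ then ⊤ else ENNReal.ofReal (Real.exp (θ * y.toReal))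

lemma measurable_expE (θ : ℝ) : Measurable (expE θ) :=
  Measurable.ite (measurableSet_singleton ⊤) measurable_const (by fun_prop)

lemma lintegral_expE {r θ : ℝ} (hr : 0 < r) (hθ : θ < r) :
    ∫⁻ y, expE θ y ∂expTime r = ENNReal.ofReal (r / (r - θ)) := by
  rw [← lintegral_exp_expTime hr hθ]
  have h : ∀ᵐ y ∂expTime r, y ≠ ⊤ := by
    rw [expTime, if_pos hr]
    exact (ae_map_iff (p := fun y => y ≠ ⊤) ENNReal.measurable_ofReal.aemeasurable
      (measurableSet_singleton ⊤).compl).2 (ae_of_all _ fun _ => ENNReal.ofReal_ne_top)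
  refine lintegral_congr_ae ?_
  filter_upwards [h] with y hy
  rw [expE, if_neg hy]

lemma expE_add (θ : ℝ) (y z : ℝ≥0∞) : expE θ (y + z) = expE θ y * expE θ z := by
  have h0 : ∀ y, expE θ y ≠ 0 := by
    intro y
    unfold expE
    split_ifs
    · exact ENNReal.top_ne_zero
    · exact (ENNReal.ofReal_pos.2 (Real.exp_pos _)).ne'
  by_cases hy : y = ⊤
  · rw [hy, top_add, expE, if_pos rfl, ENNReal.top_mul (h0 z)]
  by_cases hz : z = ⊤
  · rw [hz, add_top, expE, if_pos rfl, ENNReal.mul_top (h0 y)]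
  rw [expE, expE, expE, if_neg hy, if_neg hz, if_neg (ENNReal.add_ne_top.2 ⟨hy, hz⟩),
    ← ENNReal.ofReal_mul (Real.exp_pos _).le, ← Real.exp_add, ENNReal.toReal_add hy hz, mul_add]

lemma expE_zero (θ : ℝ) : expE θ 0 = 1 := by simp [expE]

lemma expE_sum {ι : Type*} (θ : ℝ) (s : Finset ι) (y : ι → ℝ≥0∞) :
    expE θ (∑ i ∈ s, y i) = ∏ i ∈ s, expE θ (y i) := by
  classical
  induction s using Finset.induction_on with
  | empty => simp [expE_zero]
  | insert a s ha ih => rw [Finset.sum_insert ha, Finset.prod_insert ha, expE_add, ih]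

lemma expE_mono {θ : ℝ} (hθ : 0 ≤ θ) : Monotone (expE θ) := by
  intro y z hyz
  unfold expE
  by_cases hz : z = ⊤
  · simp [hz]
  · rw [if_neg hz, if_neg (ne_top_of_le_ne_top hz hyz)]
    exact ENNReal.ofReal_le_ofReal (Real.exp_le_exp.2 (mul_le_mul_of_nonneg_left
      (ENNReal.toReal_mono hz hyz) hθ))

/-- A Chernoff bound. -/
lemma measure_lt_le_of_expE {Ω : Type*} [MeasurableSpace Ω] (P : Measure Ω) {θ : ℝ} (hθ : 0 ≤ θ)
    {Y : Ω → ℝ≥0∞} (hY : Measurable Y) (x : ℝ≥0) {C : ℝ}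
    (hC : ∫⁻ ω, expE θ (Y ω) ∂P ≤ ENNReal.ofReal C) :
    P {ω | (x : ℝ≥0∞) < Y ω} ≤ ENNReal.ofReal (Real.exp (-(θ * x)) * C) := by
  have h1 : P {ω | (x : ℝ≥0∞) < Y ω} ≤ P {ω | expE θ x ≤ expE θ (Y ω)} :=
    measure_mono fun ω hω => expE_mono hθ (le_of_lt hω)
  have h2 := mul_meas_ge_le_lintegral₀ (μ := P) ((measurable_expE θ).comp hY).aemeasurable (expE θ x)
  have h3 : expE θ x = ENNReal.ofReal (Real.exp (θ * x)) := by
    rw [expE, if_neg ENNReal.coe_ne_top, ENNReal.coe_toReal]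
  rw [Real.exp_neg, ENNReal.ofReal_mul (by positivity), ENNReal.ofReal_inv_of_pos (Real.exp_pos _),
    ← h3, ← ENNReal.div_eq_inv_mul, ENNReal.le_div_iff_mul_le]
  · rw [mul_comm]
    exact (mul_le_mul_right h1 _).trans (h2.trans hC)
  · left
    rw [h3]
    exact (ENNReal.ofReal_pos.2 (Real.exp_pos _)).ne'
  · left
    rw [h3]
    exact ENNReal.ofReal_ne_top

/-! ### The work that arrives at a server -/

section Work

variable {n k : ℕ} [NeZero k] {M : CodedSystem n k}

/-- The work for server `ℓ` among the first `N` jobs that arrive until time `s`. -/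
noncomputable def Policy.work (π : Policy M) (I : Input n k) (ℓ : Fin n) (s : ℝ≥0∞) (N : ℕ) :
    ℝ≥0∞ :=
  ∑ m ∈ Finset.range N,
    if I.jobArrival m ≤ s ∧ ℓ ∈ π.jobRoute I m then I.service (m, ℓ) else 0

lemma Policy.measurable_work (π : Policy M) (ℓ : Fin n) (s : ℝ≥0∞) (N : ℕ) :
    Measurable fun ω : Sample n k => π.work ω.input ℓ s N := by
  refine Finset.measurable_sum _ fun m _ => Measurable.ite ?_ ?_ measurable_const
  · exact (measurableSet_le (measurable_jobArrival m) measurable_const).inter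
      (π.measurableSet_mem_jobRoute m ℓ)
  · unfold Sample.input
    fun_prop

lemma Policy.work_mono (π : Policy M) (I : Input n k) (ℓ : Fin n) (s : ℝ≥0∞) :
    Monotone (π.work I ℓ s) := fun _ _ h =>
  Finset.sum_le_sum_of_subset (Finset.range_mono h)

variable {π : Policy M} {f : Fin k → unitInterval → Finset (Fin n)}

lemma Policy.IsStatic.lintegral_prod_jobs (hπ : π.IsStatic f) (hf : ∀ i, Measurable (f i))
    (lam : Fin k → ℝ) (ℓ : Fin n) (s : ℝ≥0∞) {h : ℝ≥0∞ → ℝ≥0∞} (hh : Measurable h) (N : ℕ)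
    {G : Sample n k → ℝ≥0∞} (hG : Measurable G) (hG' : ∀ ω ω', ω.1 = ω'.1 → G ω = G ω') :
    ∫⁻ ω, G ω * ∏ m ∈ Finset.range N, (if ω.input.jobArrival m ≤ s ∧ ℓ ∈ π.jobRoute ω.input m
      then h (ω.2.1 (m, ℓ)) else 1) ∂sampleLaw n lam =
    ∫⁻ ω, G ω * ∏ m ∈ Finset.range N, (if ω.input.jobArrival m ≤ s then
      ∫⁻ u, (if ℓ ∈ f (ω.input.jobType m) u then ∫⁻ y, h y ∂expTime 1 else 1) else 1)
      ∂sampleLaw n lam := by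
  set κ := ∫⁻ y, h y ∂expTime 1 with hκ
  let ψ : Fin k → ℝ≥0∞ := fun i => ∫⁻ u, (if ℓ ∈ f i u then κ else 1)
  have hfm : ∀ i, MeasurableSet {u | ℓ ∈ f i u} := fun i =>
    (measurableSet_mem_finset ℓ).preimage (hf i)
  have hfm' : ∀ m, MeasurableSet {z : Sample n k × unitInterval |
      ℓ ∈ f (z.1.input.jobType m) z.2} := by
    intro m
    have h1 : Measurable fun p : Fin k × unitInterval => f p.1 p.2 :=
      measurable_from_prod_countable_right hf
    exact (measurableSet_mem_finset ℓ).preimage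
      (h1.comp (((measurable_jobType m).comp measurable_fst).prodMk measurable_snd))
  have hAm : ∀ m, MeasurableSet {ω : Sample n k | ω.input.jobArrival m ≤ s} := fun m =>
    measurableSet_le (measurable_jobArrival m) measurable_const
  let X : ℕ → Sample n k → ℝ≥0∞ := fun m ω =>
    if ω.input.jobArrival m ≤ s ∧ ℓ ∈ π.jobRoute ω.input m then h (ω.2.1 (m, ℓ)) else 1
  have hX : ∀ m, Measurable (X m) := fun m => Measurable.ite
    ((hAm m).inter (π.measurableSet_mem_jobRoute m ℓ)) (hh.comp (by fun_prop)) measurable_const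
  let Y : ℕ → Sample n k → ℝ≥0∞ := fun m ω =>
    if ω.input.jobArrival m ≤ s then ψ (ω.input.jobType m) else 1
  have hY : ∀ m, Measurable (Y m) := fun m => Measurable.ite (hAm m)
    ((measurable_of_countable ψ).comp (measurable_jobType m)) measurable_const
  have hcongr : ∀ {ω ω' : Sample n k}, ω.1 = ω'.1 → ω.input.jobArrival = ω'.input.jobArrival ∧
      ω.input.jobType = ω'.input.jobType := fun h =>
    ⟨Input.jobArrival_congr h, Input.jobType_congr h⟩
  change ∫⁻ ω, G ω * ∏ m ∈ Finset.range N, X m ω ∂sampleLaw n lam =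
    ∫⁻ ω, G ω * ∏ m ∈ Finset.range N, Y m ω ∂sampleLaw n lam
  induction N generalizing G with
  | zero => simp
  | succ N ih =>
    have hP : Measurable fun ω => G ω * ∏ m ∈ Finset.range N, X m ω :=
      hG.mul (Finset.measurable_prod _ fun m _ => hX m)
    -- integrate the service time of the last job
    have e1 := lintegral_sampleLaw_service lam (N, ℓ) (H := fun ω y =>
      (G ω * ∏ m ∈ Finset.range N, X m ω) * if ω.input.jobArrival N ≤ s ∧
        ℓ ∈ f (ω.input.jobType N) (ω.2.2 N) then h y else 1) ?_ ?_
    rotate_left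
    · refine (hP.comp measurable_fst).mul (Measurable.ite ?_ (hh.comp measurable_snd)
        measurable_const)
      have h1 : MeasurableSet {ω : Sample n k | ℓ ∈ f (ω.input.jobType N) (ω.2.2 N)} :=
        (measurable_id.prodMk (by fun_prop) :
          Measurable fun ω : Sample n k => (ω, ω.2.2 N)) (hfm' N)
      exact measurable_fst ((hAm N).inter h1)
    · intro ω y y'
      obtain ⟨h1, h2⟩ := hcongr (ω := (ω.1, Function.update ω.2.1 (N, ℓ) y, ω.2.2)) (ω' := ω) rfl
      rw [hG' (ω.1, Function.update ω.2.1 (N, ℓ) y, ω.2.2) ω rfl]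
      simp only [h1, h2]
      congr 2
      refine Finset.prod_congr rfl fun m hm => ?_
      have hne : (m, ℓ) ≠ (N, ℓ) := fun h => (Finset.mem_range.1 hm).ne (Prod.ext_iff.1 h).1
      simp only [X, h1]
      rw [Function.update_of_ne hne, hπ, hπ, h2]
      rfl
    -- integrate the random number of the last job
    have e2 := lintegral_sampleLaw_coin lam N (H := fun ω u =>
      (G ω * ∏ m ∈ Finset.range N, X m ω) * if ω.input.jobArrival N ≤ s ∧
        ℓ ∈ f (ω.input.jobType N) u then κ else 1) ?_ ?_
    rotate_left
    · refine (hP.comp measurable_fst).mul (Measurable.ite ?_ measurable_const measurable_const)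
      exact (measurable_fst (hAm N)).inter (hfm' N)
    · intro ω y y'
      obtain ⟨h1, h2⟩ := hcongr (ω := (ω.1, ω.2.1, Function.update ω.2.2 N y)) (ω' := ω) rfl
      rw [hG' (ω.1, ω.2.1, Function.update ω.2.2 N y) ω rfl]
      simp only [h1, h2]
      congr 2
      refine Finset.prod_congr rfl fun m hm => ?_
      have hne : m ≠ N := (Finset.mem_range.1 hm).ne
      simp only [X, h1]
      rw [hπ, hπ, h2]
      simp only [Sample.input, Function.update_of_ne hne]
      rfl
    calc ∫⁻ ω, G ω * ∏ m ∈ Finset.range (N + 1), X m ω ∂sampleLaw n lam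
        = ∫⁻ ω, (G ω * ∏ m ∈ Finset.range N, X m ω) * (if ω.input.jobArrival N ≤ s ∧
            ℓ ∈ f (ω.input.jobType N) (ω.2.2 N) then h (ω.2.1 (N, ℓ)) else 1)
            ∂sampleLaw n lam := by
          refine lintegral_congr fun ω => ?_
          rw [Finset.prod_range_succ, mul_assoc]
          congr 2
          simp only [X]
          rw [hπ]
          rfl
      _ = ∫⁻ ω, (G ω * ∏ m ∈ Finset.range N, X m ω) * (if ω.input.jobArrival N ≤ s ∧
            ℓ ∈ f (ω.input.jobType N) (ω.2.2 N) then κ else 1) ∂sampleLaw n lam := by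
          rw [e1]
          refine lintegral_congr fun ω => ?_
          rw [lintegral_const_mul _ (by split_ifs; exacts [hh, measurable_const])]
          congr 1
          split_ifs
          · rfl
          · simp
      _ = ∫⁻ ω, (G ω * ∏ m ∈ Finset.range N, X m ω) * Y N ω ∂sampleLaw n lam := by
          rw [e2]
          refine lintegral_congr fun ω => ?_
          rw [lintegral_const_mul]
          · congr 1
            by_cases h1 : ω.input.jobArrival N ≤ s
            · simp only [Y, h1, true_and, if_true, ψ]
            · simp [Y, h1]
          · by_cases h1 : ω.input.jobArrival N ≤ s
            · simp only [h1, true_and]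
              exact Measurable.ite (hfm _) measurable_const measurable_const
            · simp only [h1, false_and, if_false]
              exact measurable_const
      _ = ∫⁻ ω, (G ω * Y N ω) * ∏ m ∈ Finset.range N, X m ω ∂sampleLaw n lam :=
          lintegral_congr fun ω => by ring
      _ = ∫⁻ ω, (G ω * Y N ω) * ∏ m ∈ Finset.range N, Y m ω ∂sampleLaw n lam := by
          refine ih (hG.mul (hY N)) fun ω ω' hω => ?_
          obtain ⟨h1, h2⟩ := hcongr hω
          simp only [Y, hG' ω ω' hω, h1, h2]
      _ = ∫⁻ ω, G ω * ∏ m ∈ Finset.range (N + 1), Y m ω ∂sampleLaw n lam :=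
          lintegral_congr fun ω => by rw [Finset.prod_range_succ]; ring

/-- Exponential moments of the numbers of arrivals of all types. -/
lemma lintegral_prod_jobType_le {lam : Fin k → ℝ} (hlam : ∀ i, 0 < lam i) {z : Fin k → ℝ}
    (hz : ∀ i, 1 ≤ z i) (s : ℝ≥0) (N : ℕ) :
    ∫⁻ ω, ∏ m ∈ Finset.range N, (if ω.input.jobArrival m ≤ s then
      ENNReal.ofReal (z (ω.input.jobType m)) else 1) ∂sampleLaw n lam ≤
      ENNReal.ofReal (Real.exp (s * ∑ i, lam i * (z i - 1))) := by
  let h : Fin k → (ℕ → ℝ≥0∞) → ℝ≥0∞ := fun i g => ∏ q ∈ Finset.range N,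
    (if arrivalTime g q ≤ s then ENNReal.ofReal (z i) else 1)
  have hh : ∀ i, Measurable (h i) := fun i => Finset.measurable_prod _ fun q _ => Measurable.ite
    (measurableSet_le (measurable_arrivalTime q) measurable_const) measurable_const measurable_const
  have h1 : ∀ ω : Sample n k, ∏ m ∈ Finset.range N, (if ω.input.jobArrival m ≤ s then
      ENNReal.ofReal (z (ω.input.jobType m)) else 1) ≤ ∏ i, h i fun q => ω.1 (i, q) := by
    intro ω
    rw [ω.input.prod_range_jobs (fun i a => if a ≤ s then ENNReal.ofReal (z i) else 1) N]
    refine Finset.prod_le_prod' fun i _ => ?_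
    refine Finset.prod_le_prod_of_subset_of_one_le' (Finset.range_mono (ω.input.counts_le N i))
      fun q _ _ => ?_
    split_ifs
    · rw [← ENNReal.ofReal_one]
      exact ENNReal.ofReal_le_ofReal (hz i)
    · exact le_rfl
  refine (lintegral_mono h1).trans ?_
  have hm : Measurable fun x : Fin k → ℕ → ℝ≥0∞ => ∏ i, h i (x i) :=
    Finset.measurable_prod _ fun i _ => (hh i).comp (measurable_pi_apply i)
  have h2 := measurePreserving_curry_gaps lam
  rw [lintegral_sampleLaw_gap lam (h := fun g => ∏ i, h i fun q => g (i, q))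
    (hm.comp h2.measurable), h2.lintegral_comp hm, lintegral_infinitePi_prod _ _ hh]
  refine (Finset.prod_le_prod' fun i _ =>
    lintegral_prod_arrivalTime_le (hlam i) (hz i) N s).trans (le_of_eq ?_)
  rw [← ENNReal.ofReal_prod_of_nonneg fun i _ => (Real.exp_pos _).le, ← Real.exp_sum,
    Finset.mul_sum]
  congr 2
  exact Finset.sum_congr rfl fun i _ => by ring

/-- The exponential moments of the work that arrives at a server. -/
lemma Policy.IsStatic.lintegral_expE_work_le (hπ : π.IsStatic f) (hf : ∀ i, Measurable (f i))
    {lam : Fin k → ℝ} (hlam : ∀ i, 0 < lam i) (ℓ : Fin n) {p : Fin k → ℝ}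
    (hp : ∀ i, volume {u | ℓ ∈ f i u} = ENNReal.ofReal (p i)) (hp0 : ∀ i, 0 ≤ p i)
    {θ : ℝ} (hθ : 0 ≤ θ) (hθ1 : θ < 1) (s : ℝ≥0) (N : ℕ) :
    ∫⁻ ω, expE θ (π.work ω.input ℓ s N) ∂sampleLaw n lam ≤
      ENNReal.ofReal (Real.exp (s * ((∑ i, lam i * p i) * (θ / (1 - θ))))) := by
  have h1 : ∀ ω : Sample n k, expE θ (π.work ω.input ℓ s N) =
      1 * ∏ m ∈ Finset.range N, (if ω.input.jobArrival m ≤ s ∧ ℓ ∈ π.jobRoute ω.input m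
        then expE θ (ω.2.1 (m, ℓ)) else 1) := by
    intro ω
    rw [work, expE_sum, one_mul]
    refine Finset.prod_congr rfl fun m _ => ?_
    split_ifs
    · rfl
    · exact expE_zero θ
  have hθ2 : 0 < 1 - θ := by linarith
  have hκ : 1 ≤ 1 / (1 - θ) := (one_le_div hθ2).2 (by linarith)
  have hψ : ∀ i, ∫⁻ u, (if ℓ ∈ f i u then ∫⁻ y, expE θ y ∂expTime 1 else 1) =
      ENNReal.ofReal (1 + p i * (1 / (1 - θ) - 1)) := by
    intro i
    have hfm : MeasurableSet {u | ℓ ∈ f i u} := (measurableSet_mem_finset ℓ).preimage (hf i)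
    have hp1 : p i ≤ 1 := by
      have : volume {u | ℓ ∈ f i u} ≤ 1 := prob_le_one
      rw [hp, ENNReal.ofReal_le_one] at this
      exact this
    have h2 : ∀ u, (if ℓ ∈ f i u then ∫⁻ y, expE θ y ∂expTime 1 else 1) =
        {u | ℓ ∈ f i u}.indicator (fun _ => ENNReal.ofReal (1 / (1 - θ))) u +
        {u | ℓ ∈ f i u}ᶜ.indicator (fun _ => (1 : ℝ≥0∞)) u := by
      intro u
      rw [lintegral_expE one_pos hθ1]
      by_cases h : ℓ ∈ f i u <;> simp [h]
    simp only [h2]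
    rw [lintegral_add_left (measurable_const.indicator hfm), lintegral_indicator_const hfm,
      lintegral_indicator_const hfm.compl, prob_compl_eq_one_sub hfm, hp, one_mul,
      ← ENNReal.ofReal_one, ← ENNReal.ofReal_sub _ (hp0 i), ← ENNReal.ofReal_mul (by positivity),
      ← ENNReal.ofReal_add (mul_nonneg (by positivity) (hp0 i)) (by linarith)]
    congr 1
    ring
  simp only [h1]
  rw [hπ.lintegral_prod_jobs hf lam ℓ s (measurable_expE θ) N measurable_const fun _ _ _ => rfl]
  simp only [hψ, one_mul]
  refine (lintegral_prod_jobType_le hlam (z := fun i => 1 + p i * (1 / (1 - θ) - 1)) (fun i => ?_)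
    s N).trans (le_of_eq ?_)
  · have := mul_nonneg (hp0 i) (sub_nonneg.2 hκ)
    linarith
  · congr 3
    rw [Finset.sum_mul]
    refine Finset.sum_congr rfl fun i _ => ?_
    field_simp
    ring

end Work

/-! ### Stability of static policies -/

section StaticStability

variable {n k : ℕ}

/-- The number of jobs that arrive until time `u`. -/
noncomputable def Sample.totalAt (u : ℝ≥0∞) (ω : Sample n k) : ℕ := ∑ i, ω.countsAt u i

lemma measurable_totalAt (u : ℝ≥0∞) : Measurable (Sample.totalAt (n := n) (k := k) u) :=
  Finset.measurable_sum _ fun i _ => (measurable_pointCount u).comp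
    (by fun_prop : Measurable fun ω : Sample n k => fun q => ω.1 (i, q))

lemma tendsto_measure_lt_totalAt (lam : Fin k → ℝ) (u : ℝ≥0∞) :
    Tendsto (fun c : ℕ => sampleLaw n lam {ω | c < ω.totalAt u}) atTop (𝓝 0) := by
  have h1 : Antitone fun c : ℕ => {ω : Sample n k | c < ω.totalAt u} :=
    fun c c' h ω hω => lt_of_le_of_lt h hω
  have h2 := tendsto_measure_iInter_atTop (μ := sampleLaw n lam)
    (fun c => (measurableSet_lt measurable_const (measurable_totalAt u)).nullMeasurableSet) h1
    ⟨0, measure_ne_top _ _⟩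
  have h3 : ⋂ c : ℕ, {ω : Sample n k | c < ω.totalAt u} = ∅ := by
    ext ω
    simp only [mem_iInter, mem_ofPred_eq, mem_empty_iff_false, iff_false, not_forall, not_lt]
    exact ⟨_, le_rfl⟩
  rwa [h3, measure_empty] at h2

variable [NeZero k] {M : CodedSystem n k} {π : Policy M}
  {f : Fin k → unitInterval → Finset (Fin n)}

lemma Policy.IsStatic.measure_lt_work_le (hπ : π.IsStatic f) (hf : ∀ i, Measurable (f i))
    {lam : Fin k → ℝ} (hlam : ∀ i, 0 < lam i) (ℓ : Fin n) {p : Fin k → ℝ}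
    (hp : ∀ i, volume {u | ℓ ∈ f i u} = ENNReal.ofReal (p i)) (hp0 : ∀ i, 0 ≤ p i)
    {θ : ℝ} (hθ : 0 ≤ θ) (hθ1 : θ < 1) (s x : ℝ≥0) :
    sampleLaw n lam {ω | ∃ N, (x : ℝ≥0∞) < π.work ω.input ℓ s N} ≤
      ENNReal.ofReal (Real.exp (-(θ * x)) *
        Real.exp (s * ((∑ i, lam i * p i) * (θ / (1 - θ))))) := by
  have h1 : {ω : Sample n k | ∃ N, (x : ℝ≥0∞) < π.work ω.input ℓ s N} =
      ⋃ N, {ω | (x : ℝ≥0∞) < π.work ω.input ℓ s N} := by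
    ext ω
    simp
  have h2 : Monotone fun N => {ω : Sample n k | (x : ℝ≥0∞) < π.work ω.input ℓ s N} :=
    fun N N' h ω hω => lt_of_lt_of_le hω (π.work_mono ω.input ℓ s h)
  rw [h1, h2.measure_iUnion]
  exact iSup_le fun N => measure_lt_le_of_expE _ hθ (π.measurable_work ℓ s N) x
    (hπ.lintegral_expE_work_le hf hlam ℓ hp hp0 hθ hθ1 s N)

lemma measurableSet_exists_lt_work (π : Policy M) (ℓ : Fin n) (s x : ℝ≥0∞) :
    MeasurableSet {ω : Sample n k | ∃ N, x < π.work ω.input ℓ s N} := by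
  rw [Set.ofPred_exists]
  exact MeasurableSet.iUnion fun N => measurableSet_lt measurable_const (π.measurable_work ℓ s N)

/-- A task that is delayed for a time `X` has seen a large amount of work arrive. -/
lemma Policy.IsStatic.exists_lt_work (hπ : π.IsStatic f) {I : Input n k}
    {J : ℕ → Fin k → ℕ} (hJ : ∀ a : ℕ, I.CountAt a (J a)) (h0 : ∀ j, 0 < I.jobArrival j)
    {v X m : ℕ} {ℓ : Fin n} (hm : I.jobArrival m ≤ v) (hℓ : ℓ ∈ π.jobRoute I m)
    (hD : ((v + X : ℕ) : ℝ≥0∞) < π.taskDeparture I m ℓ) :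
    ∃ a < v, ∃ N, ((v - (a + 1) + X : ℕ) : ℝ≥0∞) <
      π.work (I.shift a (J a)) ℓ ((v - a : ℕ) : ℝ≥0∞) N := by
  classical
  obtain ⟨j, hjm, hj⟩ := π.exists_taskDeparture_le I m ℓ hℓ
  have hjv : I.jobArrival j ≤ v := (I.jobArrival_mono hjm).trans hm
  -- the unit time interval in which job `j` arrives
  obtain ⟨a, ha1, ha2⟩ : ∃ a : ℕ, (a : ℝ≥0∞) < I.jobArrival j ∧ I.jobArrival j ≤ (a + 1 : ℕ) := by
    have hex : ∃ b : ℕ, I.jobArrival j ≤ b := ⟨v, hjv⟩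
    have hb := Nat.find_spec hex
    have hb0 : Nat.find hex ≠ 0 := fun h => by
      rw [h] at hb
      exact (h0 j).not_ge (by simpa using hb)
    obtain ⟨a, ha⟩ := Nat.exists_eq_succ_of_ne_zero hb0
    refine ⟨a, not_le.1 (Nat.find_min hex (by omega)), ?_⟩
    rw [ha] at hb
    exact hb
  have hav : a < v := by exact_mod_cast ha1.trans_le hjv
  have hu : (a : ℝ≥0∞) ≠ ⊤ := ENNReal.natCast_ne_top a
  set m₀ := ∑ i, J a i with hm₀
  have hm₀j : m₀ ≤ j := ((hJ a).lt_jobArrival_iff).1 ha1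
  refine ⟨a, hav, m - m₀ + 1, ?_⟩
  have hwork : (∑ i ∈ Finset.Icc j m, if ℓ ∈ π.jobRoute I i then I.service (i, ℓ) else 0) ≤
      π.work (I.shift a (J a)) ℓ ((v - a : ℕ) : ℝ≥0∞) (m - m₀ + 1) := by
    have h1 : ∀ i ∈ Finset.range (m - m₀ + 1), (if (I.shift a (J a)).jobArrival i ≤ ((v - a : ℕ) : ℝ≥0∞)
        ∧ ℓ ∈ π.jobRoute (I.shift a (J a)) i then (I.shift a (J a)).service (i, ℓ) else 0) =
        if ℓ ∈ π.jobRoute I (m₀ + i) then I.service (m₀ + i, ℓ) else 0 := by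
      intro i hi
      have h2 : (I.shift a (J a)).jobArrival i ≤ ((v - a : ℕ) : ℝ≥0∞) := by
        rw [← ENNReal.add_le_add_iff_left hu, ← (hJ a).jobArrival_add hu, ← Nat.cast_add,
          Nat.add_sub_cancel' hav.le]
        refine (I.jobArrival_mono ?_).trans hm
        have := Finset.mem_range.1 hi
        omega
      rw [hπ.jobRoute_shift (hJ a) hu]
      simp only [h2, true_and]
      rfl
    rw [Policy.work, Finset.sum_congr rfl h1]
    rw [← Finset.sum_image (s := Finset.range (m - m₀ + 1)) (g := fun i => m₀ + i)
      (f := fun i => if ℓ ∈ π.jobRoute I i then I.service (i, ℓ) else 0)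
      fun _ _ _ _ h => add_right_injective m₀ h]
    refine Finset.sum_le_sum_of_subset fun i hi => ?_
    obtain ⟨hi1, hi2⟩ := Finset.mem_Icc.1 hi
    exact Finset.mem_image.2 ⟨i - m₀, Finset.mem_range.2 (by omega), by omega⟩
  have h3 : ((v + X : ℕ) : ℝ≥0∞) < (a + 1 : ℕ) +
      π.work (I.shift a (J a)) ℓ ((v - a : ℕ) : ℝ≥0∞) (m - m₀ + 1) :=
    (hD.trans_le hj).trans_le (add_le_add ha2 hwork)
  rw [show v + X = (a + 1) + (v - (a + 1) + X) by omega, Nat.cast_add] at h3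
  exact lt_of_add_lt_add_left h3

lemma ae_jobArrival_pos (lam : Fin k → ℝ) :
    ∀ᵐ ω ∂sampleLaw n lam, ∀ j, 0 < ω.input.jobArrival j := by
  have h1 : ∀ᵐ ω ∂sampleLaw n lam, ∀ i, 0 < ω.1 (i, 0) := by
    refine ae_all_iff.2 fun i => ?_
    have h2 : MeasurePreserving (fun ω : Sample n k => ω.1 (i, 0)) (sampleLaw n lam)
        (expTime (lam i)) :=
      (measurePreserving_eval_infinitePi (fun p : Fin k × ℕ => expTime (lam p.1)) (i, 0)).comp
        (measurePreserving_fst (μ := allGapLaw lam) (ν := markLaw n))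
    exact h2.quasiMeasurePreserving.ae (ae_expTime_pos (lam i))
  filter_upwards [h1] with ω hω j
  refine lt_of_lt_of_le ?_ (ω.input.jobArrival_mono (Nat.zero_le j))
  change 0 < ω.input.typeArrival (ω.input.jobType 0) 0
  rw [Input.typeArrival_eq, arrivalTime_zero]
  exact hω _

lemma Policy.IsStatic.measure_lt_jobsInSystem_le (hπ : π.IsStatic f) (lam : Fin k → ℝ)
    (v X c : ℕ) :
    sampleLaw n lam {ω | (c : ℕ∞) < π.jobsInSystem ω.input ((v + X : ℕ) : ℝ≥0)} ≤
      sampleLaw n lam {ω | c < ω.totalAt X} + ∑ ℓ, ∑ a ∈ Finset.range v,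
        sampleLaw n lam {ω | ∃ N, ((v - (a + 1) + X : ℕ) : ℝ≥0∞) <
          π.work ω.input ℓ ((v - a : ℕ) : ℝ≥0∞) N} := by
  have hcast : ∀ a : ℕ, (a : ℝ≥0∞) ≠ ⊤ := ENNReal.natCast_ne_top
  let B : Fin n → ℕ → Set (Sample n k) := fun ℓ a => {ω | ∃ N, ((v - (a + 1) + X : ℕ) : ℝ≥0∞) <
          π.work ω.input ℓ ((v - a : ℕ) : ℝ≥0∞) N}
  have h1 : ({ω : Sample n k | (c : ℕ∞) < π.jobsInSystem ω.input ((v + X : ℕ) : ℝ≥0)} : Set _) ≤ᵐ[sampleLaw n lam]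
      (Sample.shift v ⁻¹' {ω | c < ω.totalAt X} ∪
        ⋃ ℓ, ⋃ a ∈ Finset.range v, Sample.shift a ⁻¹' B ℓ a : Set (Sample n k)) := by
    filter_upwards [ae_all_iff.2 fun a : ℕ => ae_countAt (n := n) lam (hcast a),
      ae_jobArrival_pos lam, (measurePreserving_shift (n := n) lam (hcast v)).quasiMeasurePreserving.ae
        (ae_countAt lam (hcast X))] with ω hω h0 hv hc
    refine or_iff_not_imp_right.2 fun hn2 => ?_
    simp only [mem_iUnion, not_exists] at hn2
    change c < (ω.shift v).totalAt X
    change (c : ℕ∞) < π.jobsInSystem ω.input ((v + X : ℕ) : ℝ≥0) at hc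
    have hsub : {m : ℕ | ω.input.jobArrival m ≤ (((v + X : ℕ) : ℝ≥0) : ℝ≥0∞) ∧
        (((v + X : ℕ) : ℝ≥0) : ℝ≥0∞) < π.jobCompletion ω.input m} ⊆
        ((Finset.range ((ω.shift v).totalAt X)).image
          fun m => ω.totalAt v + m : Finset ℕ) := by
      rintro m ⟨hm1, hm2⟩
      rw [ENNReal.coe_natCast] at hm1 hm2
      have hvm : (v : ℝ≥0∞) < ω.input.jobArrival m := by
        by_contra hle
        rw [← not_le, jobCompletion_le_iff] at hm2
        push Not at hm2
        obtain ⟨ℓ, hℓ, hD⟩ := hm2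
        obtain ⟨a, hav, N, hN⟩ := hπ.exists_lt_work (J := fun a => ω.countsAt a) hω h0 (not_lt.1 hle) hℓ hD
        exact hn2 ℓ a (Finset.mem_range.2 hav) ⟨N, hN⟩
      have hge : ω.totalAt v ≤ m := ((hω v).lt_jobArrival_iff).1 hvm
      obtain ⟨m', rfl⟩ := Nat.exists_eq_add_of_le hge
      rw [Finset.coe_image]
      refine ⟨m', ?_, rfl⟩
      rw [Finset.mem_coe, Finset.mem_range]
      by_contra hlt
      have h2 := (hv.lt_jobArrival_iff).2 (not_lt.1 hlt)
      rw [Nat.cast_add] at hm1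
      have h3 : ω.input.jobArrival (ω.totalAt v + m') = v + (ω.shift v).input.jobArrival m' :=
        (hω v).jobArrival_add (hcast v) m'
      rw [h3, ENNReal.add_le_add_iff_left (hcast v)] at hm1
      exact hm1.not_gt h2
    have h4 := lt_of_lt_of_le hc (Set.encard_le_encard hsub)
    rw [Set.encard_coe_eq_coe_finsetCard] at h4
    have h5 := lt_of_lt_of_le (by exact_mod_cast h4) Finset.card_image_le
    rwa [Finset.card_range] at h5
  refine (measure_mono_ae h1).trans ((measure_union_le _ _).trans (add_le_add ?_ ?_))
  · rw [(measurePreserving_shift lam (hcast v)).measure_preimage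
      (measurableSet_lt measurable_const (measurable_totalAt _)).nullMeasurableSet]
  · refine (measure_iUnion_fintype_le _ _).trans (Finset.sum_le_sum fun ℓ _ => ?_)
    refine (measure_biUnion_finset_le _ _).trans (Finset.sum_le_sum fun a _ => ?_)
    rw [(measurePreserving_shift lam (hcast a)).measure_preimage
      (measurableSet_exists_lt_work π ℓ _ _).nullMeasurableSet]

/-- A static policy is stable if the load of every server is less than `1`. -/
lemma Policy.IsStatic.isStable (hπ : π.IsStatic f) (hf : ∀ i, Measurable (f i))
    {lam : Fin k → ℝ} (hlam : ∀ i, 0 < lam i) {p : Fin k → Fin n → ℝ}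
    (hp : ∀ i ℓ, volume {u | ℓ ∈ f i u} = ENNReal.ofReal (p i ℓ)) (hp0 : ∀ i ℓ, 0 ≤ p i ℓ)
    {ρ : ℝ} (hρ0 : 0 ≤ ρ) (hρ : ρ < 1) (hload : ∀ ℓ, ∑ i, lam i * p i ℓ ≤ ρ) :
    π.IsStable lam := by
  obtain ⟨θ, b, hθ0, hθ1, hb, hbθ⟩ : ∃ θ b : ℝ, 0 < θ ∧ θ < 1 ∧ ρ * (θ / (1 - θ)) = b ∧ b < θ := by
    refine ⟨(1 - ρ) / 2, _, by linarith, by linarith, rfl, ?_⟩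
    have h1 : 0 < 1 - (1 - ρ) / 2 := by linarith
    rw [← mul_div_assoc, div_lt_iff₀ h1]
    nlinarith
  set q : ℝ := Real.exp (-(θ - b)) with hq
  have hq0 : 0 < q := Real.exp_pos _
  have hq1 : q < 1 := by rw [hq, Real.exp_lt_one_iff]; linarith
  have hb0 : 0 ≤ b := by
    have : 0 < 1 - θ := by linarith
    rw [← hb]; positivity
  -- the tail bound for the work
  have htail : ∀ ℓ (v X : ℕ), ∑ a ∈ Finset.range v, sampleLaw n lam {ω | ∃ N,
      ((v - (a + 1) + X : ℕ) : ℝ≥0∞) < π.work ω.input ℓ ((v - a : ℕ) : ℝ≥0∞) N} ≤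
      ENNReal.ofReal (Real.exp b * (1 - q)⁻¹ * Real.exp (-θ) ^ X) := by
    intro ℓ v X
    have h1 : ∀ r : ℕ, sampleLaw n lam {ω | ∃ N, ((r + X : ℕ) : ℝ≥0∞) <
        π.work ω.input ℓ ((r + 1 : ℕ) : ℝ≥0∞) N} ≤
        ENNReal.ofReal (Real.exp b * Real.exp (-θ) ^ X * q ^ r) := by
      intro r
      have h2 := hπ.measure_lt_work_le hf hlam ℓ (hp · ℓ) (hp0 · ℓ) hθ0.le hθ1
        ((r + 1 : ℕ) : ℝ≥0) ((r + X : ℕ) : ℝ≥0)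
      rw [ENNReal.coe_natCast, ENNReal.coe_natCast] at h2
      refine h2.trans (ENNReal.ofReal_le_ofReal ?_)
      rw [hq, ← Real.exp_nat_mul, ← Real.exp_nat_mul, ← Real.exp_add, ← Real.exp_add,
        ← Real.exp_add, Real.exp_le_exp]
      have h3 : (∑ i, lam i * p i ℓ) * (θ / (1 - θ)) ≤ b := by
        rw [← hb]
        exact mul_le_mul_of_nonneg_right (hload ℓ) (div_nonneg hθ0.le (by linarith))
      push_cast
      have : (0 : ℝ) ≤ r := Nat.cast_nonneg r
      nlinarith
    have h2 : ∑ a ∈ Finset.range v, sampleLaw n lam {ω | ∃ N,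
        ((v - (a + 1) + X : ℕ) : ℝ≥0∞) < π.work ω.input ℓ ((v - a : ℕ) : ℝ≥0∞) N} ≤
        ∑ r ∈ Finset.range v, ENNReal.ofReal (Real.exp b * Real.exp (-θ) ^ X * q ^ r) := by
      rw [← Finset.sum_range_reflect (fun r =>
        ENNReal.ofReal (Real.exp b * Real.exp (-θ) ^ X * q ^ r))]
      refine Finset.sum_le_sum fun a ha => ?_
      have ha := Finset.mem_range.1 ha
      have h3 := h1 (v - 1 - a)
      rw [show v - 1 - a + 1 = v - a by omega, show v - 1 - a = v - (a + 1) by omega] at h3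
      rw [show v - 1 - a = v - (a + 1) by omega]
      exact h3
    refine h2.trans ?_
    rw [← ENNReal.ofReal_sum_of_nonneg fun r _ => by positivity, ← Finset.mul_sum]
    apply ENNReal.ofReal_le_ofReal
    have h4 : ∑ r ∈ Finset.range v, q ^ r ≤ (1 - q)⁻¹ := by
      rw [← tsum_geometric_of_lt_one hq0.le hq1]
      exact (summable_geometric_of_lt_one hq0.le hq1).sum_le_tsum _ fun r _ => by positivity
    calc Real.exp b * Real.exp (-θ) ^ X * ∑ r ∈ Finset.range v, q ^ r
        ≤ Real.exp b * Real.exp (-θ) ^ X * (1 - q)⁻¹ := by gcongr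
      _ = Real.exp b * (1 - q)⁻¹ * Real.exp (-θ) ^ X := by ring
  -- the limits exist by monotonicity
  refine ⟨fun c => ⨆ t : ℝ≥0, sampleLaw n lam {ω | (c : ℕ∞) < π.jobsInSystem ω.input t},
    fun c => tendsto_atTop_iSup (hπ.monotone_measure lam c), ?_⟩
  set K : ℝ := n * (Real.exp b * (1 - q)⁻¹) with hK
  have hbound : ∀ c X : ℕ,
      (⨆ t : ℝ≥0, sampleLaw n lam {ω | (c : ℕ∞) < π.jobsInSystem ω.input t}) ≤
      sampleLaw n lam {ω | c < ω.totalAt X} + ENNReal.ofReal (K * Real.exp (-θ) ^ X) := by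
    intro c X
    refine iSup_le fun t => ?_
    obtain ⟨v, hv⟩ := exists_nat_ge t
    have hle : t ≤ ((v + X : ℕ) : ℝ≥0) := hv.trans (by exact_mod_cast Nat.le_add_right v X)
    refine ((hπ.monotone_measure lam c) hle).trans
      ((hπ.measure_lt_jobsInSystem_le lam v X c).trans (add_le_add le_rfl ?_))
    refine (Finset.sum_le_sum fun ℓ _ => htail ℓ v X).trans (le_of_eq ?_)
    rw [Finset.sum_const, Finset.card_univ, Fintype.card_fin, nsmul_eq_mul,
      ← ENNReal.ofReal_natCast, ← ENNReal.ofReal_mul (Nat.cast_nonneg n), hK]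
    congr 1
    ring
  rw [ENNReal.tendsto_atTop_zero]
  intro ε hε
  have hε2 : 0 < ε / 2 := ENNReal.half_pos hε.ne'
  have hlim : Tendsto (fun X : ℕ => ENNReal.ofReal (K * Real.exp (-θ) ^ X)) atTop (𝓝 0) := by
    rw [← ENNReal.ofReal_zero, ← mul_zero K]
    exact ENNReal.tendsto_ofReal ((tendsto_pow_atTop_nhds_zero_of_lt_one (Real.exp_pos _).le
      (by rw [Real.exp_lt_one_iff]; linarith)).const_mul K)
  obtain ⟨X, hX⟩ := (hlim.eventually (ge_mem_nhds hε2)).exists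
  obtain ⟨c₀, hc₀⟩ := eventually_atTop.1
    ((tendsto_measure_lt_totalAt (n := n) lam X).eventually (ge_mem_nhds hε2))
  exact ⟨c₀, fun c hc => (hbound c X).trans ((add_le_add (hc₀ c hc) hX).trans
    (ENNReal.add_halves ε).le)⟩

end StaticStability

/-! ### Every vector of rates in the interior of the region is stabilizable -/

/-- A random choice from a finite set with prescribed probabilities. -/
lemma exists_unitInterval_choice {A : Type*} (s : Finset A) {w : A → ℝ} (hw : ∀ a ∈ s, 0 ≤ w a)
    (h1 : ∑ a ∈ s, w a = 1) :
    ∃ f : unitInterval → A, (∀ u, f u ∈ s) ∧ (∀ P : Set A, MeasurableSet (f ⁻¹' P)) ∧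
      ∀ (p : A → Prop) [DecidablePred p],
        volume {u | p (f u)} = ENNReal.ofReal (∑ a ∈ s with p a, w a) := by
  classical
  let _ : MeasurableSpace s := ⊤
  let μ : PMF s := PMF.ofFintype (fun a => ENNReal.ofReal (w a)) (by
    rw [← ENNReal.ofReal_sum_of_nonneg fun (a : s) _ => hw a a.2, Finset.sum_coe_sort s w, h1,
      ENNReal.ofReal_one])
  have : Nonempty s := μ.support_nonempty.to_type
  obtain ⟨g, hg, hμ⟩ := μ.toMeasure.exists_measurable_map_eq
  refine ⟨fun u => g u, fun u => (g u).2, fun P => ?_, fun p _ => ?_⟩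
  · exact hg (t := Subtype.val ⁻¹' P) trivial
  · have h2 : volume {u | p (g u)} = μ.toMeasure {a | p a} := by
      rw [← hμ, Measure.map_apply hg trivial]
      rfl
    rw [h2, PMF.toMeasure_apply_fintype, ENNReal.ofReal_sum_of_nonneg fun a ha =>
      hw a (Finset.mem_filter.1 ha).1, Finset.sum_filter, ← Finset.sum_coe_sort s]
    refine Finset.sum_congr rfl fun a _ => ?_
    by_cases h : p a <;> simp [Set.indicator, h, μ]

lemma CodedSystem.interior_codedRegion_subset_stabilizable {n k : ℕ} [NeZero k]
    (M : CodedSystem n k) : interior M.codedRegion ⊆ M.stabilizable := by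
  classical
  intro lam hlam
  have hpos := M.pos_of_mem_interior hlam
  obtain ⟨s, hs, x, hx0, hx1, hx2⟩ := M.exists_smul_mem_of_mem_interior hlam
  have hs0 : 0 < s := by linarith
  have hsl : ∀ i, 0 < s * lam i := fun i => mul_pos hs0 (hpos i)
  choose f hfmem hfmeas hf using fun i => exists_unitInterval_choice (M.recoverySets i)
    (w := fun R => x i R / (s * lam i)) (fun R hR => div_nonneg (hx0 i R hR) (hsl i).le) (by
      rw [← Finset.sum_div, ← hx1 i]
      exact div_self (hsl i).ne')
  have hfm : ∀ i, Measurable (f i) := fun i P _ => hfmeas i P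
  refine ⟨fun i => (hpos i).le, staticPolicy M f hfm hfmem, ?_⟩
  refine (Policy.isStatic_staticPolicy f hfm hfmem).isStable hfm hpos
    (p := fun i ℓ => ∑ R ∈ M.recoverySets i with ℓ ∈ R, x i R / (s * lam i))
    (fun i ℓ => hf i fun R => ℓ ∈ R)
    (fun i ℓ => Finset.sum_nonneg fun R hR =>
      div_nonneg (hx0 i R (Finset.mem_filter.1 hR).1) (hsl i).le)
    (ρ := 1 / s) (by positivity) ((div_lt_one hs0).2 hs) fun ℓ => ?_
  have h1 : ∀ i, lam i * ∑ R ∈ M.recoverySets i with ℓ ∈ R, x i R / (s * lam i) =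
      (∑ R ∈ M.recoverySets i with ℓ ∈ R, x i R) / s := fun i => by
    rw [← Finset.sum_div]
    field_simp [(hpos i).ne']
  rw [Finset.sum_congr rfl fun i _ => h1 i, ← Finset.sum_div]
  exact div_le_div_of_nonneg_right (hx2 ℓ) hs0.le

/-! ### Under a stable policy, not many tasks are sent to a server -/

section TaskBound

variable {n k : ℕ} [NeZero k] {M : CodedSystem n k} (π : Policy M)

namespace Policy

open Classical in
/-- The jobs among the first `N` that arrive until time `t` and have a task at server `ℓ`. -/
noncomputable def tasksUntil (I : Input n k) (ℓ : Fin n) (t : ℝ≥0∞) (N : ℕ) : Finset ℕ :=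
  {j ∈ Finset.range N | ℓ ∈ π.jobRoute I j ∧ I.jobArrival j ≤ t}

lemma tasksUntil_succ (I : Input n k) (ℓ : Fin n) (t : ℝ≥0∞) (N : ℕ) (w : ℕ → ℝ≥0∞) [Decidable (ℓ ∈ π.jobRoute I N ∧ I.jobArrival N ≤ t)] :
    ∏ j ∈ π.tasksUntil I ℓ t (N + 1), w j =
      (∏ j ∈ π.tasksUntil I ℓ t N, w j) *
        if ℓ ∈ π.jobRoute I N ∧ I.jobArrival N ≤ t then w N else 1 := by
  classical
  simp only [tasksUntil, Finset.prod_filter, Finset.prod_range_succ]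
  congr

lemma tasksUntil_congr {I I' : Input n k} (hg : I.gap = I'.gap) (hc : I.coin = I'.coin) {N : ℕ}
    (hs : ∀ j, j + 1 < N → ∀ ℓ, I.service (j, ℓ) = I'.service (j, ℓ)) (ℓ : Fin n) (t : ℝ≥0∞) :
    π.tasksUntil I ℓ t N = π.tasksUntil I' ℓ t N := by
  classical
  refine Finset.filter_congr fun j hj => ?_
  have hj := Finset.mem_range.1 hj
  rw [π.jobRoute_congr hg hc (m := j) fun i hi => hs i (by omega), Input.jobArrival_congr hg]

/-- Whether a job has a task at a server does not depend on the service time of that task. -/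
lemma lintegral_prod_tasksUntil (lam : Fin k → ℝ) (ℓ : Fin n) (t : ℝ≥0∞) (N : ℕ)
    {h : ℝ≥0∞ → ℝ≥0∞} (hh : Measurable h) (h1 : ∫⁻ y, h y ∂expTime 1 = 1) :
    Measurable (fun ω : Sample n k => ∏ j ∈ π.tasksUntil ω.input ℓ t N, h (ω.2.1 (j, ℓ))) ∧
    ∫⁻ ω, ∏ j ∈ π.tasksUntil ω.input ℓ t N, h (ω.2.1 (j, ℓ)) ∂sampleLaw n lam = 1 := by
  classical
  induction N with
  | zero => simp [tasksUntil]
  | succ N ih =>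
    obtain ⟨ihm, ih⟩ := ih
    have hA : MeasurableSet {ω : Sample n k | ℓ ∈ π.jobRoute ω.input N ∧ ω.input.jobArrival N ≤ t} :=
      (π.measurableSet_mem_jobRoute N ℓ).inter
        (measurableSet_le (measurable_jobArrival N) measurable_const)
    obtain ⟨H, hHdef⟩ : ∃ H : Sample n k → ℝ≥0∞ → ℝ≥0∞, H = fun ω y =>
      (∏ j ∈ π.tasksUntil ω.input ℓ t N, h (ω.2.1 (j, ℓ))) *
        if ℓ ∈ π.jobRoute ω.input N ∧ ω.input.jobArrival N ≤ t then h y else 1 := ⟨_, rfl⟩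
    have hH : Measurable fun z : Sample n k × ℝ≥0∞ => H z.1 z.2 := by
      rw [hHdef]
      exact (ihm.comp measurable_fst).mul (Measurable.ite (hA.preimage measurable_fst)
        (hh.comp measurable_snd) measurable_const)
    have hHe : (fun ω : Sample n k => ∏ j ∈ π.tasksUntil ω.input ℓ t (N + 1), h (ω.2.1 (j, ℓ))) =
        fun ω => H ω (ω.2.1 (N, ℓ)) := by
      funext ω
      rw [hHdef]
      exact π.tasksUntil_succ ω.input ℓ t N fun j => h (ω.2.1 (j, ℓ))
    have hm : Measurable fun ω : Sample n k => H ω (ω.2.1 (N, ℓ)) :=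
      hH.comp (measurable_id.prodMk (by fun_prop))
    rw [hHe]
    refine ⟨hm, ?_⟩
    rw [lintegral_sampleLaw_service lam (N, ℓ) hH]
    · rw [← ih]
      refine lintegral_congr fun ω => ?_
      simp only [hHdef]
      split_ifs
      · rw [lintegral_const_mul _ hh, h1, mul_one]
      · simp
    · intro ω y y'
      have hs : ∀ j < N, ∀ ℓ', Function.update ω.2.1 (N, ℓ) y (j, ℓ') = ω.2.1 (j, ℓ') :=
        fun j hj ℓ' => Function.update_of_ne (fun h => hj.ne (congrArg Prod.fst h)) _ _
      simp only [hHdef]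
      let I' : Input n k := Sample.input (ω.1, Function.update ω.2.1 (N, ℓ) y, ω.2.2)
      have e1 : π.tasksUntil I' ℓ t N = π.tasksUntil ω.input ℓ t N :=
        π.tasksUntil_congr (I := I') (I' := ω.input) rfl rfl (fun j hj ℓ' => hs j (by omega) ℓ') ℓ t
      have e2 : π.jobRoute I' N = π.jobRoute ω.input N := π.jobRoute_congr (I := I') (I' := ω.input) rfl rfl hs
      have e3 : I'.jobArrival = ω.input.jobArrival := Input.jobArrival_congr (I := I') (I' := ω.input) rfl
      simp only [I'] at e1 e2 e3
      rw [e1, e2, e3]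
      congr 1
      refine Finset.prod_congr rfl fun j hj => ?_
      rw [hs j (Finset.mem_range.1 (Finset.mem_filter.1 hj).1)]

/-- If few jobs are in the system, then most tasks have departed. -/
lemma le_prod_tasksUntil (I : Input n k) (ℓ : Fin n) (t : ℝ≥0) (N c : ℕ) {θ δ : ℝ} (hθ : 0 ≤ θ)
    (hδ0 : 0 < δ) (hδ1 : δ ≤ 1) (hc : π.jobsInSystem I t ≤ c) :
    Real.exp (-(θ * t)) * δ ^ c ≤
      ∏ j ∈ π.tasksUntil I ℓ t N, (Real.exp (-(θ * (I.service (j, ℓ)).toReal)) + δ) := by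
  classical
  set T := π.tasksUntil I ℓ t N with hT
  have hTmem : ∀ j ∈ T, ℓ ∈ π.jobRoute I j ∧ I.jobArrival j ≤ t := fun j hj =>
    (Finset.mem_filter.1 hj).2
  rw [← Finset.prod_filter_mul_prod_filter_not T fun j => π.taskDeparture I j ℓ ≤ t]
  set D := T.filter fun j => π.taskDeparture I j ℓ ≤ t with hD
  set U := T.filter fun j => ¬ π.taskDeparture I j ℓ ≤ t with hU
  refine mul_le_mul ?_ ?_ (by positivity) (Finset.prod_nonneg fun j _ => by positivity)
  · have h1 := π.sum_service_departed_le I t ℓ D fun j hj =>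
      ⟨(hTmem j (Finset.mem_filter.1 hj).1).1, (Finset.mem_filter.1 hj).2⟩
    have h2 : ∑ j ∈ D, (I.service (j, ℓ)).toReal ≤ t := by
      rw [← ENNReal.toReal_sum fun j hj => ne_top_of_le_ne_top ENNReal.coe_ne_top
        ((Finset.single_le_sum (fun _ _ => zero_le) hj).trans h1)]
      exact ENNReal.toReal_mono ENNReal.coe_ne_top h1
    calc Real.exp (-(θ * t)) ≤ Real.exp (∑ j ∈ D, -(θ * (I.service (j, ℓ)).toReal)) := by
          rw [Finset.sum_neg_distrib, ← Finset.mul_sum]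
          exact Real.exp_le_exp.2 (neg_le_neg (mul_le_mul_of_nonneg_left h2 hθ))
      _ = ∏ j ∈ D, Real.exp (-(θ * (I.service (j, ℓ)).toReal)) := Real.exp_sum _ _
      _ ≤ _ := Finset.prod_le_prod (fun _ _ => (Real.exp_pos _).le) fun j _ => by linarith
  · have h1 : U.card ≤ c := by
      have h2 : (U : Set ℕ) ⊆ {m : ℕ | I.jobArrival m ≤ (t : ℝ≥0∞) ∧
          (t : ℝ≥0∞) < π.jobCompletion I m} := by
        intro j hj
        obtain ⟨hj1, hj2⟩ := Finset.mem_filter.1 (Finset.mem_coe.1 hj)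
        refine ⟨(hTmem j hj1).2, not_le.1 fun h => hj2 ?_⟩
        exact (π.jobCompletion_le_iff I).1 h ℓ (hTmem j hj1).1
      have h3 := (Set.encard_le_encard h2).trans hc
      rw [Set.encard_coe_eq_coe_finsetCard] at h3
      exact_mod_cast h3
    calc δ ^ c ≤ δ ^ U.card := pow_le_pow_of_le_one hδ0.le hδ1 h1
      _ = ∏ j ∈ U, δ := (Finset.prod_const δ).symm
      _ ≤ _ := Finset.prod_le_prod (fun _ _ => hδ0.le) fun j _ => by
        have := Real.exp_pos (-(θ * (I.service (j, ℓ)).toReal))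
        linarith

lemma measure_le_card_tasksUntil_le {ε : ℝ} (hε : 0 < ε) :
    ∃ C γ : ℝ, 0 < γ ∧ ∀ (lam : Fin k → ℝ) (ℓ : Fin n) (t c N : ℕ),
      sampleLaw n lam {ω | π.jobsInSystem ω.input (t : ℝ≥0) ≤ c ∧
        (1 + ε) * t ≤ (π.tasksUntil ω.input ℓ t N).card} ≤
      ENNReal.ofReal (C ^ c * Real.exp (-γ) ^ t) := by
  obtain ⟨θ, δ, κ, hθ, hδ0, hδ1, hκ0, hκ1, hκ, hneg⟩ : ∃ θ δ κ : ℝ, 0 < θ ∧ 0 < δ ∧ δ ≤ 1 ∧ 0 < κ ∧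
      κ ≤ 1 ∧ κ = 1 / (1 + θ) + δ ∧ θ + (1 + ε) * (κ - 1) < 0 := by
    refine ⟨ε / 2, (ε / 2) ^ 2 / (2 * (1 + ε / 2) * (1 + ε)), _, by positivity, by positivity, ?_,
      by positivity, ?_, rfl, ?_⟩
    · rw [div_le_one (by positivity)]
      nlinarith
    · rw [div_add_div _ _ (by positivity) (by positivity), div_le_one (by positivity)]
      nlinarith [mul_pos hε hε, mul_pos (mul_pos hε hε) hε]
    · have h1 : ε / 2 + (1 + ε) * (1 / (1 + ε / 2) + (ε / 2) ^ 2 / (2 * (1 + ε / 2) * (1 + ε)) - 1) =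
          -((ε / 2) ^ 2 / (2 * (1 + ε / 2))) := by
        field_simp
        ring
      rw [h1, neg_lt_zero]
      positivity
  refine ⟨δ⁻¹, -(θ + (1 + ε) * (κ - 1)), by linarith, fun lam ℓ t c N => ?_⟩
  let h : ℝ≥0∞ → ℝ≥0∞ := fun y => ENNReal.ofReal ((Real.exp (-(θ * y.toReal)) + δ) / κ)
  have hh : Measurable h := by fun_prop
  have h1 : ∫⁻ y, h y ∂expTime 1 = 1 := by
    have h2 : ∀ y, h y = (ENNReal.ofReal (Real.exp (-θ * y.toReal)) + ENNReal.ofReal δ) *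
        ENNReal.ofReal κ⁻¹ := fun y => by
      rw [← ENNReal.ofReal_add (Real.exp_pos _).le hδ0.le, ← ENNReal.ofReal_mul (by positivity),
        neg_mul, ← div_eq_mul_inv]
    simp only [h2]
    rw [lintegral_mul_const _ (by fun_prop), lintegral_add_left (by fun_prop),
      lintegral_exp_expTime one_pos (by linarith), lintegral_const, measure_univ, mul_one,
      sub_neg_eq_add, ← ENNReal.ofReal_add (by positivity) hδ0.le, ← hκ,
      ← ENNReal.ofReal_mul hκ0.le, mul_inv_cancel₀ hκ0.ne', ENNReal.ofReal_one]
  obtain ⟨hm, hi⟩ := π.lintegral_prod_tasksUntil lam ℓ t N hh h1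
  set b : ℝ := δ ^ c * Real.exp (-(θ + (1 + ε) * (κ - 1))) ^ t with hb
  have hb0 : 0 < b := by positivity
  have hsub : {ω : Sample n k | π.jobsInSystem ω.input (t : ℝ≥0) ≤ c ∧
        (1 + ε) * t ≤ (π.tasksUntil ω.input ℓ t N).card} ⊆
      {ω | ENNReal.ofReal b ≤ ∏ j ∈ π.tasksUntil ω.input ℓ t N, h (ω.2.1 (j, ℓ))} := by
    rintro ω ⟨hω1, hω2⟩
    change ENNReal.ofReal b ≤ ∏ j ∈ π.tasksUntil ω.input ℓ t N, h (ω.2.1 (j, ℓ))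
    rw [← ENNReal.ofReal_prod_of_nonneg fun j _ => by positivity, Finset.prod_div_distrib,
      Finset.prod_const]
    refine ENNReal.ofReal_le_ofReal ?_
    have h2 := π.le_prod_tasksUntil ω.input ℓ t N c hθ.le hδ0 hδ1 hω1
    rw [ENNReal.coe_natCast] at h2
    rw [le_div_iff₀ (by positivity)]
    refine le_trans ?_ h2
    set K := (π.tasksUntil ω.input ℓ t N).card
    have h3 : κ ^ K ≤ Real.exp ((1 + ε) * (κ - 1) * t) := by
      calc κ ^ K ≤ Real.exp (κ - 1) ^ K := pow_le_pow_left₀ hκ0.le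
            (by linarith [Real.add_one_le_exp (κ - 1)]) K
        _ = Real.exp (K * (κ - 1)) := (Real.exp_nat_mul _ _).symm
        _ ≤ _ := by
          rw [Real.exp_le_exp]
          nlinarith
    calc b * κ ^ K ≤ b * Real.exp ((1 + ε) * (κ - 1) * t) := by gcongr
      _ = Real.exp (-(θ * t)) * δ ^ c := by
        rw [hb, ← Real.exp_nat_mul, mul_assoc, ← Real.exp_add, mul_comm]
        congr 2
        ring
      _ = _ := by simp
  refine (measure_mono hsub).trans ?_
  have h4 := mul_meas_ge_le_lintegral₀ (μ := sampleLaw n lam) hm.aemeasurable (ENNReal.ofReal b)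
  rw [hi, mul_comm] at h4
  have h5 := ENNReal.le_div_iff_mul_le (Or.inl (ENNReal.ofReal_pos.2 hb0).ne')
    (Or.inl ENNReal.ofReal_ne_top) |>.2 h4
  refine h5.trans (le_of_eq ?_)
  rw [one_div, ← ENNReal.ofReal_inv_of_pos hb0, hb, mul_inv, ← inv_pow, ← inv_pow,
    ← Real.exp_neg]

end Policy

end TaskBound

/-! ### A stable policy yields a splitting of the rates -/

lemma lintegral_expE_typeArrival {n k : ℕ} {lam : Fin k → ℝ} {i : Fin k} {θ : ℝ}
    (hi : 0 < lam i) (hθ : θ < lam i) (q : ℕ) :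
    ∫⁻ ω, expE θ (ω.input.typeArrival i q) ∂sampleLaw n lam =
      ENNReal.ofReal ((lam i / (lam i - θ)) ^ (q + 1)) := by
  have h1 : ∀ ω : Sample n k, expE θ (ω.input.typeArrival i q) =
      ∏ p ∈ ({i} : Finset (Fin k)) ×ˢ Finset.range (q + 1), expE θ (ω.1 p) := fun ω => by
    rw [Finset.prod_product, Finset.prod_singleton]
    exact expE_sum θ _ _
  simp only [h1]
  have hpos : 0 < lam i - θ := by linarith
  rw [lintegral_sampleLaw_gap lam (h := fun g => ∏ p ∈ ({i} : Finset (Fin k)) ×ˢ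
    Finset.range (q + 1), expE θ (g p))
    (Finset.measurable_prod _ fun p _ => (measurable_expE θ).comp (measurable_pi_apply p)),
    allGapLaw, lintegral_infinitePi_prod _ _ fun _ => measurable_expE θ, Finset.prod_product,
    Finset.prod_singleton, Finset.prod_congr rfl fun _ _ => lintegral_expE hi hθ,
    Finset.prod_const, Finset.card_range, ENNReal.ofReal_pow (by positivity)]

/-- A Poisson process of rate `r` has, with high probability, at least `(r - ε) t` points until
time `t`. -/
lemma measure_lt_typeArrival_le {n k : ℕ} {lam : Fin k → ℝ} {i : Fin k} {ε : ℝ} (hε : 0 < ε)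
    (hi : ε < lam i) :
    ∃ C γ : ℝ, 0 < γ ∧ ∀ t : ℕ, sampleLaw n lam
      {ω | (t : ℝ≥0∞) < ω.input.typeArrival i (⌈(lam i - ε) * t⌉₊ - 1)} ≤
      ENNReal.ofReal (C * Real.exp (-γ) ^ t) := by
  set r := lam i with hr
  set θ := ε / 2 with hθ
  have hθ0 : 0 < θ := by positivity
  have hrθ : 0 < r - θ := by linarith
  set β := θ / (r - θ) with hβ
  have hβ0 : 0 < β := by positivity
  have hgap : 0 < θ - β * (r - ε) := by
    rw [hβ, div_mul_eq_mul_div, sub_pos, div_lt_iff₀ hrθ]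
    nlinarith
  refine ⟨Real.exp β, θ - β * (r - ε), hgap, fun t => ?_⟩
  set q := ⌈(r - ε) * t⌉₊ - 1 with hq
  have hq1 : ((q + 1 : ℕ) : ℝ) ≤ (r - ε) * t + 1 := by
    have h0 : 0 ≤ (r - ε) * t := mul_nonneg (by linarith) (Nat.cast_nonneg t)
    rcases Nat.eq_zero_or_pos ⌈(r - ε) * (t : ℝ)⌉₊ with h | h
    · rw [hq, h]
      simpa using h0
    · rw [hq, Nat.sub_add_cancel h]
      exact (Nat.ceil_lt_add_one h0).le
  have h1 := measure_lt_le_of_expE (sampleLaw n lam) hθ0.le (measurable_typeArrival i q) (t : ℝ≥0)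
    (lintegral_expE_typeArrival (n := n) (lam := lam) (i := i) (by linarith) (by linarith) q).le
  rw [ENNReal.coe_natCast] at h1
  refine h1.trans (ENNReal.ofReal_le_ofReal ?_)
  have h2 : r / (r - θ) ≤ Real.exp β := by
    refine le_trans (le_of_eq ?_) (Real.add_one_le_exp β)
    rw [hβ]
    field_simp
    ring
  have h3 : 0 ≤ r / (r - θ) := div_nonneg (by linarith) hrθ.le
  calc Real.exp (-(θ * ((t : ℝ≥0) : ℝ))) * (r / (r - θ)) ^ (q + 1)
      ≤ Real.exp (-(θ * ((t : ℝ≥0) : ℝ))) * Real.exp β ^ (q + 1) := by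
        gcongr
    _ ≤ Real.exp (β + t * -(θ - β * (r - ε))) := by
        rw [← Real.exp_nat_mul, ← Real.exp_add, Real.exp_le_exp, NNReal.coe_natCast]
        nlinarith
    _ = _ := by rw [Real.exp_add, Real.exp_nat_mul]

namespace Policy

variable {n k : ℕ} [NeZero k] {M : CodedSystem n k} (π : Policy M)

lemma jobRoute_mem (I : Input n k) (j : ℕ) : π.jobRoute I j ∈ M.recoverySets (I.jobType j) := by
  change π.route j (historyOf I j (π.records I j)) ∈ _
  have h := π.route_mem j (historyOf I j (π.records I j))
  simpa only [historyOf, Fin.val_last] using h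

/-- Under a stable policy, the system shows a typical behaviour for some outcome and time. -/
lemma IsStable.exists_typical {lam : Fin k → ℝ} (hπ : π.IsStable lam) {ε : ℝ} (hε : 0 < ε) :
    ∃ (ω : Sample n k) (t N : ℕ), 0 < t ∧ (t : ℝ≥0∞) < ω.input.jobArrival N ∧
      (∀ i, ε < lam i → ω.input.typeArrival i (⌈(lam i - ε) * t⌉₊ - 1) ≤ t) ∧
      ∀ ℓ, (π.tasksUntil ω.input ℓ t N).card ≤ (1 + ε) * t := by
  classical
  obtain ⟨L, hL, hL0⟩ := hπ
  have h8 : (0 : ℝ≥0∞) < 1 / 8 := by simp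
  obtain ⟨c, hc⟩ := (hL0.eventually (gt_mem_nhds h8)).exists
  have ev1 : ∀ᶠ t : ℕ in atTop,
      sampleLaw n lam {ω | (c : ℕ∞) < π.jobsInSystem ω.input (t : ℝ≥0)} < 1 / 8 :=
    ((hL c).comp tendsto_natCast_atTop_atTop).eventually (gt_mem_nhds hc)
  obtain ⟨C, γ, hγ, htask⟩ := π.measure_le_card_tasksUntil_le hε
  have hlim : ∀ C γ : ℝ, 0 < γ →
      Tendsto (fun t : ℕ => ENNReal.ofReal (C * Real.exp (-γ) ^ t)) atTop (𝓝 0) := by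
    intro C γ hγ
    rw [← ENNReal.ofReal_zero, ← mul_zero C]
    exact ENNReal.tendsto_ofReal ((tendsto_pow_atTop_nhds_zero_of_lt_one (Real.exp_pos _).le
      (by rw [Real.exp_lt_one_iff]; linarith)).const_mul C)
  have ev2 : ∀ᶠ t : ℕ in atTop, ∑ _ℓ : Fin n, ENNReal.ofReal (C ^ c * Real.exp (-γ) ^ t) < 1 / 8 := by
    have h := tendsto_finsetSum (Finset.univ : Finset (Fin n)) fun _ _ => hlim (C ^ c) γ hγ
    rw [Finset.sum_const_zero] at h
    exact h.eventually (gt_mem_nhds h8)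
  have ev3 : ∀ᶠ t : ℕ in atTop, ∑ i, sampleLaw n lam {ω | ε < lam i ∧
      (t : ℝ≥0∞) < ω.input.typeArrival i (⌈(lam i - ε) * t⌉₊ - 1)} < 1 / 8 := by
    have h : Tendsto (fun t : ℕ => ∑ i, sampleLaw n lam {ω | ε < lam i ∧
        (t : ℝ≥0∞) < ω.input.typeArrival i (⌈(lam i - ε) * t⌉₊ - 1)}) atTop
        (𝓝 (∑ _i : Fin k, 0)) := by
      refine tendsto_finsetSum _ fun i _ => ?_
      by_cases hi : ε < lam i
      · obtain ⟨C, γ, hγ, h⟩ := measure_lt_typeArrival_le (n := n) hε hi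
        simp only [hi, true_and]
        exact tendsto_of_tendsto_of_tendsto_of_le_of_le tendsto_const_nhds (hlim C γ hγ)
          (fun _ => zero_le) h
      · simp [hi]
    rw [Finset.sum_const_zero] at h
    exact h.eventually (gt_mem_nhds h8)
  obtain ⟨t, ⟨⟨h1, h2⟩, h3⟩, ht⟩ := (((ev1.and ev2).and ev3).and (eventually_gt_atTop 0)).exists
  obtain ⟨N, h4⟩ := ((tendsto_measure_lt_totalAt (n := n) lam t).eventually
    (gt_mem_nhds h8)).exists
  by_contra hcon
  push Not at hcon
  let B1 : Set (Sample n k) := {ω | (c : ℕ∞) < π.jobsInSystem ω.input (t : ℝ≥0)}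
  let B2 : Fin n → Set (Sample n k) := fun ℓ => {ω | π.jobsInSystem ω.input (t : ℝ≥0) ≤ c ∧
    (1 + ε) * t ≤ (π.tasksUntil ω.input ℓ t N).card}
  let B3 : Fin k → Set (Sample n k) := fun i => {ω | ε < lam i ∧
      (t : ℝ≥0∞) < ω.input.typeArrival i (⌈(lam i - ε) * t⌉₊ - 1)}
  let B4 : Set (Sample n k) := {ω | N < ω.totalAt t}
  have hcover : (univ : Set (Sample n k)) ≤ᵐ[sampleLaw n lam]
      (B1 ∪ (⋃ ℓ, B2 ℓ) ∪ ((⋃ i, B3 i) ∪ B4) : Set (Sample n k)) := by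
    filter_upwards [ae_countAt (n := n) lam (ENNReal.natCast_ne_top t)] with ω hω _
    change ω ∈ B1 ∪ (⋃ ℓ, B2 ℓ) ∪ ((⋃ i, B3 i) ∪ B4)
    by_contra hB
    simp only [mem_union, mem_iUnion, not_or, not_exists] at hB
    obtain ⟨⟨hB1, hB2⟩, hB3, hB4⟩ := hB
    have e4 : (t : ℝ≥0∞) < ω.input.jobArrival N := (hω.lt_jobArrival_iff).2 (not_lt.1 hB4)
    obtain ⟨ℓ, hℓ⟩ := hcon ω t N ht e4 fun i hi => not_lt.1 fun h => hB3 i ⟨hi, h⟩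
    exact hB2 ℓ ⟨not_lt.1 hB1, hℓ.le⟩
  have hle := measure_mono_ae hcover
  have hb2 : sampleLaw n lam (⋃ ℓ, B2 ℓ) ≤ 1 / 8 :=
    (measure_iUnion_fintype_le _ _).trans ((Finset.sum_le_sum fun ℓ _ => htask lam ℓ t c N).trans
      h2.le)
  have hb3 : sampleLaw n lam (⋃ i, B3 i) ≤ 1 / 8 := (measure_iUnion_fintype_le _ _).trans h3.le
  have hsum : sampleLaw n lam (B1 ∪ (⋃ ℓ, B2 ℓ) ∪ ((⋃ i, B3 i) ∪ B4)) ≤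
      (1 / 8 + 1 / 8) + (1 / 8 + 1 / 8) :=
    (measure_union_le _ _).trans (add_le_add
      ((measure_union_le _ _).trans (add_le_add h1.le hb2))
      ((measure_union_le _ _).trans (add_le_add hb3 h4.le)))
  rw [measure_univ] at hle
  have hlt : (1 / 8 + 1 / 8 + (1 / 8 + 1 / 8) : ℝ≥0∞) < 1 := by
    rw [← ENNReal.toReal_lt_toReal (by finiteness) (by finiteness)]
    norm_num [ENNReal.toReal_add]
  exact (hle.trans hsum).not_gt hlt

/-- The rates under which a policy is stable lie in the polyhedral region. -/
lemma IsStable.mem_codedRegion {lam : Fin k → ℝ} (hπ : π.IsStable lam) (h0 : ∀ i, 0 ≤ lam i) :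
    lam ∈ M.codedRegion := by
  classical
  refine M.mem_codedRegion_of_forall_pos h0 fun ε hε => ?_
  obtain ⟨ω, t, N, ht, hN, harr, htask⟩ := hπ.exists_typical π hε
  set I := ω.input
  have ht' : (0 : ℝ) < t := Nat.cast_pos.2 ht
  let S : Finset ℕ := {j ∈ Finset.range N | I.jobArrival j ≤ t}
  have hS : ∀ i R, ({j ∈ S | I.jobType j = i ∧ π.jobRoute I j = R}.card : ℝ) =
      ∑ j ∈ S, if I.jobType j = i ∧ π.jobRoute I j = R then 1 else 0 := fun i R => by
    rw [Finset.sum_boole]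
  refine ⟨fun i R => ({j ∈ S | I.jobType j = i ∧ π.jobRoute I j = R}.card : ℝ) / t,
    fun i R _ => by positivity, fun i => ?_, fun ℓ => ?_⟩
  · rw [← Finset.sum_div, le_div_iff₀ ht']
    simp only [hS]
    rw [Finset.sum_comm]
    have h1 : ∀ j ∈ S, ∑ R ∈ M.recoverySets i,
        (if I.jobType j = i ∧ π.jobRoute I j = R then (1 : ℝ) else 0) =
        if I.jobType j = i then 1 else 0 := by
      intro j _
      by_cases hj : I.jobType j = i
      · subst hj
        simp [π.jobRoute_mem I j]
      · simp [hj]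
    rw [Finset.sum_congr rfl h1, Finset.sum_filter]
    rw [I.sum_range_jobs (fun i' s => if s ≤ t then if i' = i then (1 : ℝ) else 0 else 0) N]
    rcases le_or_gt (lam i) ε with hi | hi
    · exact (mul_nonpos_of_nonpos_of_nonneg (by linarith) ht'.le).trans
        (Finset.sum_nonneg fun _ _ => Finset.sum_nonneg fun _ _ => by positivity)
    · set a := ⌈(lam i - ε) * t⌉₊ with ha
      have ha0 : 0 < a := Nat.ceil_pos.2 (mul_pos (by linarith) ht')
      have h2 : a - 1 < I.counts N i := I.lt_counts_of_typeArrival_lt hN (harr i hi)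
      calc (lam i - ε) * t ≤ a := Nat.le_ceil _
        _ = ∑ q ∈ Finset.range a, (if I.typeArrival i q ≤ t then if i = i then (1 : ℝ) else 0
              else 0) := by
            rw [Finset.sum_congr rfl fun q hq => ?_, Finset.sum_const, Finset.card_range,
              nsmul_eq_mul, mul_one]
            have hq := Finset.mem_range.1 hq
            rw [if_pos ((I.typeArrival_mono i (by omega)).trans (harr i hi)), if_pos rfl]
        _ ≤ ∑ q ∈ Finset.range (I.counts N i), (if I.typeArrival i q ≤ t then
              if i = i then (1 : ℝ) else 0 else 0) :=
            Finset.sum_le_sum_of_subset_of_nonneg (Finset.range_mono (by omega))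
              fun _ _ _ => by positivity
        _ ≤ _ := Finset.single_le_sum (f := fun i' => ∑ q ∈ Finset.range (I.counts N i'),
              (if I.typeArrival i' q ≤ t then if i' = i then (1 : ℝ) else 0 else 0))
              (fun _ _ => Finset.sum_nonneg fun _ _ => by positivity) (Finset.mem_univ i)
  · simp only [← Finset.sum_div]
    rw [div_le_iff₀ ht']
    refine le_trans ?_ (htask ℓ)
    simp only [hS]
    rw [Finset.sum_congr rfl fun i _ => Finset.sum_comm, Finset.sum_comm]
    have h1 : ∀ j ∈ S, ∑ i, ∑ R ∈ M.recoverySets i with ℓ ∈ R,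
        (if I.jobType j = i ∧ π.jobRoute I j = R then (1 : ℝ) else 0) =
        if ℓ ∈ π.jobRoute I j then 1 else 0 := by
      intro j _
      rw [Finset.sum_eq_single (I.jobType j) (fun i _ hi => by simp [hi.symm]) (by simp)]
      simp [π.jobRoute_mem I j]
    rw [Finset.sum_congr rfl h1, Finset.sum_boole, Finset.filter_filter, Policy.tasksUntil]
    simp only [and_comm, le_refl]

end Policy

end CodedCloud

theorem mainTheorem1 {n k : ℕ} [NeZero k] (M : CodedCloud.CodedSystem n k) :
    -- the service capacity region is the polyhedral region
    M.serviceCapacityRegion = M.codedRegion ∧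
    -- in its interior some routing policy is stable, outside of it no routing policy is stable
    interior M.codedRegion ⊆ M.stabilizable ∧
    (∀ lam : Fin k → ℝ, (∀ i, 0 ≤ lam i) → lam ∉ M.codedRegion →
      ∀ π : CodedCloud.Policy M, ¬ π.IsStable lam) ∧
    -- the criterion in terms of the residual capacities, sorted by `σ`
    ((M.nCoded = 0 ∨ k ≤ M.nCoded) →
      ∀ lam : Fin k → ℝ, (∀ i, 0 ≤ lam i) →
      ∀ σ : Equiv.Perm (Fin k), Monotone (fun i => M.residual lam (σ i)) →
        (lam ∈ M.codedRegion ↔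
          ∑ i, -min (M.residual lam i) 0 ≤
            ⨅ k₀ : Fin k, ((M.nCoded : ℝ) + ∑ i ∈ Finset.Iic k₀, max (M.residual lam (σ i)) 0) /
              ((k₀ : ℝ) + 1))) := by
  have hconv : ∀ {lam : Fin k → ℝ}, (∀ i, 0 ≤ lam i) → ∀ π : CodedCloud.Policy M,
      π.IsStable lam → lam ∈ M.codedRegion := fun h0 π hπ => hπ.mem_codedRegion π h0
  refine ⟨Set.Subset.antisymm ?_ ?_, M.interior_codedRegion_subset_stabilizable,
    fun lam h0 hlam π hπ => hlam (hconv h0 π hπ),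
    fun hc lam h0 σ hσ => M.mem_codedRegion_iff hc h0 σ hσ⟩
  · exact closure_minimal (fun lam ⟨h0, π, hπ⟩ => hconv h0 π hπ) M.isClosed_codedRegion
  · rw [← M.closure_interior_codedRegion]
    exact closure_mono M.interior_codedRegion_subset_stabilizable
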